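/- Let $n\ge 0$ and let $M$ be a nonempty compact smooth ($C^\infty$, Hausdorff, without boundary) manifold of real dimension $4n$. Let $(J,\omega_{\mathbb C})$ be a complex symplectic structure on $M$: $J$ is an integrable almost complex structure on $M$ and $\omega_{\mathbb C}\in\Omega^2(M,\mathbb C)$ is a closed non-degenerate $2$-form of bidegree $(2,0)$ with respect to $J$. Put $X=(M,J)$, write $\Omega^{p,q}=\Omega^{p,q}(X)$ for the smooth complex-valued forms of type $(p,q)$ and $d=\partial+\bar\partial$, and let $$H^{p,q}_{\bar\partial}(X)=\frac{\operatorname{Ker}\bar\partial}{\operatorname{Im}\bar\partial},\quad H^{p,q}_{\partial}(X)=\frac{\operatorname{Ker}\partial}{\operatorname{Im}\partial},\quad H^{p,q}_{BC}(X)=\frac{\operatorname{Ker}\partial\cap\operatorname{Ker}\bar\partial}{\operatorname{Im}\partial\bar\partial},\quad H^{p,q}_{A}(X)=\frac{\operatorname{Ker}\partial\bar\partial}{\operatorname{Im}\partial+\operatorname{Im}\bar\partial}$$ (in bidegree $(p,q)$) be the Dolbeault, $\partial$-, Bott–Chern and Aeppli cohomologies, of complex dimensions $h^{p,q}_{\bar\partial}$,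 $h^{p,q}_{\partial}$, $h^{p,q}_{BC}$, $h^{p,q}_{A}$. Then for all integers $0\le k,m\le n$ the form $\omega_{\mathbb C}^k\wedge\bar\omega_{\mathbb C}^m$ is a cocycle for, and defines a nonzero class in, each of $$H^{2(k+m)}_{dR}(M;\mathbb C),\quad H^{2k,2m}_{\bar\partial}(X),\quad H^{2k,2m}_{\partial}(X),\quad H^{2k,2m}_{BC}(X),\quad H^{2k,2m}_{A}(X).$$ In particular $h^{2k,2m}_{\bar\partial}(X)\ge1$, $h^{2k,2m}_{\partial}(X)\ge1$, $h^{2k,2m}_{BC}(X)\ge1$ and $h^{2k,2m}_{A}(X)\ge1$ for all $0\le k,m\le n$. -/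

import Mathlib

open scoped Manifold ContDiff

noncomputable section

namespace ComplexSymplectic

theorem sum_exp_aux (k : ℕ) (d : ℤ) (hd : |d| ≤ k) :
    ∑ j ∈ Finset.range (k + 1), Complex.exp (2 * d * (Real.pi * j / (k + 1) : ℝ) * Complex.I) =
      if d = 0 then (k + 1 : ℂ) else 0 := by
  have hk : (k + 1 : ℂ) ≠ 0 := by exact_mod_cast Nat.succ_ne_zero k
  have : ∀ j : ℕ, Complex.exp (2 * d * (Real.pi * j / (k + 1) : ℝ) * Complex.I) =
      Complex.exp (2 * Real.pi * Complex.I * d / (k + 1)) ^ j := by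
    intro j
    rw [← Complex.exp_nat_mul]
    congr 1
    push_cast
    ring
  simp only [this]
  split_ifs with h
  · simp [h]
  · have hne : Complex.exp (2 * Real.pi * Complex.I * d / (k + 1)) ≠ 1 := by
      intro h1
      rw [Complex.exp_eq_one_iff] at h1
      obtain ⟨n, hn⟩ := h1
      have h2 : (2 * Real.pi * Complex.I : ℂ) ≠ 0 := Complex.two_pi_I_ne_zero
      have h3 : (d : ℂ) = n * (k + 1) := by
        field_simp at hn
        apply mul_left_cancel₀ h2
        linear_combination (2 * Real.pi * Complex.I) * hn
      have h4 : d = n * (k + 1) := by exact_mod_cast h3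
      have hn0 : n ≠ 0 := by rintro rfl; simp at h4; exact h h4
      have : (k + 1 : ℤ) ≤ |d| := by
        rw [h4, abs_mul, abs_of_nonneg (by positivity : (0 : ℤ) ≤ k + 1)]
        have := Int.one_le_abs hn0
        nlinarith
      omega
    rw [geom_sum_eq hne, ← Complex.exp_nat_mul]
    have : ((k + 1 : ℕ) : ℂ) * (2 * Real.pi * Complex.I * d / (k + 1)) =
        d * (2 * Real.pi * Complex.I) := by
      push_cast
      field_simp
    rw [this, Complex.exp_int_mul_two_pi_mul_I]
    simp

section Pointwise

variable {V : Type*} [AddCommGroup V] [Module ℝ V] [TopologicalSpace V]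

/-- The product `v ↦ a (v₁, …, v_k) * b (v_{k+1}, …, v_{k+l})`, as a multilinear map. -/
def mulForms {k l : ℕ} (a : V [⋀^Fin k]→L[ℝ] ℂ) (b : V [⋀^Fin l]→L[ℝ] ℂ) :
    ContinuousMultilinearMap ℝ (fun _ : Fin (k + l) => V) ℂ where
  toMultilinearMap :=
    ((LinearMap.mul' ℝ ℂ).compMultilinearMap (MultilinearMap.domCoprod
      a.toAlternatingMap.toMultilinearMap b.toAlternatingMap.toMultilinearMap)).domDomCongr
      finSumFinEquiv
  cont := by
    change Continuous fun v : Fin (k + l) → V =>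
      a (fun i => v (finSumFinEquiv (Sum.inl i))) * b (fun i => v (finSumFinEquiv (Sum.inr i)))
    exact (a.cont.comp (continuous_pi fun _ => continuous_apply _)).mul
      (b.cont.comp (continuous_pi fun _ => continuous_apply _))

theorem mulForms_apply {k l : ℕ} (a : V [⋀^Fin k]→L[ℝ] ℂ) (b : V [⋀^Fin l]→L[ℝ] ℂ)
    (v : Fin (k + l) → V) :
    mulForms a b v = a (fun i => v (Fin.castAdd l i)) * b (fun i => v (Fin.natAdd k i)) := rfl

/-- The wedge product of complex-valued alternating forms,
`(a ∧ b)(v) = 1/(k! l!) ∑_σ sign σ · a(v_{σ 1}, …, v_{σ k}) b(v_{σ(k+1)}, …, v_{σ(k+l)})`. -/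
def wedge {k l : ℕ} (a : V [⋀^Fin k]→L[ℝ] ℂ) (b : V [⋀^Fin l]→L[ℝ] ℂ) :
    V [⋀^Fin (k + l)]→L[ℝ] ℂ :=
  ((k.factorial * l.factorial : ℂ)⁻¹) • ContinuousMultilinearMap.alternatization (mulForms a b)

theorem wedge_apply {k l : ℕ} (a : V [⋀^Fin k]→L[ℝ] ℂ) (b : V [⋀^Fin l]→L[ℝ] ℂ)
    (v : Fin (k + l) → V) :
    wedge a b v = ((k.factorial * l.factorial : ℂ)⁻¹) * ∑ σ : Equiv.Perm (Fin (k + l)),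
      Equiv.Perm.sign σ •
        (a (fun i => v (σ (Fin.castAdd l i))) * b (fun i => v (σ (Fin.natAdd k i)))) := by
  rw [wedge, ContinuousAlternatingMap.smul_apply,
    ContinuousMultilinearMap.alternatization_apply_apply]
  rfl

/-- The complex conjugate of a complex-valued alternating form. -/
def conjForm {k : ℕ} (a : V [⋀^Fin k]→L[ℝ] ℂ) : V [⋀^Fin k]→L[ℝ] ℂ :=
  (Complex.conjCLE : ℂ →L[ℝ] ℂ).compContinuousAlternatingMap a

theorem conjForm_apply {k : ℕ} (a : V [⋀^Fin k]→L[ℝ] ℂ) (v : Fin k → V) :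
    conjForm a v = (starRingEnd ℂ) (a v) := rfl

/-- The wedge product `α₁ ∧ ⋯ ∧ α_k` of complex covectors, that is `v ↦ det (α_i (v_j))`. -/
def covectorWedge {k : ℕ} (α : Fin k → V →L[ℝ] ℂ) : V [⋀^Fin k]→L[ℝ] ℂ :=
  ContinuousMultilinearMap.alternatization
    ((ContinuousMultilinearMap.mkPiAlgebra ℝ (Fin k) ℂ).compContinuousLinearMap α)

theorem covectorWedge_apply {k : ℕ} (α : Fin k → V →L[ℝ] ℂ) (v : Fin k → V) :
    covectorWedge α v = Matrix.det (Matrix.of fun i j => α i (v j)) := by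
  rw [covectorWedge, ContinuousMultilinearMap.alternatization_apply_apply,
    ← Matrix.det_transpose, Matrix.det_apply]
  rfl

/-- Complex covectors of type `(1,0)` : `α ∘ J = i α`. -/
def IsOneZero (J : V →L[ℝ] V) (α : V →L[ℝ] ℂ) : Prop := ∀ v, α (J v) = Complex.I * α v

/-- Complex covectors of type `(0,1)`, the conjugates of those of type `(1,0)` : `α ∘ J = -i α`. -/
def IsZeroOne (J : V →L[ℝ] V) (α : V →L[ℝ] ℂ) : Prop := ∀ v, α (J v) = -Complex.I * α v

/-- The space `Λ^{p,q}` inside the complex-valued alternating `k`-forms: the complex span of the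
wedge products of `p` covectors of type `(1,0)` and `q` covectors of type `(0,1)` (in any order).
It is zero unless `p, q ≥ 0` and `p + q = k`. -/
def bidegree (J : V →L[ℝ] V) (k : ℕ) (p q : ℤ) : Submodule ℂ (V [⋀^Fin k]→L[ℝ] ℂ) :=
  Submodule.span ℂ {η | ∃ (α : Fin k → V →L[ℝ] ℂ) (S : Finset (Fin k)),
    (S.card : ℤ) = p ∧ (Sᶜ.card : ℤ) = q ∧ (∀ i ∈ S, IsOneZero J (α i)) ∧
    (∀ i ∉ S, IsZeroOne J (α i)) ∧ η = covectorWedge α}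

theorem bidegree_eq_bot {J : V →L[ℝ] V} {k : ℕ} {p q : ℤ}
    (h : ¬ (0 ≤ p ∧ 0 ≤ q ∧ p + q = k)) : bidegree J k p q = ⊥ := by
  rw [bidegree, Submodule.span_eq_bot]
  rintro x ⟨α, S, rfl, rfl, -⟩
  refine absurd ⟨by positivity, by positivity, ?_⟩ h
  have := Finset.card_add_card_compl S
  rw [Fintype.card_fin] at this
  exact_mod_cast this

theorem covectorWedge_sum {k : ℕ} {ι : Type*} [Fintype ι] (β : Fin k → ι → V →L[ℝ] ℂ) :
    covectorWedge (fun i => ∑ t, β i t) =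
      ∑ f : Fin k → ι, covectorWedge (fun i => β i (f i)) := by
  ext v
  rw [ContinuousAlternatingMap.sum_apply, covectorWedge]
  simp only [covectorWedge, ContinuousMultilinearMap.alternatization_apply_apply]
  rw [Finset.sum_comm]
  refine Finset.sum_congr rfl fun σ _ => ?_
  rw [← Finset.smul_sum]
  congr 1
  simp [Finset.prod_univ_sum]

theorem covectorWedge_mem_iSup {J : V →L[ℝ] V} (hJ : ∀ v, J (J v) = -v) {k : ℕ}
    (α : Fin k → V →L[ℝ] ℂ) :
    covectorWedge α ∈ ⨆ p : ℕ, bidegree J k p (k - p) := by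
  set β : Fin k → Bool → V →L[ℝ] ℂ := fun i b =>
    (2⁻¹ : ℂ) • (α i + (if b then -Complex.I else Complex.I) • (α i).comp J) with hβ
  have h1 : ∀ i, IsOneZero J (β i true) := by
    intro i v
    simp [hβ, hJ]
    linear_combination ((1 / 2 : ℂ) * (α i (J v))) * Complex.I_mul_I
  have h2 : ∀ i, IsZeroOne J (β i false) := by
    intro i v
    simp [hβ, hJ]
    linear_combination ((1 / 2 : ℂ) * (α i (J v))) * Complex.I_mul_I
  have hα : α = fun i => ∑ t, β i t := by
    ext i v
    simp [hβ]
    ring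
  rw [hα, covectorWedge_sum]
  refine Submodule.sum_mem _ fun f _ => ?_
  set S : Finset (Fin k) := Finset.univ.filter fun i => f i = true with hS
  refine Submodule.mem_iSup_of_mem S.card (Submodule.subset_span ⟨_, S, rfl, ?_, ?_, ?_, rfl⟩)
  · have := Finset.card_add_card_compl S
    rw [Fintype.card_fin] at this
    omega
  · intro i hi
    have : f i = true := by simpa [hS] using hi
    rw [this]; exact h1 i
  · intro i hi
    have : f i = false := by simpa [hS] using hi
    rw [this]; exact h2 i

theorem mem_iSup_bidegree [IsTopologicalAddGroup V] [FiniteDimensional ℝ V] [T2Space V] [ContinuousSMul ℝ V]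
    {J : V →L[ℝ] V} (hJ : ∀ v, J (J v) = -v) {k : ℕ} (a : V [⋀^Fin k]→L[ℝ] ℂ) :
    a ∈ ⨆ p : ℕ, bidegree J k p (k - p) := by
  classical
  set b := Module.finBasis ℝ V
  set d := Module.finrank ℝ V
  set c : Fin d → V →L[ℝ] ℂ := fun t =>
    Complex.ofRealCLM.comp (LinearMap.toContinuousLinearMap (b.coord t)) with hc
  have hcv : ∀ t v, c t v = (b.repr v t : ℂ) := fun t v => rfl
  have hk : (k.factorial : ℂ) ≠ 0 := by exact_mod_cast k.factorial_ne_zero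
  have key : a = (k.factorial : ℂ)⁻¹ • ∑ f : Fin k → Fin d,
      a (fun i => b (f i)) • covectorWedge (fun i => c (f i)) := by
    ext v
    have hexp : ∀ w : Fin k → V, a w =
        ∑ f : Fin k → Fin d, (∏ i, c (f i) (w i)) * a (fun i => b (f i)) := by
      intro w
      conv_lhs => rw [show w = fun i => ∑ t, b.repr (w i) t • b t from
        funext fun i => (b.sum_repr (w i)).symm]
      rw [ContinuousAlternatingMap.map_sum]
      refine Finset.sum_congr rfl fun f _ => ?_
      have := a.toMultilinearMap.map_smul_univ (fun i => b.repr (w i) (f i)) (fun i => b (f i))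
      refine this.trans ?_
      simp only [hcv]
      rw [← Complex.ofReal_prod, Complex.real_smul]
      rfl
    rw [ContinuousAlternatingMap.smul_apply, ContinuousAlternatingMap.sum_apply]
    have hsgn : ∀ σ : Equiv.Perm (Fin k), Equiv.Perm.sign σ • a (v ∘ σ) = a v := by
      intro σ
      have := a.toAlternatingMap.map_perm v σ
      refine (congrArg (fun z => Equiv.Perm.sign σ • z) this).trans ?_
      rw [smul_smul, Int.units_mul_self, one_smul]
      rfl
    have hsum : ∑ σ : Equiv.Perm (Fin k), Equiv.Perm.sign σ • a (v ∘ σ) =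
        (k.factorial : ℂ) * a v := by
      simp [hsgn, Fintype.card_perm]
    rw [eq_comm, smul_eq_mul, inv_mul_eq_iff_eq_mul₀ hk, ← hsum]
    simp only [ContinuousAlternatingMap.smul_apply, covectorWedge,
      ContinuousMultilinearMap.alternatization_apply_apply]
    simp only [Finset.smul_sum]
    rw [Finset.sum_comm]
    refine Finset.sum_congr rfl fun σ _ => ?_
    rw [hexp (v ∘ σ), Finset.smul_sum]
    refine Finset.sum_congr rfl fun f _ => ?_
    rw [smul_comm]
    congr 1
    simp [mul_comm]
  rw [key]
  exact Submodule.smul_mem _ _ (Submodule.sum_mem _ fun f _ =>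
    Submodule.smul_mem _ _ (covectorWedge_mem_iSup hJ _))

variable [IsTopologicalAddGroup V] [ContinuousConstSMul ℝ V]

/-- The rotation `cos θ + sin θ J`. It acts on `Λ^{p,q}` as multiplication by `e^{i(p-q)θ}`. -/
def rotation (J : V →L[ℝ] V) (θ : ℝ) : V →L[ℝ] V :=
  Real.cos θ • ContinuousLinearMap.id ℝ V + Real.sin θ • J

/-- The projection of the complex-valued alternating `k`-forms onto `Λ^{p,q}`, as a Fourier
coefficient of the action of the rotations; see `bidegreeProj_of_mem`, `bidegreeProj_of_mem_ne`,
`bidegreeProj_mem` and `sum_bidegreeProj`, which characterize it. -/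
def bidegreeProj (J : V →L[ℝ] V) (k : ℕ) (p q : ℤ) :
    (V [⋀^Fin k]→L[ℝ] ℂ) →ₗ[ℂ] (V [⋀^Fin k]→L[ℝ] ℂ) where
  toFun a := if 0 ≤ p ∧ 0 ≤ q ∧ p + q = k then
    ((k + 1 : ℂ)⁻¹) • ∑ j ∈ Finset.range (k + 1),
      Complex.exp (-((p - q : ℤ) * (Real.pi * j / (k + 1) : ℝ) * Complex.I)) •
        a.compContinuousLinearMap (rotation J (Real.pi * j / (k + 1))) else 0
  map_add' a b := by
    split_ifs
    · ext v
      simp [Finset.sum_add_distrib, mul_add]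
    · simp
  map_smul' c a := by
    split_ifs
    · ext v
      simp only [ContinuousAlternatingMap.smul_apply, ContinuousAlternatingMap.sum_apply,
        ContinuousAlternatingMap.compContinuousLinearMap_apply, RingHom.id_apply, smul_eq_mul,
        Finset.mul_sum]
      refine Finset.sum_congr rfl fun j _ => ?_
      ring
    · ext v; simp

theorem bidegreeProj_apply (J : V →L[ℝ] V) {k : ℕ} {p q : ℤ} (h : 0 ≤ p ∧ 0 ≤ q ∧ p + q = k)
    (a : V [⋀^Fin k]→L[ℝ] ℂ) : bidegreeProj J k p q a =
    ((k + 1 : ℂ)⁻¹) • ∑ j ∈ Finset.range (k + 1),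
      Complex.exp (-((p - q : ℤ) * (Real.pi * j / (k + 1) : ℝ) * Complex.I)) •
        a.compContinuousLinearMap (rotation J (Real.pi * j / (k + 1))) := if_pos h

theorem bidegreeProj_apply_zero (J : V →L[ℝ] V) {k : ℕ} {p q : ℤ}
    (h : ¬ (0 ≤ p ∧ 0 ≤ q ∧ p + q = k)) (a : V [⋀^Fin k]→L[ℝ] ℂ) :
    bidegreeProj J k p q a = 0 := if_neg h

theorem IsOneZero.rotation {J : V →L[ℝ] V} {α : V →L[ℝ] ℂ} (h : IsOneZero J α) (θ : ℝ) (v : V) :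
    α (rotation J θ v) = Complex.exp (θ * Complex.I) * α v := by
  simp [ComplexSymplectic.rotation, h v, Complex.exp_mul_I]
  ring

theorem IsZeroOne.rotation {J : V →L[ℝ] V} {α : V →L[ℝ] ℂ} (h : IsZeroOne J α) (θ : ℝ) (v : V) :
    α (rotation J θ v) = Complex.exp (-(θ * Complex.I)) * α v := by
  have : -((θ : ℂ) * Complex.I) = ((-θ : ℝ) : ℂ) * Complex.I := by push_cast; ring
  rw [this, Complex.exp_mul_I]
  simp [ComplexSymplectic.rotation, h v]
  ring

theorem compRotation_of_mem {J : V →L[ℝ] V} {k : ℕ} {p q : ℤ} {a : V [⋀^Fin k]→L[ℝ] ℂ}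
    (ha : a ∈ bidegree J k p q) (θ : ℝ) :
    a.compContinuousLinearMap (rotation J θ) =
      Complex.exp ((p - q : ℤ) * θ * Complex.I) • a := by
  induction ha using Submodule.span_induction with
  | mem a ha =>
    obtain ⟨α, S, rfl, rfl, h1, h2, rfl⟩ := ha
    ext v
    have hrow : ∀ i j, α i (rotation J θ (v j)) =
        (if i ∈ S then Complex.exp (θ * Complex.I) else Complex.exp (-(θ * Complex.I))) *
          α i (v j) := by
      intro i j
      split_ifs with hi
      · exact (h1 i hi).rotation θ (v j)
      · exact (h2 i hi).rotation θ (v j)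
    rw [ContinuousAlternatingMap.compContinuousLinearMap_apply,
      ContinuousAlternatingMap.smul_apply, covectorWedge_apply, covectorWedge_apply]
    simp only [Function.comp_apply, hrow]
    have := Matrix.det_mul_column
      (fun i => if i ∈ S then Complex.exp (θ * Complex.I) else Complex.exp (-(θ * Complex.I)))
      (Matrix.of fun i j => α i (v j))
    simp only [Matrix.of_apply] at this
    rw [this, smul_eq_mul]
    congr 1
    rw [Finset.prod_ite, Finset.prod_const, Finset.prod_const, ← Complex.exp_nat_mul,
      ← Complex.exp_nat_mul, ← Complex.exp_add]
    congr 1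
    have e1 : Finset.univ.filter (fun i => i ∈ S) = S := by ext; simp
    have e2 : Finset.univ.filter (fun i => i ∉ S) = Sᶜ := by ext; simp
    rw [e1, e2]
    push_cast
    ring
  | zero => ext v; simp
  | add a b _ _ ha hb =>
    rw [smul_add, ← ha, ← hb]; rfl
  | smul c a _ ha =>
    rw [smul_comm, ← ha]; rfl

theorem bidegreeProj_eq_of_mem {J : V →L[ℝ] V} {k : ℕ} {p q p' q' : ℤ}
    {a : V [⋀^Fin k]→L[ℝ] ℂ} (ha : a ∈ bidegree J k p' q')
    (h : 0 ≤ p ∧ 0 ≤ q ∧ p + q = k) (h' : 0 ≤ p' ∧ 0 ≤ q' ∧ p' + q' = k) :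
    bidegreeProj J k p q a = if p' = p then a else 0 := by
  have hk : (k + 1 : ℂ) ≠ 0 := by exact_mod_cast Nat.succ_ne_zero k
  rw [bidegreeProj_apply J h]
  simp only [compRotation_of_mem ha, smul_smul, ← Complex.exp_add]
  rw [← Finset.sum_smul, smul_smul]
  have key := sum_exp_aux k (p' - p) (by rw [abs_le]; omega)
  have : ∀ j ∈ Finset.range (k + 1),
      Complex.exp (-((p - q : ℤ) * (Real.pi * j / (k + 1) : ℝ) * Complex.I) +
        (p' - q' : ℤ) * (Real.pi * j / (k + 1) : ℝ) * Complex.I) =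
      Complex.exp (2 * (p' - p : ℤ) * (Real.pi * j / (k + 1) : ℝ) * Complex.I) := by
    intro j _
    congr 1
    have hq : q = k - p := by omega
    have hq' : q' = k - p' := by omega
    subst hq hq'
    push_cast
    ring
  rw [Finset.sum_congr rfl this, key]
  by_cases hp : p' = p
  · simp [hp, hk]
  · rw [if_neg hp, if_neg (sub_ne_zero.mpr hp), mul_zero]
    exact zero_smul ℂ a

/-- The projection onto `Λ^{p,q}` fixes `Λ^{p,q}`. -/
theorem bidegreeProj_of_mem {J : V →L[ℝ] V} {k : ℕ} {p q : ℤ}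
    {a : V [⋀^Fin k]→L[ℝ] ℂ} (ha : a ∈ bidegree J k p q) : bidegreeProj J k p q a = a := by
  by_cases h : 0 ≤ p ∧ 0 ≤ q ∧ p + q = k
  · rw [bidegreeProj_eq_of_mem ha h h, if_pos rfl]
  · rw [bidegree_eq_bot h, Submodule.mem_bot] at ha
    rw [ha, map_zero]

/-- The projection onto `Λ^{p,q}` kills every other `Λ^{p',q'}`. -/
theorem bidegreeProj_of_mem_ne {J : V →L[ℝ] V} {k : ℕ} {p q p' q' : ℤ}
    {a : V [⋀^Fin k]→L[ℝ] ℂ} (ha : a ∈ bidegree J k p' q') (hne : (p', q') ≠ (p, q)) :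
    bidegreeProj J k p q a = 0 := by
  by_cases h : 0 ≤ p ∧ 0 ≤ q ∧ p + q = k
  · by_cases h' : 0 ≤ p' ∧ 0 ≤ q' ∧ p' + q' = k
    · rw [bidegreeProj_eq_of_mem ha h h', if_neg]
      rintro rfl
      exact hne (by rw [show q' = q by omega])
    · rw [bidegree_eq_bot h', Submodule.mem_bot] at ha
      rw [ha, map_zero]
  · exact bidegreeProj_apply_zero J h a

/-- The projection onto `Λ^{p,q}` takes values in `Λ^{p,q}`. -/
theorem bidegreeProj_mem [FiniteDimensional ℝ V] [T2Space V] [ContinuousSMul ℝ V]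
    {J : V →L[ℝ] V} (hJ : ∀ v, J (J v) = -v) {k : ℕ} (p q : ℤ) (a : V [⋀^Fin k]→L[ℝ] ℂ) :
    bidegreeProj J k p q a ∈ bidegree J k p q := by
  induction mem_iSup_bidegree hJ a using Submodule.iSup_induction' with
  | mem p' a ha =>
    by_cases hne : ((p' : ℤ), (k : ℤ) - p') = (p, q)
    · obtain ⟨rfl, rfl⟩ := Prod.mk.inj hne
      rwa [bidegreeProj_of_mem ha]
    · rw [bidegreeProj_of_mem_ne ha hne]; exact Submodule.zero_mem _
  | zero => rw [map_zero]; exact Submodule.zero_mem _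
  | add a b _ _ ha hb => rw [map_add]; exact Submodule.add_mem _ ha hb

/-- Every complex-valued alternating form is the sum of its components of type `(p, k - p)`. -/
theorem sum_bidegreeProj [FiniteDimensional ℝ V] [T2Space V] [ContinuousSMul ℝ V]
    {J : V →L[ℝ] V} (hJ : ∀ v, J (J v) = -v) {k : ℕ} (a : V [⋀^Fin k]→L[ℝ] ℂ) :
    ∑ p ∈ Finset.range (k + 1), bidegreeProj J k p (k - p) a = a := by
  induction mem_iSup_bidegree hJ a using Submodule.iSup_induction' with
  | mem p' a ha =>
    by_cases hp : p' ≤ k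
    · rw [Finset.sum_eq_single p', bidegreeProj_of_mem ha]
      · intro p _ hne
        exact bidegreeProj_of_mem_ne ha fun h => hne (by have := (Prod.mk.inj h).1; omega)
      · intro h; simp at h; omega
    · rw [bidegree_eq_bot (by omega), Submodule.mem_bot] at ha
      simp [ha]
  | zero => simp
  | add a b _ _ ha hb => simp only [map_add, Finset.sum_add_distrib, ha, hb]

end Pointwise
section Smoothness

variable {E : Type*} [NormedAddCommGroup E] [NormedSpace ℝ E] [FiniteDimensional ℝ E]
variable {F : Type*} [NormedAddCommGroup F] [NormedSpace ℝ F]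

/-- A family of alternating forms on a finite-dimensional space is smooth if all its values are. -/
theorem contDiffOn_of_apply {k : ℕ} {f : F → E [⋀^Fin k]→L[ℝ] ℂ} {s : Set F}
    (h : ∀ v, ContDiffOn ℝ ∞ (fun y => f y v) s) : ContDiffOn ℝ ∞ f s := by
  classical
  set b := Module.finBasis ℝ E
  let ev : (E [⋀^Fin k]→L[ℝ] ℂ) →ₗ[ℝ] ((Fin k → Fin (Module.finrank ℝ E)) → ℂ) :=
    { toFun := fun a r => a (fun i => b (r i))
      map_add' := fun _ _ => rfl
      map_smul' := fun _ _ => rfl }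
  have hinj : Function.Injective ev := by
    intro a a' h
    apply ContinuousAlternatingMap.toAlternatingMap_injective
    apply AlternatingMap.coe_multilinearMap_injective
    exact Module.Basis.ext_multilinear (fun _ => b) fun r => congrFun h r
  have : FiniteDimensional ℝ (E [⋀^Fin k]→L[ℝ] ℂ) := Module.Finite.of_injective ev hinj
  obtain ⟨g, hg⟩ := ev.exists_leftInverse_of_injective (LinearMap.ker_eq_bot.mpr hinj)
  have : f = fun y => LinearMap.toContinuousLinearMap g (ev (f y)) := by
    funext y
    exact (LinearMap.congr_fun hg (f y)).symm
  rw [this]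
  refine (LinearMap.toContinuousLinearMap g).contDiff.comp_contDiffOn ?_
  rw [contDiffOn_pi]
  exact fun r => h _

theorem contDiffOn_apply_apply {k : ℕ} {f : F → E [⋀^Fin k]→L[ℝ] ℂ} {A : F → E →L[ℝ] E} {s : Set F}
    (hf : ContDiffOn ℝ ∞ f s) (hA : ContDiffOn ℝ ∞ A s) (v : Fin k → E) :
    ContDiffOn ℝ ∞ (fun y => f y (fun i => A y (v i))) s := by
  classical
  set b := Module.finBasis ℝ E
  have hexp : ∀ y, f y (fun i => A y (v i)) = ∑ r : Fin k → Fin (Module.finrank ℝ E),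
      (∏ i, b.repr (A y (v i)) (r i)) • f y (fun i => b (r i)) := by
    intro y
    conv_lhs => rw [show (fun i => A y (v i)) = fun i => ∑ t, b.repr (A y (v i)) t • b t from
      funext fun i => (b.sum_repr (A y (v i))).symm]
    rw [ContinuousAlternatingMap.map_sum]
    refine Finset.sum_congr rfl fun r _ => ?_
    exact (f y).toMultilinearMap.map_smul_univ (fun i => b.repr (A y (v i)) (r i))
      (fun i => b (r i))
  simp only [hexp]
  refine ContDiffOn.sum fun r _ => ContDiffOn.fun_smul ?_ ?_
  · refine contDiffOn_prod fun i _ => ?_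
    exact (LinearMap.toContinuousLinearMap (b.coord (r i))).contDiff.comp_contDiffOn
      (hA.clm_apply contDiffOn_const)
  · exact (ContinuousAlternatingMap.apply ℝ E ℂ (fun i => b (r i))).contDiff.comp_contDiffOn hf

end Smoothness
theorem two_le_infty : (2 : WithTop ℕ∞) ≤ ∞ := WithTop.coe_le_coe.mpr le_top

section Manifold

variable {E : Type*} [NormedAddCommGroup E] [NormedSpace ℝ E]
variable {M : Type*} [TopologicalSpace M] [ChartedSpace E M]

/-- The derivative of the inverse of the preferred chart at `c`, at the point `y` of the model
space. -/
def chartSymmDeriv (E : Type*) [NormedAddCommGroup E] [NormedSpace ℝ E]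
    {M : Type*} [TopologicalSpace M] [ChartedSpace E M] (c : M) (y : E) :
    E →L[ℝ] TangentSpace 𝓘(ℝ, E) ((extChartAt 𝓘(ℝ, E) c).symm y) :=
  mfderiv 𝓘(ℝ, E) 𝓘(ℝ, E) (extChartAt 𝓘(ℝ, E) c).symm y

/-- The derivative of the preferred chart at `c`, at the point `x` of the manifold. -/
def chartDeriv (E : Type*) [NormedAddCommGroup E] [NormedSpace ℝ E]
    {M : Type*} [TopologicalSpace M] [ChartedSpace E M] (c x : M) :
    TangentSpace 𝓘(ℝ, E) x →L[ℝ] E :=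
  mfderiv 𝓘(ℝ, E) 𝓘(ℝ, E) (extChartAt 𝓘(ℝ, E) c) x

/-- The expression of a field of complex-valued alternating `k`-forms in the preferred chart `φ`
at `c`: its pull-back by `φ⁻¹`, a differential form on (the target of `φ` in) the model space. -/
def formInChart {k : ℕ} (η : ∀ x : M, TangentSpace 𝓘(ℝ, E) x [⋀^Fin k]→L[ℝ] ℂ) (c : M) (y : E) :
    E [⋀^Fin k]→L[ℝ] ℂ :=
  (η ((extChartAt 𝓘(ℝ, E) c).symm y)).compContinuousLinearMap (chartSymmDeriv E c y)

/-- The expression of a field of endomorphisms of the tangent spaces in the preferred chart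
at `c`. -/
def endoInChart (J : ∀ x : M, TangentSpace 𝓘(ℝ, E) x →L[ℝ] TangentSpace 𝓘(ℝ, E) x)
    (c : M) (y : E) : E →L[ℝ] E :=
  (chartDeriv E c ((extChartAt 𝓘(ℝ, E) c).symm y)).comp
    ((J ((extChartAt 𝓘(ℝ, E) c).symm y)).comp (chartSymmDeriv E c y))

variable (E M) in
/-- The complex vector space of smooth complex-valued differential `k`-forms on `M`, among all
fields of alternating forms: those whose expression in every preferred chart is smooth. -/
def smoothForms (k : ℕ) : Submodule ℂ (∀ x : M, TangentSpace 𝓘(ℝ, E) x [⋀^Fin k]→L[ℝ] ℂ) where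
  carrier := {η | ∀ c : M, ContDiffOn ℝ ∞ (formInChart η c) (extChartAt 𝓘(ℝ, E) c).target}
  zero_mem' _ := contDiffOn_const (c := (0 : E [⋀^Fin k]→L[ℝ] ℂ))
  add_mem' h h' c := (h c).add (h' c)
  smul_mem' a _ h c := (h c).const_smul a

variable (E M) in
/-- `Ω^k(M, ℂ)` : the smooth complex-valued differential `k`-forms on `M`. -/
@[ext]
structure Form (k : ℕ) where
  /-- The alternating form on the tangent space at each point. -/
  toFun : ∀ x : M, TangentSpace 𝓘(ℝ, E) x [⋀^Fin k]→L[ℝ] ℂ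
  smooth : ∀ c : M, ContDiffOn ℝ ∞ (formInChart toFun c) (extChartAt 𝓘(ℝ, E) c).target

/-- `Form E M k` as the subspace of the smooth fields of alternating forms; this gives it its
(pointwise) vector space structure. -/
def Form.equiv (k : ℕ) : Form E M k ≃ smoothForms E M k where
  toFun η := ⟨η.toFun, η.smooth⟩
  invFun η := ⟨η.1, η.2⟩

instance (k : ℕ) : AddCommGroup (Form E M k) := (Form.equiv k).addCommGroup

instance (k : ℕ) : Module ℂ (Form E M k) := (Form.equiv k).module ℂ

theorem Form.zero_apply {k : ℕ} (x : M) : (0 : Form E M k).toFun x = 0 := rfl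

theorem Form.add_apply {k : ℕ} (η ζ : Form E M k) (x : M) :
    (η + ζ).toFun x = η.toFun x + ζ.toFun x := rfl

theorem Form.smul_apply {k : ℕ} (a : ℂ) (η : Form E M k) (x : M) :
    (a • η).toFun x = a • η.toFun x := rfl

variable [IsManifold 𝓘(ℝ, E) ∞ M]

theorem chartDeriv_comp_chartSymmDeriv (c : M) {y : E} (hy : y ∈ (extChartAt 𝓘(ℝ, E) c).target) :
    (chartDeriv E c ((extChartAt 𝓘(ℝ, E) c).symm y)).comp (chartSymmDeriv E c y) =
      ContinuousLinearMap.id ℝ E := by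
  have : IsManifold 𝓘(ℝ, E) 1 M := IsManifold.of_le (n := ∞) (by simp)
  have h := mfderiv_extChartAt_comp_mfderivWithin_extChartAt_symm (I := 𝓘(ℝ, E)) hy
  rw [ModelWithCorners.range_eq_univ, mfderivWithin_univ] at h
  exact h

theorem chartSymmDeriv_comp_chartDeriv (c : M) {y : E} (hy : y ∈ (extChartAt 𝓘(ℝ, E) c).target) :
    (chartSymmDeriv E c y).comp (chartDeriv E c ((extChartAt 𝓘(ℝ, E) c).symm y)) =
      ContinuousLinearMap.id ℝ _ := by
  have : IsManifold 𝓘(ℝ, E) 1 M := IsManifold.of_le (n := ∞) (by simp)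
  have h := mfderivWithin_extChartAt_symm_comp_mfderiv_extChartAt (I := 𝓘(ℝ, E)) hy
  rw [ModelWithCorners.range_eq_univ, mfderivWithin_univ] at h
  exact h

/-- The transition map from the preferred chart at `c` to the one at `c'` is smooth. -/
theorem contDiffAt_transition (c c' : M) {y : E} (hy : y ∈ (extChartAt 𝓘(ℝ, E) c).target)
    (hy' : (extChartAt 𝓘(ℝ, E) c).symm y ∈ (extChartAt 𝓘(ℝ, E) c').source) :
    ContDiffAt ℝ ∞ (extChartAt 𝓘(ℝ, E) c' ∘ (extChartAt 𝓘(ℝ, E) c).symm) y := by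
  have h1 := contMDiffOn_extChartAt_symm (I := 𝓘(ℝ, E)) (n := ∞) c
  have h2 := contMDiffOn_extChartAt (I := 𝓘(ℝ, E)) (n := ∞) (x := c')
  have h1' := h1.contMDiffAt ((isOpen_extChartAt_target c).mem_nhds hy)
  have h2' := h2.contMDiffAt (x := (extChartAt 𝓘(ℝ, E) c).symm y)
    ((chartAt E c').open_source.mem_nhds (by simpa using hy'))
  exact (h2'.comp y h1').contDiffAt

theorem fderiv_transition (c c' : M) {y : E} (hy : y ∈ (extChartAt 𝓘(ℝ, E) c).target)
    (hy' : (extChartAt 𝓘(ℝ, E) c).symm y ∈ (extChartAt 𝓘(ℝ, E) c').source) :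
    fderiv ℝ (extChartAt 𝓘(ℝ, E) c' ∘ (extChartAt 𝓘(ℝ, E) c).symm) y =
      (chartDeriv E c' ((extChartAt 𝓘(ℝ, E) c).symm y)).comp (chartSymmDeriv E c y) := by
  have h1 := contMDiffOn_extChartAt_symm (I := 𝓘(ℝ, E)) (n := ∞) c
  have h2 := contMDiffOn_extChartAt (I := 𝓘(ℝ, E)) (n := ∞) (x := c')
  have h1' := (h1.contMDiffAt ((isOpen_extChartAt_target c).mem_nhds hy)).mdifferentiableAt
    (by simp)
  have h2' := (h2.contMDiffAt (x := (extChartAt 𝓘(ℝ, E) c).symm y)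
    ((chartAt E c').open_source.mem_nhds (by simpa using hy'))).mdifferentiableAt (by simp)
  rw [← mfderiv_eq_fderiv]
  exact mfderiv_comp y h2' h1'

/-- Change of charts for the expression of a form. -/
theorem formInChart_eq {k : ℕ} (η : ∀ x : M, TangentSpace 𝓘(ℝ, E) x [⋀^Fin k]→L[ℝ] ℂ)
    (c c' : M) {y : E} (hy : y ∈ (extChartAt 𝓘(ℝ, E) c).target)
    (hy' : (extChartAt 𝓘(ℝ, E) c).symm y ∈ (extChartAt 𝓘(ℝ, E) c').source) :
    formInChart η c y =
      (formInChart η c' ((extChartAt 𝓘(ℝ, E) c' ∘ (extChartAt 𝓘(ℝ, E) c).symm) y)).compContinuousLinearMap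
        (fderiv ℝ (extChartAt 𝓘(ℝ, E) c' ∘ (extChartAt 𝓘(ℝ, E) c).symm) y) := by
  rw [fderiv_transition c c' hy hy']
  have hx : (extChartAt 𝓘(ℝ, E) c').symm ((extChartAt 𝓘(ℝ, E) c')
      ((extChartAt 𝓘(ℝ, E) c).symm y)) = (extChartAt 𝓘(ℝ, E) c).symm y :=
    (extChartAt 𝓘(ℝ, E) c').left_inv hy'
  have hid := chartSymmDeriv_comp_chartDeriv c' ((extChartAt 𝓘(ℝ, E) c').map_source hy')
  simp only [Function.comp_apply, formInChart]
  generalize (extChartAt 𝓘(ℝ, E) c') ((extChartAt 𝓘(ℝ, E) c).symm y) = z at hx hid ⊢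
  generalize chartSymmDeriv E c y = A
  revert A
  revert hid
  rw [← hx]
  intro hid A
  ext v
  have hid' : ∀ w, chartSymmDeriv E c' z (chartDeriv E c' ((extChartAt 𝓘(ℝ, E) c').symm z) w) = w :=
    fun w => congrArg (fun L => L w) hid
  refine congrArg (η ((extChartAt 𝓘(ℝ, E) c').symm z)) (funext fun i => ?_)
  exact (hid' (A (v i))).symm

/-- The exterior derivative of a field of complex-valued alternating forms, computed at every
point in the preferred chart at that point. -/
def extDerivField {k : ℕ} (η : ∀ x : M, TangentSpace 𝓘(ℝ, E) x [⋀^Fin k]→L[ℝ] ℂ) (x : M) :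
    TangentSpace 𝓘(ℝ, E) x [⋀^Fin (k + 1)]→L[ℝ] ℂ :=
  (extDeriv (formInChart η x) (extChartAt 𝓘(ℝ, E) x x)).compContinuousLinearMap (chartDeriv E x x)

/-- In every preferred chart, the exterior derivative of a smooth form is given by the usual
exterior derivative on the model space. -/
theorem formInChart_extDerivField {k : ℕ} (η : Form E M k) (c : M) {y : E}
    (hy : y ∈ (extChartAt 𝓘(ℝ, E) c).target) :
    formInChart (extDerivField η.toFun) c y = extDeriv (formInChart η.toFun c) y := by
  set x := (extChartAt 𝓘(ℝ, E) c).symm y with hx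
  have hxs : x ∈ (extChartAt 𝓘(ℝ, E) x).source := mem_extChartAt_source x
  set τ := extChartAt 𝓘(ℝ, E) x ∘ (extChartAt 𝓘(ℝ, E) c).symm with hτ
  have hτs : ContDiffAt ℝ ∞ τ y := contDiffAt_transition c x hy hxs
  have hev : formInChart η.toFun c =ᶠ[nhds y]
      fun z => (formInChart η.toFun x (τ z)).compContinuousLinearMap (fderiv ℝ τ z) := by
    have hcont : ContinuousAt (extChartAt 𝓘(ℝ, E) c).symm y :=
      (continuousOn_extChartAt_symm c).continuousAt ((isOpen_extChartAt_target c).mem_nhds hy)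
    filter_upwards [(isOpen_extChartAt_target c).mem_nhds hy,
      hcont.preimage_mem_nhds ((isOpen_extChartAt_source (I := 𝓘(ℝ, E)) x).mem_nhds hxs)]
      with z hz hz'
    exact formInChart_eq η.toFun c x hz hz'
  have hdiff : DifferentiableAt ℝ (formInChart η.toFun x) (τ y) :=
    ((η.smooth x).contDiffAt ((isOpen_extChartAt_target x).mem_nhds
      ((extChartAt 𝓘(ℝ, E) x).map_source hxs))).differentiableAt (by simp)
  rw [hev.extDeriv_eq, extDeriv_pullback hdiff hτs (by simpa using two_le_infty),
    fderiv_transition c x hy hxs]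
  rfl

variable (E M) in
/-- The exterior derivative `d : Ω^k(M, ℂ) → Ω^{k+1}(M, ℂ)`. -/
def d (k : ℕ) : Form E M k →ₗ[ℂ] Form E M (k + 1) where
  toFun η := ⟨extDerivField η.toFun, fun c => by
    have h : ContDiffOn ℝ ∞ (extDeriv (formInChart η.toFun c)) (extChartAt 𝓘(ℝ, E) c).target := by
      have := (η.smooth c).fderiv_of_isOpen (m := ∞) (isOpen_extChartAt_target c) (by simp)
      exact (ContinuousAlternatingMap.alternatizeUncurryFinCLM ℝ E ℂ).contDiff.comp_contDiffOn this
    exact h.congr fun y hy => formInChart_extDerivField η c hy⟩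
  map_add' η ζ := by
    refine Form.ext (funext fun x => ?_)
    have hd : ∀ η : Form E M k, DifferentiableAt ℝ (formInChart η.toFun x) (extChartAt 𝓘(ℝ, E) x x) :=
      fun η => ((η.smooth x).contDiffAt ((isOpen_extChartAt_target x).mem_nhds
        (mem_extChartAt_target x))).differentiableAt (by simp)
    have := extDeriv_add (hd η) (hd ζ)
    exact congrArg (fun a => a.compContinuousLinearMap (chartDeriv E x x)) this
  map_smul' a η := by
    refine Form.ext (funext fun x => ?_)
    have hd : DifferentiableAt ℝ (formInChart η.toFun x) (extChartAt 𝓘(ℝ, E) x x) :=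
      ((η.smooth x).contDiffAt ((isOpen_extChartAt_target x).mem_nhds
        (mem_extChartAt_target x))).differentiableAt (by simp)
    have : extDeriv (a • formInChart η.toFun x) (extChartAt 𝓘(ℝ, E) x x) =
        a • extDeriv (formInChart η.toFun x) (extChartAt 𝓘(ℝ, E) x x) := by
      ext v
      have h1 : HasFDerivAt (a • formInChart η.toFun x) (a • fderiv ℝ (formInChart η.toFun x)
          (extChartAt 𝓘(ℝ, E) x x)) (extChartAt 𝓘(ℝ, E) x x) := hd.hasFDerivAt.const_smul a
      rw [extDeriv, h1.fderiv, extDeriv, ContinuousAlternatingMap.smul_apply,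
        ContinuousAlternatingMap.alternatizeUncurryFin_apply,
        ContinuousAlternatingMap.alternatizeUncurryFin_apply, Finset.smul_sum]
      refine Finset.sum_congr rfl fun i _ => ?_
      rw [smul_comm]
      rfl
    exact congrArg (fun a => a.compContinuousLinearMap (chartDeriv E x x)) this

/-- The wedge product `Ω^k(M, ℂ) × Ω^l(M, ℂ) → Ω^{k+l}(M, ℂ)`. -/
def Form.wedge [FiniteDimensional ℝ E] {k l : ℕ} (η : Form E M k) (ζ : Form E M l) :
    Form E M (k + l) :=
  ⟨fun x => ComplexSymplectic.wedge (η.toFun x) (ζ.toFun x), fun c => by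
    refine contDiffOn_of_apply fun v => ?_
    have h : ∀ y, formInChart (fun x => ComplexSymplectic.wedge (η.toFun x) (ζ.toFun x)) c y v =
        ((k.factorial * l.factorial : ℂ)⁻¹) * ∑ σ : Equiv.Perm (Fin (k + l)),
          Equiv.Perm.sign σ • (formInChart η.toFun c y (fun i => v (σ (Fin.castAdd l i))) *
            formInChart ζ.toFun c y (fun i => v (σ (Fin.natAdd k i)))) := fun y =>
      wedge_apply (η.toFun ((extChartAt 𝓘(ℝ, E) c).symm y)) (ζ.toFun ((extChartAt 𝓘(ℝ, E) c).symm y))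
        (fun i => chartSymmDeriv E c y (v i))
    simp only [h]
    refine contDiffOn_const.mul (ContDiffOn.sum fun σ _ => ?_)
    have hmul := ((ContinuousAlternatingMap.apply ℝ E ℂ
        (fun i => v (σ (Fin.castAdd l i)))).contDiff.comp_contDiffOn (η.smooth c)).mul
      ((ContinuousAlternatingMap.apply ℝ E ℂ
        (fun i => v (σ (Fin.natAdd k i)))).contDiff.comp_contDiffOn (ζ.smooth c))
    rcases Int.units_eq_one_or (Equiv.Perm.sign σ) with hs | hs
    · simp only [hs, one_smul]
      exact hmul
    · simp only [hs, Units.neg_smul, one_smul]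
      exact hmul.neg⟩

/-- The complex conjugate of a complex-valued differential form. -/
def Form.conj [FiniteDimensional ℝ E] {k : ℕ} (η : Form E M k) : Form E M k :=
  ⟨fun x => conjForm (η.toFun x), fun c => by
    refine contDiffOn_of_apply fun v => ?_
    exact ((Complex.conjCLE : ℂ →L[ℝ] ℂ).comp
      (ContinuousAlternatingMap.apply ℝ E ℂ v)).contDiff.comp_contDiffOn (η.smooth c)⟩

variable (E M) in
/-- The constant function `1`, as a differential `0`-form. -/
def Form.one : Form E M 0 :=
  ⟨fun x => ContinuousAlternatingMap.constOfIsEmpty ℝ (TangentSpace 𝓘(ℝ, E) x) (Fin 0) (1 : ℂ),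
    fun _ => contDiffOn_const
      (c := ContinuousAlternatingMap.constOfIsEmpty ℝ E (Fin 0) (1 : ℂ))⟩

/-- The wedge powers `η^k = η ∧ ⋯ ∧ η` of a `2`-form `η`. -/
def Form.pow [FiniteDimensional ℝ E] (η : Form E M 2) : (k : ℕ) → Form E M (2 * k)
  | 0 => Form.one E M
  | k + 1 => (η.pow k).wedge η

/-- The form `σ^k ∧ σ̄^m`, of degree `2k + 2m`. -/
def Form.powWedgeConjPow [FiniteDimensional ℝ E] (σ : Form E M 2) (k m : ℕ) :
    Form E M (2 * k + 2 * m) :=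
  (σ.pow k).wedge (σ.conj.pow m)

/-- A smooth vector field on `M`. -/
def IsSmoothVectorField (X : ∀ x : M, TangentSpace 𝓘(ℝ, E) x) : Prop :=
  ContMDiff 𝓘(ℝ, E) 𝓘(ℝ, E).tangent ∞ (fun x => (⟨x, X x⟩ : TangentBundle 𝓘(ℝ, E) M))

variable (E M) in
/-- A complex structure on the smooth manifold `M`: a smooth field `J` of endomorphisms of the
tangent spaces with `J² = -1` that is integrable, that is
`[JX, JY] = [X, Y] + J[JX, Y] + J[X, JY]` for all smooth vector fields `X` and `Y`. -/
structure ComplexStructure where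
  /-- The endomorphism of each tangent space. -/
  J : ∀ x : M, TangentSpace 𝓘(ℝ, E) x →L[ℝ] TangentSpace 𝓘(ℝ, E) x
  smooth : ∀ c : M, ContDiffOn ℝ ∞ (endoInChart J c) (extChartAt 𝓘(ℝ, E) c).target
  sq_eq_neg : ∀ (x : M) (v : TangentSpace 𝓘(ℝ, E) x), J x (J x v) = -v
  integrable : ∀ X Y : (∀ x : M, TangentSpace 𝓘(ℝ, E) x),
    IsSmoothVectorField X → IsSmoothVectorField Y → ∀ x : M,
      VectorField.mlieBracket 𝓘(ℝ, E) (fun z => J z (X z)) (fun z => J z (Y z)) x =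
        VectorField.mlieBracket 𝓘(ℝ, E) X Y x +
          J x (VectorField.mlieBracket 𝓘(ℝ, E) (fun z => J z (X z)) Y x) +
          J x (VectorField.mlieBracket 𝓘(ℝ, E) X (fun z => J z (Y z)) x)

namespace ComplexStructure

variable (S : ComplexStructure E M)

/-- `Ω^{p,q}` inside `Ω^k(M, ℂ)` : the forms that are of type `(p,q)` at every point. -/
def bidegreeForms (k : ℕ) (p q : ℤ) : Submodule ℂ (Form E M k) where
  carrier := {η | ∀ x, η.toFun x ∈ bidegree (S.J x) k p q}
  zero_mem' _ := Submodule.zero_mem _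
  add_mem' h h' x := Submodule.add_mem _ (h x) (h' x)
  smul_mem' a _ h x := Submodule.smul_mem _ a (h x)

theorem chartSymmDeriv_rotation (c : M) {y : E} (hy : y ∈ (extChartAt 𝓘(ℝ, E) c).target)
    (θ : ℝ) (v : E) :
    rotation (S.J ((extChartAt 𝓘(ℝ, E) c).symm y)) θ (chartSymmDeriv E c y v) =
      chartSymmDeriv E c y (rotation (endoInChart S.J c y) θ v) := by
  have hid : ∀ w, chartSymmDeriv E c y (chartDeriv E c ((extChartAt 𝓘(ℝ, E) c).symm y) w) = w :=
    fun w => congrArg (fun L => L w) (chartSymmDeriv_comp_chartDeriv c hy)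
  change Real.cos θ • chartSymmDeriv E c y v + Real.sin θ • _ =
    chartSymmDeriv E c y (Real.cos θ • v + Real.sin θ • chartDeriv E c _ _)
  rw [map_add, map_smul, map_smul, hid]
  rfl

variable [FiniteDimensional ℝ E]

/-- The projection `Ω^k(M, ℂ) → Ω^{p,q}`, as an endomorphism of `Ω^k(M, ℂ)`. -/
def proj (k : ℕ) (p q : ℤ) : Form E M k →ₗ[ℂ] Form E M k where
  toFun η := ⟨fun x => bidegreeProj (S.J x) k p q (η.toFun x), fun c => by
    by_cases h : 0 ≤ p ∧ 0 ≤ q ∧ p + q = k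
    · have key : ∀ y ∈ (extChartAt 𝓘(ℝ, E) c).target,
          formInChart (fun x => bidegreeProj (S.J x) k p q (η.toFun x)) c y =
            bidegreeProj (endoInChart S.J c y) k p q (formInChart η.toFun c y) := by
        intro y hy
        rw [bidegreeProj_apply _ h, formInChart, bidegreeProj_apply _ h]
        ext v
        simp only [ContinuousAlternatingMap.compContinuousLinearMap_apply,
          ContinuousAlternatingMap.smul_apply, ContinuousAlternatingMap.sum_apply]
        refine congrArg _ (Finset.sum_congr rfl fun j _ => congrArg _ ?_)
        refine congrArg (η.toFun ((extChartAt 𝓘(ℝ, E) c).symm y)) (funext fun i => ?_)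
        exact S.chartSymmDeriv_rotation c hy _ (v i)
      refine ContDiffOn.congr (contDiffOn_of_apply fun v => ?_) key
      simp only [bidegreeProj_apply _ h, ContinuousAlternatingMap.smul_apply,
        ContinuousAlternatingMap.sum_apply, smul_eq_mul]
      refine contDiffOn_const.mul (ContDiffOn.sum fun j _ => contDiffOn_const.mul ?_)
      refine contDiffOn_apply_apply (η.smooth c) ?_ v
      exact contDiffOn_const.add ((S.smooth c).const_smul _)
    · have h0 : (fun x => bidegreeProj (S.J x) k p q (η.toFun x)) = 0 :=
        funext fun x => bidegreeProj_apply_zero _ h _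
      rw [h0]
      exact (0 : Form E M k).smooth c⟩
  map_add' η ζ := by
    refine Form.ext (funext fun x => ?_)
    exact map_add (bidegreeProj (S.J x) k p q) (η.toFun x) (ζ.toFun x)
  map_smul' a η := by
    refine Form.ext (funext fun x => ?_)
    exact map_smul (bidegreeProj (S.J x) k p q) a (η.toFun x)

/-- The operator `∂ : Ω^k(M, ℂ) → Ω^{k+1}(M, ℂ)`, which on `Ω^{p,q}` is `d` followed by the
projection onto `Ω^{p+1,q}`. -/
def del (k : ℕ) : Form E M k →ₗ[ℂ] Form E M (k + 1) :=
  ∑ p ∈ Finset.range (k + 1),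
    (S.proj (k + 1) (p + 1) (k - p)).comp ((d E M k).comp (S.proj k p (k - p)))

/-- The operator `∂̄ : Ω^k(M, ℂ) → Ω^{k+1}(M, ℂ)`, which on `Ω^{p,q}` is `d` followed by the
projection onto `Ω^{p,q+1}`. -/
def delbar (k : ℕ) : Form E M k →ₗ[ℂ] Form E M (k + 1) :=
  ∑ p ∈ Finset.range (k + 1),
    (S.proj (k + 1) p (k - p + 1)).comp ((d E M k).comp (S.proj k p (k - p)))

theorem proj_of_mem {k : ℕ} {p q : ℤ} {η : Form E M k} (h : η ∈ S.bidegreeForms k p q) :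
    S.proj k p q η = η := by
  refine Form.ext (funext fun x => ?_)
  exact bidegreeProj_of_mem (h x)

theorem proj_of_mem_ne {k : ℕ} {p q p' q' : ℤ} {η : Form E M k}
    (h : η ∈ S.bidegreeForms k p' q') (hne : (p', q') ≠ (p, q)) : S.proj k p q η = 0 := by
  refine Form.ext (funext fun x => ?_)
  exact bidegreeProj_of_mem_ne (h x) hne

/-- On `Ω^{p,q}`, the operator `∂` is `d` followed by the projection onto `Ω^{p+1,q}`. -/
theorem del_of_mem {p q : ℕ} {η : Form E M (p + q)} (h : η ∈ S.bidegreeForms (p + q) p q) :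
    S.del (p + q) η = S.proj (p + q + 1) (p + 1) q (d E M (p + q) η) := by
  rw [del, LinearMap.sum_apply, Finset.sum_eq_single p]
  · have : ((p + q : ℕ) : ℤ) - p = q := by push_cast; ring
    rw [this, LinearMap.comp_apply, LinearMap.comp_apply, S.proj_of_mem h]
  · intro p' _ hne
    rw [LinearMap.comp_apply, LinearMap.comp_apply, S.proj_of_mem_ne h, map_zero, map_zero]
    exact fun he => hne (by have := (Prod.mk.inj he).1; omega)
  · intro hp
    simp at hp

/-- On `Ω^{p,q}`, the operator `∂̄` is `d` followed by the projection onto `Ω^{p,q+1}`. -/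
theorem delbar_of_mem {p q : ℕ} {η : Form E M (p + q)} (h : η ∈ S.bidegreeForms (p + q) p q) :
    S.delbar (p + q) η = S.proj (p + q + 1) p (q + 1) (d E M (p + q) η) := by
  rw [delbar, LinearMap.sum_apply, Finset.sum_eq_single p]
  · have : ((p + q : ℕ) : ℤ) - p = q := by push_cast; ring
    rw [this, LinearMap.comp_apply, LinearMap.comp_apply, S.proj_of_mem h]
  · intro p' _ hne
    rw [LinearMap.comp_apply, LinearMap.comp_apply, S.proj_of_mem_ne h, map_zero, map_zero]
    exact fun he => hne (by have := (Prod.mk.inj he).1; omega)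
  · intro hp
    simp at hp

end ComplexStructure

section Cohomology

/-- The quotient `Z / B` of a space `Z` of cocycles by a space `B` of coboundaries. -/
def Cohomology {W : Type*} [AddCommGroup W] [Module ℂ W] (Z B : Submodule ℂ W) : Type _ :=
  Z ⧸ B.submoduleOf Z

instance {W : Type*} [AddCommGroup W] [Module ℂ W] (Z B : Submodule ℂ W) :
    AddCommGroup (Cohomology Z B) := inferInstanceAs (AddCommGroup (Z ⧸ B.submoduleOf Z))

instance {W : Type*} [AddCommGroup W] [Module ℂ W] (Z B : Submodule ℂ W) :
    Module ℂ (Cohomology Z B) := inferInstanceAs (Module ℂ (Z ⧸ B.submoduleOf Z))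

/-- The class in `Z / B` of a cocycle. -/
def Cohomology.mk {W : Type*} [AddCommGroup W] [Module ℂ W] (Z B : Submodule ℂ W) :
    Z →ₗ[ℂ] Cohomology Z B := (B.submoduleOf Z).mkQ

/-- `η` defines a nonzero class in `Z / B` : it is a cocycle and its class does not vanish. -/
def DefinesNonzeroClass {W : Type*} [AddCommGroup W] [Module ℂ W] (Z B : Submodule ℂ W)
    (η : W) : Prop :=
  ∃ h : η ∈ Z, Cohomology.mk Z B ⟨η, h⟩ ≠ 0

variable (E M) in
/-- The closed `k`-forms. -/
def deRhamCocycles (k : ℕ) : Submodule ℂ (Form E M k) := LinearMap.ker (d E M k)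

variable (E M) in
/-- The exact `k`-forms. -/
def deRhamCoboundaries : (k : ℕ) → Submodule ℂ (Form E M k)
  | 0 => ⊥
  | k + 1 => LinearMap.range (d E M k)

variable (E M) in
/-- The de Rham cohomology `H^k_{dR}(M)` with complex coefficients. -/
abbrev DeRhamCohomology (k : ℕ) : Type _ :=
  Cohomology (deRhamCocycles E M k) (deRhamCoboundaries E M k)

namespace ComplexStructure

variable [FiniteDimensional ℝ E] (S : ComplexStructure E M)

/-- `Ω^{p,q} ∩ Ker ∂̄`. -/
def dolbeaultCocycles (k : ℕ) (p q : ℤ) : Submodule ℂ (Form E M k) :=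
  S.bidegreeForms k p q ⊓ LinearMap.ker (S.delbar k)

/-- The image `∂̄ (Ω^{p,q-1})`, inside `Ω^{p,q}`. -/
def dolbeaultCoboundaries : (k : ℕ) → (p q : ℤ) → Submodule ℂ (Form E M k)
  | 0, _, _ => ⊥
  | k + 1, p, q => (S.bidegreeForms k p (q - 1)).map (S.delbar k)

/-- The Dolbeault cohomology `H^{p,q}_{∂̄}`. -/
abbrev DolbeaultCohomology (p q : ℕ) : Type _ :=
  Cohomology (S.dolbeaultCocycles (p + q) p q)
    (S.dolbeaultCoboundaries (p + q) p q)

/-- `Ω^{p,q} ∩ Ker ∂`. -/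
def delCocycles (k : ℕ) (p q : ℤ) : Submodule ℂ (Form E M k) :=
  S.bidegreeForms k p q ⊓ LinearMap.ker (S.del k)

/-- The image `∂ (Ω^{p-1,q})`, inside `Ω^{p,q}`. -/
def delCoboundaries : (k : ℕ) → (p q : ℤ) → Submodule ℂ (Form E M k)
  | 0, _, _ => ⊥
  | k + 1, p, q => (S.bidegreeForms k (p - 1) q).map (S.del k)

/-- The `∂`-cohomology `H^{p,q}_{∂}`. -/
abbrev DelCohomology (p q : ℕ) : Type _ :=
  Cohomology (S.delCocycles (p + q) p q)
    (S.delCoboundaries (p + q) p q)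

/-- `Ω^{p,q} ∩ Ker ∂ ∩ Ker ∂̄`. -/
def bottChernCocycles (k : ℕ) (p q : ℤ) : Submodule ℂ (Form E M k) :=
  S.bidegreeForms k p q ⊓ (LinearMap.ker (S.del k) ⊓ LinearMap.ker (S.delbar k))

/-- The image `∂∂̄ (Ω^{p-1,q-1})`, inside `Ω^{p,q}`. -/
def bottChernCoboundaries : (k : ℕ) → (p q : ℤ) → Submodule ℂ (Form E M k)
  | 0, _, _ => ⊥
  | 1, _, _ => ⊥
  | k + 2, p, q => (S.bidegreeForms k (p - 1) (q - 1)).map ((S.del (k + 1)).comp (S.delbar k))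

/-- The Bott–Chern cohomology `H^{p,q}_{BC}`. -/
abbrev BottChernCohomology (p q : ℕ) : Type _ :=
  Cohomology (S.bottChernCocycles (p + q) p q)
    (S.bottChernCoboundaries (p + q) p q)

/-- `Ω^{p,q} ∩ Ker ∂∂̄`. -/
def aeppliCocycles (k : ℕ) (p q : ℤ) : Submodule ℂ (Form E M k) :=
  S.bidegreeForms k p q ⊓ LinearMap.ker ((S.del (k + 1)).comp (S.delbar k))

/-- The sum of images `∂ (Ω^{p-1,q}) + ∂̄ (Ω^{p,q-1})`. -/
def aeppliCoboundaries : (k : ℕ) → (p q : ℤ) → Submodule ℂ (Form E M k)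
  | 0, _, _ => ⊥
  | k + 1, p, q => (S.bidegreeForms k (p - 1) q).map (S.del k) ⊔
      (S.bidegreeForms k p (q - 1)).map (S.delbar k)

/-- The Aeppli cohomology `H^{p,q}_{A}`. -/
abbrev AeppliCohomology (p q : ℕ) : Type _ :=
  Cohomology (S.aeppliCocycles (p + q) p q)
    (S.aeppliCoboundaries (p + q) p q)

/-- `(S, σ)` is a complex symplectic structure: `σ` is a closed `2`-form of bidegree `(2,0)` that
is non-degenerate. For a form of bidegree `(2,0)`, non-degeneracy on the vectors of type `(1,0)` is
the same as the condition below on real tangent vectors `v`, since `σ(v, w) = σ(v^{1,0}, w^{1,0})`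
and `v ↦ v^{1,0}` is a bijection from the real tangent space. -/
structure IsComplexSymplectic (σ : Form E M 2) : Prop where
  closed : d E M 2 σ = 0
  bidegree_two_zero : σ ∈ S.bidegreeForms 2 2 0
  nondegenerate : ∀ (x : M) (v : TangentSpace 𝓘(ℝ, E) x),
    (∀ w : TangentSpace 𝓘(ℝ, E) x, σ.toFun x ![v, w] = 0) → v = 0

end ComplexStructure

end Cohomology

end Manifold

end ComplexSymplectic

end

/-! Write η = σ^k ∧ σ̄^m, a closed form of type (2k, 2m), so a cocycle in all five theories. An
exact form of that type is its own (2k, 2m)-component; on pure types ∂ and ∂̄ are by construction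
components of d; and the image of ∂∂̄ lies in that of ∂. Hence in all five theories a vanishing
class would make η the (2k, 2m)-component of an exact form dγ (`projExact`), or zero in degree 0.
One non-membership, `notMem_projExact`, thus settles every case.

Pair η with θ = σ^{n-k} ∧ σ̄^{n-m}, closed of type (2(n-k), 2(n-m)). In top degree a form of type
(r, s) with r ≠ s vanishes (`eq_zero_of_mem_bidegree_top`), so only the (2k, 2m)-component of dγ
survives the wedge with θ, and η ∧ θ = dγ ∧ θ = d(γ ∧ θ) (`proj_d_wedge_toFun`). On the other side η
∧ θ = σ^n ∧ σ̄^n is real, and it has no zero: in a linear Darboux basis σ = ∑ α_i ∧ β_i, and σ^n ∧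
σ̄^n is (n!)² times the product, in some order, of all α_i, β_i and their conjugates, a basis of the
complex covectors (`exists_volume_element`).

It remains to see that a real exact top form Ω = dζ on a compact manifold has a zero
(`exists_d_toFun_eq_zero`). If it had none, |Ω| would be a positive density, for which no
orientation is needed. With a partition of unity ρ_c, both the ρ_c and the ratios d(ρ_c ζ)/Ω are
families with sum 1, supported in charts, so their integrals against |Ω| have the same total. For
the ratios every integral is zero, by Stokes in a chart, where |Ω| = ±Ω with a locally constant
sign; for the ρ_c the total is positive.

The pointwise algebra is carried out in the exterior algebra of the complex covectors, where
associativity, powers and signs are ring identities, and is transported to alternating forms by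
`toForm`. -/

noncomputable section

namespace ComplexSymplectic

/-! ### The wedge product through the exterior algebra -/

section ExteriorAlgebraOfForms

variable {V : Type*} [AddCommGroup V] [Module ℝ V] [TopologicalSpace V]

theorem alternatization_domDomCongr {R ι ι' M N : Type*} [CommSemiring R] [AddCommMonoid M]
    [Module R M] [AddCommGroup N] [Module R N] [Fintype ι] [Fintype ι'] [DecidableEq ι]
    [DecidableEq ι'] (e : ι ≃ ι') (f : MultilinearMap R (fun _ : ι => M) N) :
    MultilinearMap.alternatization (f.domDomCongr e) =
      (MultilinearMap.alternatization f).domDomCongr e := by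
  ext v
  rw [AlternatingMap.domDomCongr_apply, MultilinearMap.alternatization_apply,
    MultilinearMap.alternatization_apply, ← e.permCongr.sum_comp]
  refine Finset.sum_congr rfl fun σ _ => ?_
  rw [Equiv.Perm.sign_permCongr]
  simp

/-- `domCoprod` sums over shuffles only. Since `a` and `b` already alternate, the sum over all
permutations counts each shuffle k! l! times, which is exactly what the normalisation of `wedge`
divides by. -/
theorem wedge_toAlternatingMap {k l : ℕ} (a : V [⋀^Fin k]→L[ℝ] ℂ) (b : V [⋀^Fin l]→L[ℝ] ℂ) :
    (wedge a b).toAlternatingMap =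
      ((LinearMap.mul' ℝ ℂ).compAlternatingMap
        (a.toAlternatingMap.domCoprod b.toAlternatingMap)).domDomCongr finSumFinEquiv := by
  have h : (ContinuousMultilinearMap.alternatization (mulForms a b)).toAlternatingMap =
      ((LinearMap.mul' ℝ ℂ).compAlternatingMap ((k.factorial * l.factorial) •
        (a.toAlternatingMap.domCoprod b.toAlternatingMap))).domDomCongr finSumFinEquiv := by
    rw [ContinuousMultilinearMap.alternatization_apply_toAlternatingMap]
    change MultilinearMap.alternatization (MultilinearMap.domDomCongr _ _) = _
    rw [alternatization_domDomCongr, LinearMap.compMultilinearMap_alternatization,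
      MultilinearMap.domCoprod_alternization_eq, Fintype.card_fin, Fintype.card_fin]
  ext v
  have h' := congrArg (fun f => f v) h
  have hk : (k.factorial : ℂ) ≠ 0 := by exact_mod_cast k.factorial_ne_zero
  have hl : (l.factorial : ℂ) ≠ 0 := by exact_mod_cast l.factorial_ne_zero
  change ((k.factorial * l.factorial : ℂ)⁻¹) *
    (ContinuousMultilinearMap.alternatization (mulForms a b)).toAlternatingMap v = _
  rw [h', inv_mul_eq_iff_eq_mul₀ (mul_ne_zero hk hl)]
  change LinearMap.mul' ℝ ℂ ((k.factorial * l.factorial) • _) = _ * LinearMap.mul' ℝ ℂ _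
  rw [map_nsmul, nsmul_eq_mul]
  push_cast
  rfl

/-- Both sides are the alternatization of one product of covectors: the shuffle product of two
alternatizations is the alternatization of the tensor product. -/
theorem wedge_covectorWedge {k l : ℕ} (α : Fin k → V →L[ℝ] ℂ) (β : Fin l → V →L[ℝ] ℂ) :
    wedge (covectorWedge α) (covectorWedge β) = covectorWedge (Fin.append α β) := by
  apply ContinuousAlternatingMap.toAlternatingMap_injective
  rw [wedge_toAlternatingMap, covectorWedge, covectorWedge, covectorWedge,
    ContinuousMultilinearMap.alternatization_apply_toAlternatingMap,
    ContinuousMultilinearMap.alternatization_apply_toAlternatingMap,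
    ContinuousMultilinearMap.alternatization_apply_toAlternatingMap,
    ← MultilinearMap.domCoprod_alternization, ← LinearMap.compMultilinearMap_alternatization,
    ← alternatization_domDomCongr]
  congr 1
  ext v
  simp [Fin.prod_univ_add]

theorem wedge_add_left {k l : ℕ} (a a' : V [⋀^Fin k]→L[ℝ] ℂ) (b : V [⋀^Fin l]→L[ℝ] ℂ) :
    wedge (a + a') b = wedge a b + wedge a' b := by
  ext v
  simp only [ContinuousAlternatingMap.add_apply, wedge_apply, add_mul, smul_add,
    Finset.sum_add_distrib, mul_add]

theorem wedge_add_right {k l : ℕ} (a : V [⋀^Fin k]→L[ℝ] ℂ) (b b' : V [⋀^Fin l]→L[ℝ] ℂ) :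
    wedge a (b + b') = wedge a b + wedge a b' := by
  ext v
  simp only [ContinuousAlternatingMap.add_apply, wedge_apply, smul_add,
    Finset.sum_add_distrib, mul_add]

theorem wedge_smul_left {k l : ℕ} (c : ℂ) (a : V [⋀^Fin k]→L[ℝ] ℂ) (b : V [⋀^Fin l]→L[ℝ] ℂ) :
    wedge (c • a) b = c • wedge a b := by
  ext v
  simp only [ContinuousAlternatingMap.smul_apply, wedge_apply, smul_eq_mul]
  rw [mul_left_comm]
  congr 1
  simp only [Finset.mul_sum, mul_assoc, mul_smul_comm]

theorem wedge_smul_right {k l : ℕ} (c : ℂ) (a : V [⋀^Fin k]→L[ℝ] ℂ) (b : V [⋀^Fin l]→L[ℝ] ℂ) :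
    wedge a (c • b) = c • wedge a b := by
  ext v
  simp only [ContinuousAlternatingMap.smul_apply, wedge_apply, smul_eq_mul]
  rw [mul_left_comm]
  congr 1
  simp only [Finset.mul_sum, mul_left_comm, mul_smul_comm]

/-- The wedge product, as a bilinear map. -/
def wedgeBilin (V : Type*) [AddCommGroup V] [Module ℝ V] [TopologicalSpace V] (k l : ℕ) :
    (V [⋀^Fin k]→L[ℝ] ℂ) →ₗ[ℂ] (V [⋀^Fin l]→L[ℝ] ℂ) →ₗ[ℂ] (V [⋀^Fin (k + l)]→L[ℝ] ℂ) :=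
  LinearMap.mk₂ ℂ wedge wedge_add_left wedge_smul_left wedge_add_right wedge_smul_right

theorem wedgeBilin_apply {k l : ℕ} (a : V [⋀^Fin k]→L[ℝ] ℂ) (b : V [⋀^Fin l]→L[ℝ] ℂ) :
    wedgeBilin V k l a b = wedge a b := rfl

variable (V) in
/-- The wedge product of `k` complex covectors, as an alternating map. -/
def covectorWedgeAlternating (k : ℕ) :
    (V →L[ℝ] ℂ) [⋀^Fin k]→ₗ[ℂ] (V [⋀^Fin k]→L[ℝ] ℂ) where
  toFun := covectorWedge
  map_update_add' {inst} α i x y := by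
    cases Subsingleton.elim inst (instDecidableEqFin k)
    ext v
    let ev : (V →L[ℝ] ℂ) →ₗ[ℂ] (Fin k → ℂ) :=
      { toFun := fun a j => a (v j), map_add' := fun _ _ => rfl, map_smul' := fun _ _ => rfl }
    simp only [ContinuousAlternatingMap.add_apply, covectorWedge_apply]
    exact (Matrix.detRowAlternating.compLinearMap ev).map_update_add α i x y
  map_update_smul' {inst} α i c x := by
    cases Subsingleton.elim inst (instDecidableEqFin k)
    ext v
    let ev : (V →L[ℝ] ℂ) →ₗ[ℂ] (Fin k → ℂ) :=
      { toFun := fun a j => a (v j), map_add' := fun _ _ => rfl, map_smul' := fun _ _ => rfl }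
    simp only [ContinuousAlternatingMap.smul_apply, covectorWedge_apply]
    exact (Matrix.detRowAlternating.compLinearMap ev).map_update_smul α i c x
  map_eq_zero_of_eq' α i j h hij := by
    ext v
    rw [covectorWedge_apply]
    exact Matrix.det_zero_of_row_eq hij (by ext; simp [h])

/-- The linear map from the exterior algebra of the complex covectors to the complex-valued
alternating `k`-forms, which maps `α₁ ⋯ α_k` to `α₁ ∧ ⋯ ∧ α_k` and vanishes on the other degrees. -/
def toForm (k : ℕ) : ExteriorAlgebra ℂ (V →L[ℝ] ℂ) →ₗ[ℂ] (V [⋀^Fin k]→L[ℝ] ℂ) :=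
  ExteriorAlgebra.liftAlternating
    (Pi.single (M := fun i => (V →L[ℝ] ℂ) [⋀^Fin i]→ₗ[ℂ] (V [⋀^Fin k]→L[ℝ] ℂ)) k
      (covectorWedgeAlternating V k))

theorem toForm_ιMulti {k : ℕ} (α : Fin k → V →L[ℝ] ℂ) :
    toForm k (ExteriorAlgebra.ιMulti ℂ k α) = covectorWedge α := by
  rw [toForm, ExteriorAlgebra.liftAlternating_apply_ιMulti, Pi.single_eq_same]
  rfl

/-- By bilinearity it suffices to take products of covectors, where multiplication is concatenation
on both sides. Homogeneity is essential, as `toForm (k + l)` sees only one degree. -/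
theorem toForm_mul {k l : ℕ} {x y : ExteriorAlgebra ℂ (V →L[ℝ] ℂ)}
    (hx : x ∈ ⋀[ℂ]^k (V →L[ℝ] ℂ)) (hy : y ∈ ⋀[ℂ]^l (V →L[ℝ] ℂ)) :
    toForm (k + l) (x * y) = wedge (toForm k x) (toForm l y) := by
  rw [← ExteriorAlgebra.ιMulti_span_fixedDegree] at hx hy
  rw [← wedgeBilin_apply]
  induction hx using Submodule.span_induction with
  | mem x hx =>
    obtain ⟨α, rfl⟩ := hx
    induction hy using Submodule.span_induction with
    | mem y hy =>
      obtain ⟨β, rfl⟩ := hy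
      rw [ExteriorAlgebra.ιMulti_mul_ιMulti, toForm_ιMulti, toForm_ιMulti, toForm_ιMulti,
        wedgeBilin_apply, wedge_covectorWedge]
    | zero => simp
    | add y z _ _ hy hz => rw [mul_add, map_add, map_add, map_add, hy, hz]
    | smul c y _ hy => rw [mul_smul_comm, map_smul, map_smul, map_smul, hy]
  | zero => simp
  | add y z _ _ hy hz => rw [add_mul, map_add, map_add, map_add, hy, hz]; rfl
  | smul c y _ hy => rw [smul_mul_assoc, map_smul, map_smul, map_smul, hy]; rfl

theorem toForm_one : toForm 0 (1 : ExteriorAlgebra ℂ (V →L[ℝ] ℂ)) =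
    ContinuousAlternatingMap.constOfIsEmpty ℝ V (Fin 0) (1 : ℂ) := by
  rw [← ExteriorAlgebra.ιMulti_zero_apply (R := ℂ) (M := V →L[ℝ] ℂ) 0, toForm_ιMulti]
  ext v
  rw [covectorWedge_apply]
  simp

section FiniteDimensional

variable [IsTopologicalAddGroup V] [FiniteDimensional ℝ V] [T2Space V] [ContinuousSMul ℝ V]

/-- Expansion in the dual of a real basis. The sum runs over all k-tuples of indices rather than
increasing ones, hence the factor 1/k!. -/
theorem span_covectorWedge (k : ℕ) :
    Submodule.span ℂ (Set.range (covectorWedge : (Fin k → V →L[ℝ] ℂ) → _)) = ⊤ := by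
  refine eq_top_iff.mpr fun a _ => ?_
  classical
  set b := Module.finBasis ℝ V
  set d := Module.finrank ℝ V
  set c : Fin d → V →L[ℝ] ℂ := fun t =>
    Complex.ofRealCLM.comp (LinearMap.toContinuousLinearMap (b.coord t)) with hc
  have hcv : ∀ t v, c t v = (b.repr v t : ℂ) := fun t v => rfl
  have hk : (k.factorial : ℂ) ≠ 0 := by exact_mod_cast k.factorial_ne_zero
  have key : a = (k.factorial : ℂ)⁻¹ • ∑ f : Fin k → Fin d,
      a (fun i => b (f i)) • covectorWedge (fun i => c (f i)) := by
    ext v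
    have hexp : ∀ w : Fin k → V, a w =
        ∑ f : Fin k → Fin d, (∏ i, c (f i) (w i)) * a (fun i => b (f i)) := by
      intro w
      conv_lhs => rw [show w = fun i => ∑ t, b.repr (w i) t • b t from
        funext fun i => (b.sum_repr (w i)).symm]
      rw [ContinuousAlternatingMap.map_sum]
      refine Finset.sum_congr rfl fun f _ => ?_
      have := a.toMultilinearMap.map_smul_univ (fun i => b.repr (w i) (f i)) (fun i => b (f i))
      refine this.trans ?_
      simp only [hcv]
      rw [← Complex.ofReal_prod, Complex.real_smul]
      rfl
    rw [ContinuousAlternatingMap.smul_apply, ContinuousAlternatingMap.sum_apply]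
    have hsgn : ∀ σ : Equiv.Perm (Fin k), Equiv.Perm.sign σ • a (v ∘ σ) = a v := by
      intro σ
      have := a.toAlternatingMap.map_perm v σ
      refine (congrArg (fun z => Equiv.Perm.sign σ • z) this).trans ?_
      rw [smul_smul, Int.units_mul_self, one_smul]
      rfl
    have hsum : ∑ σ : Equiv.Perm (Fin k), Equiv.Perm.sign σ • a (v ∘ σ) =
        (k.factorial : ℂ) * a v := by
      simp [hsgn, Fintype.card_perm]
    rw [eq_comm, smul_eq_mul, inv_mul_eq_iff_eq_mul₀ hk, ← hsum]
    simp only [ContinuousAlternatingMap.smul_apply, covectorWedge,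
      ContinuousMultilinearMap.alternatization_apply_apply]
    simp only [Finset.smul_sum]
    rw [Finset.sum_comm]
    refine Finset.sum_congr rfl fun σ _ => ?_
    rw [hexp (v ∘ σ), Finset.smul_sum]
    refine Finset.sum_congr rfl fun f _ => ?_
    rw [smul_comm]
    congr 1
    simp [mul_comm]
  rw [key]
  exact Submodule.smul_mem _ _ (Submodule.sum_mem _ fun f _ =>
    Submodule.smul_mem _ _ (Submodule.subset_span ⟨_, rfl⟩))

theorem exists_toForm_eq {k : ℕ} (a : V [⋀^Fin k]→L[ℝ] ℂ) :
    ∃ x ∈ ⋀[ℂ]^k (V →L[ℝ] ℂ), toForm k x = a := by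
  have ha : a ∈ Submodule.span ℂ (Set.range (covectorWedge : (Fin k → V →L[ℝ] ℂ) → _)) := by
    rw [span_covectorWedge]; trivial
  induction ha using Submodule.span_induction with
  | mem a ha =>
    obtain ⟨α, rfl⟩ := ha
    exact ⟨_, ExteriorAlgebra.ιMulti_range ℂ k ⟨α, rfl⟩, toForm_ιMulti α⟩
  | zero => exact ⟨0, Submodule.zero_mem _, map_zero _⟩
  | add a b _ _ ha hb =>
    obtain ⟨x, hx, rfl⟩ := ha
    obtain ⟨y, hy, rfl⟩ := hb
    exact ⟨x + y, Submodule.add_mem _ hx hy, map_add _ _ _⟩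
  | smul c a _ ha =>
    obtain ⟨x, hx, rfl⟩ := ha
    exact ⟨c • x, Submodule.smul_mem _ _ hx, map_smul _ _ _⟩

end FiniteDimensional

end ExteriorAlgebraOfForms

end ComplexSymplectic

end

noncomputable section

namespace ComplexSymplectic

/-! ### Bidegree, rotations and top-degree forms -/

section Types

variable {V : Type*} [AddCommGroup V] [Module ℝ V] [TopologicalSpace V]

theorem wedge_compContinuousLinearMap {k l : ℕ} (a : V [⋀^Fin k]→L[ℝ] ℂ)
    (b : V [⋀^Fin l]→L[ℝ] ℂ) {W : Type*} [AddCommGroup W] [Module ℝ W] [TopologicalSpace W]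
    (R : W →L[ℝ] V) :
    (wedge a b).compContinuousLinearMap R =
      wedge (a.compContinuousLinearMap R) (b.compContinuousLinearMap R) := by
  ext v
  rw [ContinuousAlternatingMap.compContinuousLinearMap_apply, wedge_apply, wedge_apply]
  rfl

theorem conjForm_wedge {k l : ℕ} (a : V [⋀^Fin k]→L[ℝ] ℂ) (b : V [⋀^Fin l]→L[ℝ] ℂ) :
    conjForm (wedge a b) = wedge (conjForm a) (conjForm b) := by
  ext v
  rw [conjForm_apply, wedge_apply, wedge_apply, map_mul, map_sum]
  congr 1
  · simp
  · refine Finset.sum_congr rfl fun σ _ => ?_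
    rcases Int.units_eq_one_or (Equiv.Perm.sign σ) with h | h <;> simp [h, conjForm_apply]

theorem conjForm_covectorWedge {k : ℕ} (α : Fin k → V →L[ℝ] ℂ) :
    conjForm (covectorWedge α) =
      covectorWedge fun i => (Complex.conjCLE : ℂ →L[ℝ] ℂ).comp (α i) := by
  ext v
  rw [conjForm_apply, covectorWedge_apply, covectorWedge_apply, RingHom.map_det]
  rfl

theorem conjForm_add {k : ℕ} (a b : V [⋀^Fin k]→L[ℝ] ℂ) :
    conjForm (a + b) = conjForm a + conjForm b := by
  ext v
  simp [conjForm_apply]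

theorem conjForm_compContinuousLinearMap {k : ℕ} (a : V [⋀^Fin k]→L[ℝ] ℂ) (R : V →L[ℝ] V) :
    (conjForm a).compContinuousLinearMap R = conjForm (a.compContinuousLinearMap R) := rfl

/-- Real top forms are multiples of the determinant of a basis; real and imaginary parts are treated
separately. -/
theorem apply_comp_eq_det_mul [FiniteDimensional ℝ V] {N : ℕ} (hN : Module.finrank ℝ V = N)
    (a : V [⋀^Fin N]→L[ℝ] ℂ)
    (R : V →ₗ[ℝ] V) (v : Fin N → V) : a (R ∘ v) = (LinearMap.det R : ℝ) * a v := by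
  set e := (Module.finBasis ℝ V).reindex (finCongr hN)
  have key : ∀ g : V [⋀^Fin N]→ₗ[ℝ] ℝ, g (R ∘ v) = LinearMap.det R * g v := by
    intro g
    rw [g.eq_smul_basis_det e, AlternatingMap.smul_apply, AlternatingMap.smul_apply,
      Module.Basis.det_comp]
    simp only [smul_eq_mul]
    ring
  apply Complex.ext
  · rw [Complex.re_ofReal_mul]
    exact key (Complex.reCLM.compContinuousAlternatingMap a).toAlternatingMap
  · rw [Complex.im_ofReal_mul]
    exact key (Complex.imCLM.compContinuousAlternatingMap a).toAlternatingMap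

/-- A rotation multiplies a top form by its determinant, which is real, and a form of type (p, q) by
e^{i(p-q)θ}. For p ≠ q some angle makes the latter factor non-real. -/
theorem eq_zero_of_mem_bidegree_top [IsTopologicalAddGroup V]
    [ContinuousSMul ℝ V] [FiniteDimensional ℝ V] {J : V →L[ℝ] V} {N : ℕ}
    (hN : Module.finrank ℝ V = N) {p q : ℤ}
    (hpq : p ≠ q) {a : V [⋀^Fin N]→L[ℝ] ℂ} (ha : a ∈ bidegree J N p q) : a = 0 := by
  ext v
  by_contra hv
  have hD : ((p - q : ℤ) : ℝ) ≠ 0 := by exact_mod_cast sub_ne_zero.mpr hpq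
  -- Chosen so that e^{i(p-q)θ} = i.
  set θ : ℝ := Real.pi / 2 / (p - q : ℤ)
  have h1 := apply_comp_eq_det_mul hN a (rotation J θ).toLinearMap v
  have h2 := congrArg (fun b => b v) (compRotation_of_mem ha θ)
  have h3 : a ((rotation J θ).toLinearMap ∘ v) = Complex.exp ((p - q : ℤ) * θ * Complex.I) * a v :=
    h2
  rw [h3] at h1
  have h4 := mul_right_cancel₀ hv h1
  have h5 : ((p - q : ℤ) : ℂ) * θ = (Real.pi : ℂ) / 2 := by
    have : ((p - q : ℤ) : ℝ) * θ = Real.pi / 2 := mul_div_cancel₀ _ hD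
    exact_mod_cast congrArg (Complex.ofReal) this
  rw [h5, Complex.exp_pi_div_two_mul_I] at h4
  simpa using congrArg Complex.im h4

variable [IsTopologicalAddGroup V] [FiniteDimensional ℝ V] [T2Space V] [ContinuousSMul ℝ V]
  {J : V →L[ℝ] V}

/-- Converse of `compRotation_of_mem`: in the Fourier average defining `bidegreeProj` all k + 1
terms equal `a`, so `a` is its own projection. Types can then be read off from characters, which
multiply under wedge and invert under conjugation. -/
theorem mem_bidegree_of_rotation (hJ : ∀ v, J (J v) = -v) {k : ℕ} {p q : ℤ} (hp : 0 ≤ p)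
    (hq : 0 ≤ q) (hpq : p + q = k) {a : V [⋀^Fin k]→L[ℝ] ℂ}
    (h : ∀ θ : ℝ, a.compContinuousLinearMap (rotation J θ) =
      Complex.exp ((p - q : ℤ) * θ * Complex.I) • a) : a ∈ bidegree J k p q := by
  have hk : (k + 1 : ℂ) ≠ 0 := by exact_mod_cast Nat.succ_ne_zero k
  have : bidegreeProj J k p q a = a := by
    rw [bidegreeProj_apply J ⟨hp, hq, hpq⟩]
    simp only [h, smul_smul, ← Complex.exp_add, mul_assoc, neg_add_cancel, Complex.exp_zero]
    simp only [one_smul, Finset.sum_const, Finset.card_range]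
    rw [← Nat.cast_smul_eq_nsmul ℂ, smul_smul]
    push_cast
    rw [inv_mul_cancel₀ hk, one_smul]
  rw [← this]
  exact bidegreeProj_mem hJ p q a

theorem wedge_mem_bidegree (hJ : ∀ v, J (J v) = -v) {k l : ℕ} {p q p' q' : ℤ}
    {a : V [⋀^Fin k]→L[ℝ] ℂ} {b : V [⋀^Fin l]→L[ℝ] ℂ} (ha : a ∈ bidegree J k p q)
    (hb : b ∈ bidegree J l p' q') : wedge a b ∈ bidegree J (k + l) (p + p') (q + q') := by
  by_cases h : 0 ≤ p ∧ 0 ≤ q ∧ p + q = k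
  swap
  · rw [bidegree_eq_bot h, Submodule.mem_bot] at ha
    rw [ha, ← wedgeBilin_apply, map_zero]
    exact Submodule.zero_mem _
  by_cases h' : 0 ≤ p' ∧ 0 ≤ q' ∧ p' + q' = l
  swap
  · rw [bidegree_eq_bot h', Submodule.mem_bot] at hb
    rw [hb, ← wedgeBilin_apply, map_zero]
    exact Submodule.zero_mem _
  refine mem_bidegree_of_rotation hJ (by omega) (by omega) (by push_cast; omega) fun θ => ?_
  rw [wedge_compContinuousLinearMap, compRotation_of_mem ha, compRotation_of_mem hb,
    wedge_smul_left, wedge_smul_right, smul_smul, ← Complex.exp_add]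
  congr 2
  push_cast
  ring

theorem conjForm_mem_bidegree (hJ : ∀ v, J (J v) = -v) {k : ℕ} {p q : ℤ}
    {a : V [⋀^Fin k]→L[ℝ] ℂ} (ha : a ∈ bidegree J k p q) : conjForm a ∈ bidegree J k q p := by
  by_cases h : 0 ≤ p ∧ 0 ≤ q ∧ p + q = k
  swap
  · rw [bidegree_eq_bot h, Submodule.mem_bot] at ha
    rw [show conjForm a = 0 by ext v; simp [conjForm_apply, ha]]
    exact Submodule.zero_mem _
  refine mem_bidegree_of_rotation hJ (by omega) (by omega) (by omega) fun θ => ?_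
  rw [conjForm_compContinuousLinearMap, compRotation_of_mem ha]
  ext v
  simp only [conjForm_apply, ContinuousAlternatingMap.smul_apply, smul_eq_mul, map_mul,
    ← Complex.exp_conj]
  congr 2
  simp
  ring

end Types

end ComplexSymplectic

end

noncomputable section

namespace ComplexSymplectic

/-! ### The Leibniz rule on a vector space -/

section Leibniz

theorem toForm_cast {V : Type*} [AddCommGroup V] [Module ℝ V] [TopologicalSpace V] {k l : ℕ}
    (h : k = l) (x : ExteriorAlgebra ℂ (V →L[ℝ] ℂ)) (v : Fin l → V) :
    toForm k x (v ∘ Fin.cast h) = toForm l x v := by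
  subst h
  rfl

/-- The covector anticommutes past each of the k factors in turn. The sign of the Leibniz rule comes
from here. -/
theorem mul_ι_eq {W : Type*} [AddCommGroup W] [Module ℂ W] {k : ℕ} {x : ExteriorAlgebra ℂ W}
    (hx : x ∈ ⋀[ℂ]^k W) (α : W) :
    x * ExteriorAlgebra.ι ℂ α = (-1 : ℂ) ^ k • (ExteriorAlgebra.ι ℂ α * x) := by
  rw [← ExteriorAlgebra.ιMulti_span_fixedDegree] at hx
  induction hx using Submodule.span_induction with
  | mem x hx =>
    obtain ⟨β, rfl⟩ := hx
    induction k with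
    | zero => simp
    | succ k ih =>
      have h := eq_neg_of_add_eq_zero_left (ExteriorAlgebra.ι_add_mul_swap (R := ℂ) (β 0) α)
      rw [ExteriorAlgebra.ιMulti_succ_apply, mul_assoc, ih, mul_smul_comm, ← mul_assoc, h,
        pow_succ, mul_neg_one, neg_smul, neg_mul, smul_neg, mul_assoc]
  | zero => simp
  | add x y _ _ hx hy => rw [add_mul, mul_add, hx, hy, smul_add]
  | smul c x _ hx => rw [smul_mul_assoc, hx, mul_smul_comm, smul_comm]

theorem ι_mul_mem {W : Type*} [AddCommGroup W] [Module ℂ W] {k : ℕ} (α : W)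
    {x : ExteriorAlgebra ℂ W} (hx : x ∈ ⋀[ℂ]^k W) :
    ExteriorAlgebra.ι ℂ α * x ∈ ⋀[ℂ]^(k + 1) W := by
  rw [ExteriorAlgebra.exteriorPower, pow_succ']
  exact Submodule.mul_mem_mul ⟨α, rfl⟩ hx

theorem mul_mem_exteriorPower {W : Type*} [AddCommGroup W] [Module ℂ W] {k l : ℕ}
    {x y : ExteriorAlgebra ℂ W} (hx : x ∈ ⋀[ℂ]^k W) (hy : y ∈ ⋀[ℂ]^l W) :
    x * y ∈ ⋀[ℂ]^(k + l) W := by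
  rw [ExteriorAlgebra.exteriorPower, pow_add]
  exact Submodule.mul_mem_mul hx hy

variable {E : Type*} [NormedAddCommGroup E] [NormedSpace ℝ E]

/-- On a product of covectors this is the Laplace expansion of a determinant along its first row;
the rest is linearity. It turns the exterior derivative, an alternatized differential, into left
multiplication by covectors. -/
theorem alternatizeUncurryFin_smulRight {k : ℕ} (α : E →L[ℝ] ℂ)
    {x : ExteriorAlgebra ℂ (E →L[ℝ] ℂ)} (hx : x ∈ ⋀[ℂ]^k (E →L[ℝ] ℂ)) :
    ContinuousAlternatingMap.alternatizeUncurryFin (α.smulRight (toForm k x)) =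
      toForm (k + 1) (ExteriorAlgebra.ι ℂ α * x) := by
  rw [← ExteriorAlgebra.ιMulti_span_fixedDegree] at hx
  induction hx using Submodule.span_induction with
  | mem x hx =>
    obtain ⟨β, rfl⟩ := hx
    have h : ExteriorAlgebra.ι ℂ α * ExteriorAlgebra.ιMulti ℂ k β =
        ExteriorAlgebra.ιMulti ℂ (k + 1) (Fin.cons α β : Fin (k + 1) → E →L[ℝ] ℂ) := by
      rw [ExteriorAlgebra.ιMulti_succ_apply]
      rfl
    rw [h, toForm_ιMulti, toForm_ιMulti]
    ext v
    rw [ContinuousAlternatingMap.alternatizeUncurryFin_apply, covectorWedge_apply,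
      Matrix.det_succ_row_zero]
    refine Finset.sum_congr rfl fun i _ => ?_
    rw [ContinuousLinearMap.smulRight_apply, ContinuousAlternatingMap.smul_apply,
      covectorWedge_apply, zsmul_eq_mul, smul_eq_mul, mul_assoc]
    push_cast
    rfl
  | zero =>
    ext v
    simp [ContinuousAlternatingMap.alternatizeUncurryFin_apply]
  | add x y _ _ hx hy =>
    rw [mul_add, map_add, map_add, ← hx, ← hy]
    ext v
    simp [ContinuousAlternatingMap.alternatizeUncurryFin_apply, Finset.sum_add_distrib]
  | smul c x _ hx =>
    rw [mul_smul_comm, map_smul, map_smul, ← hx]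
    ext v
    simp only [ContinuousAlternatingMap.alternatizeUncurryFin_apply,
      ContinuousLinearMap.smulRight_apply, ContinuousAlternatingMap.smul_apply, Finset.smul_sum]
    refine Finset.sum_congr rfl fun i _ => ?_
    simp only [smul_eq_mul, zsmul_eq_mul]
    ring

variable [FiniteDimensional ℝ E]

theorem finiteDimensional_forms (k : ℕ) : FiniteDimensional ℝ (E [⋀^Fin k]→L[ℝ] ℂ) := by
  set b := Module.finBasis ℝ E
  let ev : (E [⋀^Fin k]→L[ℝ] ℂ) →ₗ[ℝ] ((Fin k → Fin (Module.finrank ℝ E)) → ℂ) :=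
    { toFun := fun a r => a (fun i => b (r i))
      map_add' := fun _ _ => rfl
      map_smul' := fun _ _ => rfl }
  refine Module.Finite.of_injective ev fun a a' h => ?_
  apply ContinuousAlternatingMap.toAlternatingMap_injective
  apply AlternatingMap.coe_multilinearMap_injective
  exact Module.Basis.ext_multilinear (fun _ => b) fun r => congrFun h r

variable (E) in
/-- The wedge product, as a continuous bilinear map. -/
def wedgeCLM (k l : ℕ) :
    (E [⋀^Fin k]→L[ℝ] ℂ) →L[ℝ] (E [⋀^Fin l]→L[ℝ] ℂ) →L[ℝ] (E [⋀^Fin (k + l)]→L[ℝ] ℂ) :=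
  haveI := finiteDimensional_forms (E := E) k
  haveI := finiteDimensional_forms (E := E) l
  LinearMap.toContinuousBilinearMap
    (LinearMap.mk₂ ℝ wedge wedge_add_left (fun c a b => wedge_smul_left (c : ℂ) a b)
      wedge_add_right (fun c a b => wedge_smul_right (c : ℂ) a b))

theorem wedgeCLM_apply {k l : ℕ} (a : E [⋀^Fin k]→L[ℝ] ℂ) (b : E [⋀^Fin l]→L[ℝ] ℂ) :
    wedgeCLM E k l a b = wedge a b := rfl

/-- A linear map into the alternating forms is a sum of tensors of covectors and forms. -/
theorem exists_eq_sum_smulRight {k : ℕ} (A : E →L[ℝ] E [⋀^Fin k]→L[ℝ] ℂ) :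
    ∃ (α : Fin (Module.finrank ℝ E) → E →L[ℝ] ℂ)
      (x : Fin (Module.finrank ℝ E) → ExteriorAlgebra ℂ (E →L[ℝ] ℂ)),
      (∀ t, x t ∈ ⋀[ℂ]^k (E →L[ℝ] ℂ)) ∧ A = ∑ t, (α t).smulRight (toForm k (x t)) := by
  set b := Module.finBasis ℝ E
  choose x hx hx' using fun t => exists_toForm_eq (A (b t))
  refine ⟨fun t => Complex.ofRealCLM.comp (LinearMap.toContinuousLinearMap (b.coord t)), x, hx, ?_⟩
  ext w v
  conv_lhs => rw [← b.sum_repr w, map_sum]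
  simp [hx']

/-- The covector of differentiation already stands in front, so this half of the Leibniz rule is
associativity. The cast reconciles k + l + 1 with k + 1 + l. -/
theorem alternatizeUncurryFin_wedge_left {k l : ℕ} (A : E →L[ℝ] E [⋀^Fin k]→L[ℝ] ℂ)
    (b : E [⋀^Fin l]→L[ℝ] ℂ) (v : Fin (k + l + 1) → E) :
    ContinuousAlternatingMap.alternatizeUncurryFin ((wedgeCLM E k l).precompL E A b) v =
      wedge (ContinuousAlternatingMap.alternatizeUncurryFin A) b
        (v ∘ Fin.cast (Nat.add_right_comm k 1 l)) := by
  obtain ⟨α, x, hx, rfl⟩ := exists_eq_sum_smulRight A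
  obtain ⟨y, hy, rfl⟩ := exists_toForm_eq b
  have h1 : (wedgeCLM E k l).precompL E (∑ t, (α t).smulRight (toForm k (x t))) (toForm l y) =
      ∑ t, (α t).smulRight (toForm (k + l) (x t * y)) := by
    ext w u
    simp [wedgeCLM_apply, wedge_smul_left, toForm_mul (hx _) hy]
  rw [h1, ← ContinuousAlternatingMap.alternatizeUncurryFinCLM_apply,
    ← ContinuousAlternatingMap.alternatizeUncurryFinCLM_apply, map_sum, map_sum]
  simp only [ContinuousAlternatingMap.alternatizeUncurryFinCLM_apply,
    alternatizeUncurryFin_smulRight _ (hx _),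
    alternatizeUncurryFin_smulRight _ (mul_mem_exteriorPower (hx _) hy)]
  rw [← map_sum, ← map_sum, ← toForm_mul (Submodule.sum_mem _ fun t _ => ι_mul_mem _ (hx t)) hy,
    toForm_cast, Finset.sum_mul]
  simp only [mul_assoc]

/-- Here the covector of differentiation must cross the factor of degree k, which costs (-1)^k. -/
theorem alternatizeUncurryFin_wedge_right {k l : ℕ} (a : E [⋀^Fin k]→L[ℝ] ℂ)
    (B : E →L[ℝ] E [⋀^Fin l]→L[ℝ] ℂ) :
    ContinuousAlternatingMap.alternatizeUncurryFin ((wedgeCLM E k l).precompR E a B) =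
      (-1 : ℂ) ^ k • wedge a (ContinuousAlternatingMap.alternatizeUncurryFin B) := by
  obtain ⟨β, y, hy, rfl⟩ := exists_eq_sum_smulRight B
  obtain ⟨x, hx, rfl⟩ := exists_toForm_eq a
  have h1 : (wedgeCLM E k l).precompR E (toForm k x) (∑ t, (β t).smulRight (toForm l (y t))) =
      ∑ t, (β t).smulRight (toForm (k + l) (x * y t)) := by
    ext w u
    simp [wedgeCLM_apply, wedge_smul_right, toForm_mul hx (hy _)]
  rw [h1, ← ContinuousAlternatingMap.alternatizeUncurryFinCLM_apply,
    ← ContinuousAlternatingMap.alternatizeUncurryFinCLM_apply, map_sum, map_sum]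
  simp only [ContinuousAlternatingMap.alternatizeUncurryFinCLM_apply,
    alternatizeUncurryFin_smulRight _ (hy _),
    alternatizeUncurryFin_smulRight _ (mul_mem_exteriorPower hx (hy _))]
  rw [← map_sum, ← map_sum, ← toForm_mul hx (Submodule.sum_mem _ fun t _ => ι_mul_mem _ (hy t)),
    ← map_smul, Finset.mul_sum, Finset.smul_sum]
  congr 1
  refine Finset.sum_congr rfl fun t _ => ?_
  rw [← mul_assoc, ← mul_assoc, mul_ι_eq hx, smul_mul_assoc, smul_smul, ← mul_pow]
  simp

theorem extDeriv_wedge {k l : ℕ} {f : E → E [⋀^Fin k]→L[ℝ] ℂ} {g : E → E [⋀^Fin l]→L[ℝ] ℂ} {y : E}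
    (hf : DifferentiableAt ℝ f y) (hg : DifferentiableAt ℝ g y) (v : Fin (k + l + 1) → E) :
    extDeriv (fun z => wedge (f z) (g z)) y v =
      wedge (extDeriv f y) (g y) (v ∘ Fin.cast (Nat.add_right_comm k 1 l)) +
        (-1) ^ k * wedge (f y) (extDeriv g y) v := by
  have h := ((wedgeCLM E k l).hasFDerivAt_of_bilinear hf.hasFDerivAt hg.hasFDerivAt).fderiv
  simp only [wedgeCLM_apply] at h
  rw [extDeriv, h, ContinuousAlternatingMap.alternatizeUncurryFin_add,
    ContinuousAlternatingMap.add_apply, alternatizeUncurryFin_wedge_left,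
    alternatizeUncurryFin_wedge_right, add_comm]
  rfl

end Leibniz

end ComplexSymplectic

end

noncomputable section

namespace ComplexSymplectic

/-! ### Linear Darboux bases and nonvanishing products of covectors -/

section Darboux

theorem add_pow_of_sq_zero {A : Type*} [Ring A] {x y : A} (h : Commute x y) (hx : x * x = 0)
    (m : ℕ) : (x + y) ^ (m + 1) = y ^ (m + 1) + (m + 1) • (x * y ^ m) := by
  induction m with
  | zero => simp [add_comm]
  | succ m ih =>
    have h1 : x * y ^ m * x = 0 := by
      rw [mul_assoc, (h.pow_right m).symm.eq, ← mul_assoc, hx, zero_mul]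
    have h2 : y ^ (m + 1) * x = x * y ^ (m + 1) := (h.pow_right (m + 1)).symm.eq
    rw [pow_succ, ih, add_mul, mul_add, mul_add, h2, ← pow_succ, smul_mul_assoc, smul_mul_assoc,
      h1, mul_assoc, ← pow_succ, smul_zero, zero_add, succ_nsmul _ (m + 1)]
    abel

/-- Applied to x_i = α_i β_i, this gives s^n = n! ∏ α_i β_i. The vanishing of the next power is
carried along because the induction step needs it: in the expansion by `add_pow_of_sq_zero` it kills
the pure power of the remaining sum. -/
theorem sum_pow_of_sq_zero {A : Type*} [Ring A] {n : ℕ} (x : Fin n → A)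
    (hc : ∀ i j, Commute (x i) (x j)) (hx : ∀ i, x i * x i = 0) :
    (∑ i, x i) ^ n = n.factorial • (List.ofFn x).prod ∧ (∑ i, x i) ^ (n + 1) = 0 := by
  induction n with
  | zero => simp
  | succ n ih =>
    obtain ⟨h1, h2⟩ := ih (fun i => x i.succ) (fun i j => hc _ _) (fun i => hx _)
    have hcs : Commute (x 0) (∑ i : Fin n, x i.succ) := Commute.sum_right _ _ _ fun i _ => hc _ _
    rw [Fin.sum_univ_succ, add_pow_of_sq_zero hcs (hx 0), add_pow_of_sq_zero hcs (hx 0), h2, h1,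
      pow_succ, h2, List.ofFn_succ, List.prod_cons, Nat.factorial_succ, mul_smul, mul_smul_comm]
    simp

/-- The precise order of the factors is forgotten: nonvanishing of their product will depend only on
their common kernel, hence on the range of `c`. -/
theorem prod_ι_mul_ι {W : Type*} [AddCommGroup W] [Module ℂ W] {n : ℕ} (a b : Fin n → W) :
    ∃ c : Fin (2 * n) → W, (List.ofFn fun i => ExteriorAlgebra.ι ℂ (a i) *
      ExteriorAlgebra.ι ℂ (b i)).prod = ExteriorAlgebra.ιMulti ℂ (2 * n) c ∧
      (∀ i, a i ∈ Set.range c) ∧ ∀ i, b i ∈ Set.range c := by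
  induction n with
  | zero => exact ⟨fun i => i.elim0, by simp, fun i => i.elim0, fun i => i.elim0⟩
  | succ n ih =>
    obtain ⟨c, hc, hca, hcb⟩ := ih (fun i => a i.succ) (fun i => b i.succ)
    have hr : ∀ w ∈ Set.range c, w ∈ Set.range
        (Fin.cons (a 0) (Fin.cons (b 0) c : Fin (2 * n + 1) → W) : Fin (2 * n + 2) → W) := by
      rintro _ ⟨i, rfl⟩
      exact ⟨i.succ.succ, by simp⟩
    refine ⟨(Fin.cons (a 0) (Fin.cons (b 0) c : Fin (2 * n + 1) → W) : Fin (2 * n + 2) → W),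
      ?_, fun i => ?_, fun i => ?_⟩
    · rw [List.ofFn_succ, List.prod_cons, hc]
      change _ = ExteriorAlgebra.ιMulti ℂ (2 * n + 1 + 1) _
      rw [ExteriorAlgebra.ιMulti_succ_apply, ExteriorAlgebra.ιMulti_succ_apply, mul_assoc]
      rfl
    · refine Fin.cases ⟨0, by simp⟩ (fun i => hr _ (hca i)) i
    · refine Fin.cases ⟨1, ?_⟩ (fun i => hr _ (hcb i)) i
      change (Fin.cons (a 0) (Fin.cons (b 0) c : Fin (2 * n + 1) → W) : Fin (2 * n + 2) → W)
        (Fin.succ 0) = b 0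
      simp

theorem ι_mul_ι_mem {W : Type*} [AddCommGroup W] [Module ℂ W] (a b : W) :
    ExteriorAlgebra.ι ℂ a * ExteriorAlgebra.ι ℂ b ∈ ⋀[ℂ]^2 W := by
  rw [ExteriorAlgebra.exteriorPower, pow_two]
  exact Submodule.mul_mem_mul ⟨a, rfl⟩ ⟨b, rfl⟩

theorem commute_ι_mul_ι {W : Type*} [AddCommGroup W] [Module ℂ W] (a b c d : W) :
    Commute (ExteriorAlgebra.ι ℂ a * ExteriorAlgebra.ι ℂ b)
      (ExteriorAlgebra.ι ℂ c * ExteriorAlgebra.ι ℂ d) := by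
  have h : ∀ w : W, Commute (ExteriorAlgebra.ι ℂ a * ExteriorAlgebra.ι ℂ b)
      (ExteriorAlgebra.ι ℂ w) := fun w => by
    have := mul_ι_eq (ι_mul_ι_mem a b) w
    rwa [neg_one_sq, one_smul] at this
  exact (h c).mul_right (h d)

theorem pow_mem_exteriorPower {W : Type*} [AddCommGroup W] [Module ℂ W]
    {s : ExteriorAlgebra ℂ W} (hs : s ∈ ⋀[ℂ]^2 W) (k : ℕ) : s ^ k ∈ ⋀[ℂ]^(2 * k) W := by
  rw [ExteriorAlgebra.exteriorPower, pow_mul]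
  exact Submodule.pow_mem_pow _ hs k

theorem ι_mul_ι_sq {W : Type*} [AddCommGroup W] [Module ℂ W] (a b : W) :
    ExteriorAlgebra.ι ℂ a * ExteriorAlgebra.ι ℂ b *
      (ExteriorAlgebra.ι ℂ a * ExteriorAlgebra.ι ℂ b) = 0 := by
  have h := eq_neg_of_add_eq_zero_left (ExteriorAlgebra.ι_add_mul_swap (R := ℂ) b a)
  rw [mul_assoc, ← mul_assoc (ExteriorAlgebra.ι ℂ b), h, neg_mul, mul_neg, ← mul_assoc,
    ← mul_assoc, ExteriorAlgebra.ι_sq_zero, zero_mul, zero_mul, neg_zero]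

/-- Symplectic Gram–Schmidt, by induction on a bound `4 * r` for the real rank. If B(v, w) = c ≠ 0,
put a = B(·, w)/c and b = B(v, ·); subtracting a ∧ b from B adds the J-stable span of v and w to the
kernel, so that the real rank drops by at least 4. -/
theorem exists_darboux {V : Type*} [AddCommGroup V] [Module ℝ V] [FiniteDimensional ℝ V]
    {J : V →ₗ[ℝ] V} (r : ℕ) (B : V →ₗ[ℝ] V →ₗ[ℝ] ℂ) (halt : ∀ v, B v v = 0)
    (hJ : ∀ v w, B (J v) w = Complex.I * B v w)
    (hr : Module.finrank ℝ V ≤ Module.finrank ℝ (LinearMap.ker B) + 4 * r) :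
    ∃ a b : Fin r → V →ₗ[ℝ] ℂ, (∀ i v, a i (J v) = Complex.I * a i v) ∧
      (∀ i v, b i (J v) = Complex.I * b i v) ∧
      ∀ v w, B v w = ∑ i, (a i v * b i w - b i v * a i w) := by
  induction r generalizing B with
  | zero =>
    have : LinearMap.ker B = ⊤ := Submodule.eq_top_of_finrank_eq
      (le_antisymm (Submodule.finrank_le _) (by simpa using hr))
    rw [LinearMap.ker_eq_top] at this
    exact ⟨fun i => i.elim0, fun i => i.elim0, fun i => i.elim0, fun i => i.elim0, by simp [this]⟩
  | succ r ih =>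
    by_cases hB : B = 0
    · exact ⟨0, 0, by simp, by simp, by simp [hB]⟩
    have hsw : ∀ v w, B v w = -B w v := by
      intro v w
      have h := halt (v + w)
      simp only [map_add, LinearMap.add_apply, halt, zero_add, add_zero] at h
      linear_combination h
    have hJ' : ∀ v w, B v (J w) = Complex.I * B v w := by
      intro v w
      rw [hsw, hJ, hsw w v]; ring
    obtain ⟨v, w, hvw⟩ : ∃ v w, B v w ≠ 0 := by
      by_contra! h
      exact hB (LinearMap.ext fun v => LinearMap.ext fun w => h v w)
    set c := B v w with hc
    let a : V →ₗ[ℝ] ℂ := c⁻¹ • B.flip w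
    let b : V →ₗ[ℝ] ℂ := B v
    have ha : ∀ x, a x = c⁻¹ * B x w := fun x => rfl
    have hb : ∀ x, b x = B v x := fun x => rfl
    have haJ : ∀ x, a (J x) = Complex.I * a x := fun x => by rw [ha, ha, hJ]; ring
    have hbJ : ∀ x, b (J x) = Complex.I * b x := fun x => by rw [hb, hb, hJ']
    let B' : V →ₗ[ℝ] V →ₗ[ℝ] ℂ := LinearMap.mk₂ ℝ
      (fun x y => B x y - (a x * b y - b x * a y))
      (fun x x' y => by simp only [map_add, LinearMap.add_apply]; ring)
      (fun t x y => by simp only [map_smul, LinearMap.smul_apply, Complex.real_smul]; ring)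
      (fun x y y' => by simp only [map_add]; ring)
      (fun t x y => by simp only [map_smul, Complex.real_smul]; ring)
    have hB' : ∀ x y, B' x y = B x y - (a x * b y - b x * a y) := fun x y => rfl
    have hB'J : ∀ x y, B' (J x) y = Complex.I * B' x y := fun x y => by
      rw [hB', hB', hJ, haJ, hbJ]; ring
    have hvk : ∀ y, B' v y = 0 := fun y => by
      rw [hB', ha, hb, hb, halt, ← hc, inv_mul_cancel₀ hvw]; ring
    have hwk : ∀ y, B' w y = 0 := fun y => by
      rw [hB', ha, hb, ha, hb, halt, ← hc, hsw w y]
      field_simp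
      ring
    -- The map (a, b) sends the new kernel onto ℂ², of real dimension 4, and the old kernel sits
    -- inside its kernel.
    have hdim : Module.finrank ℝ (LinearMap.ker B) + 4 ≤ Module.finrank ℝ (LinearMap.ker B') := by
      let f : LinearMap.ker B' →ₗ[ℝ] ℂ × ℂ := (a.prod b).comp (LinearMap.ker B').subtype
      have hf : LinearMap.range f = ⊤ := by
        rw [LinearMap.range_eq_top]
        rintro ⟨z, z'⟩
        -- The combination z v + (z'/c) w, with i acting as J: a takes the values 1, 0 and b the
        -- values 0, c at v, w.
        refine ⟨⟨z.re • v + z.im • J v + ((z' / c).re • w + (z' / c).im • J w), ?_⟩, ?_⟩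
        · rw [LinearMap.mem_ker]
          refine LinearMap.ext fun y => ?_
          simp only [map_add, map_smul, LinearMap.add_apply, LinearMap.smul_apply, hB'J, hvk, hwk,
            mul_zero, smul_zero, add_zero, LinearMap.zero_apply]
        · have h1 : a v = 1 := by rw [ha, ← hc, inv_mul_cancel₀ hvw]
          have h2 : a w = 0 := by rw [ha, halt, mul_zero]
          have h3 : b v = 0 := halt v
          have h4 : b w = c := rfl
          change (a (z.re • v + z.im • J v + ((z' / c).re • w + (z' / c).im • J w)),
            b (z.re • v + z.im • J v + ((z' / c).re • w + (z' / c).im • J w))) = _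
          simp only [map_add, map_smul, haJ, hbJ, h1, h2, h3, h4, Complex.real_smul]
          have h5 := Complex.re_add_im z
          have h6 := Complex.re_add_im (z' / c)
          have h7 : z' / c * c = z' := div_mul_cancel₀ _ hvw
          ext1
          · change _ = z
            linear_combination h5
          · change _ = z'
            linear_combination c * h6 + h7
      have h1 := LinearMap.finrank_range_add_finrank_ker f
      rw [hf, finrank_top, Module.finrank_prod, Complex.finrank_real_complex] at h1
      have hmem : ∀ x ∈ LinearMap.ker B, a x = 0 ∧ b x = 0 ∧ B' x = 0 := by
        intro x hx
        have hx' : ∀ y, B x y = 0 := fun y => by rw [LinearMap.mem_ker.mp hx]; rfl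
        have h1 : a x = 0 := by rw [ha, hx', mul_zero]
        have h2 : b x = 0 := by rw [hb, hsw, hx', neg_zero]
        exact ⟨h1, h2, LinearMap.ext fun y => by rw [hB', h1, h2, hx']; simp⟩
      let g : LinearMap.ker B →ₗ[ℝ] LinearMap.ker f :=
        (Submodule.inclusion fun x hx => (hmem x hx).2.2 :
          LinearMap.ker B →ₗ[ℝ] LinearMap.ker B').codRestrict _
          fun x => Prod.ext (hmem x x.2).1 (hmem x x.2).2.1
      have hg : Function.Injective g := fun x y h => by
        have h' : (g x : LinearMap.ker B') = g y := congrArg Subtype.val h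
        exact Subtype.ext (congrArg Subtype.val h' :)
      have := LinearMap.finrank_le_finrank_of_injective hg
      omega
    obtain ⟨as, bs, h1, h2, h3⟩ := ih B'
      (fun x => by rw [hB', halt]; ring) hB'J (by omega)
    refine ⟨Fin.cons a as, Fin.cons b bs, fun i => ?_, fun i => ?_, fun x y => ?_⟩
    · exact Fin.cases haJ h1 i
    · exact Fin.cases hbJ h2 i
    · have := h3 x y
      rw [hB'] at this
      rw [Fin.sum_univ_succ]
      simp only [Fin.cons_zero, Fin.cons_succ]
      rw [← this]
      ring

variable {V : Type*} [AddCommGroup V] [Module ℝ V] [TopologicalSpace V]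

theorem toForm_ι_mul_ι (a b : V →L[ℝ] ℂ) :
    toForm 2 (ExteriorAlgebra.ι ℂ a * ExteriorAlgebra.ι ℂ b) = covectorWedge ![a, b] := by
  rw [← toForm_ιMulti]
  congr 1
  simp [ExteriorAlgebra.ιMulti_apply]

variable [FiniteDimensional ℝ V]

/-- The hypothesis says that no nonzero vector x + iy of the complexification is killed by all the
covectors. A singular matrix c_i(e_j) would have a null vector z, and ∑ z_j e_j would be such a
vector. -/
theorem covectorWedge_ne_zero {N : ℕ} (hN : Module.finrank ℝ V = N) (c : Fin N → V →L[ℝ] ℂ)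
    (h : ∀ x y : V, (∀ j, c j x + Complex.I * c j y = 0) → x = 0 ∧ y = 0) :
    covectorWedge c ≠ 0 := by
  set e := (Module.finBasis ℝ V).reindex (finCongr hN)
  intro h0
  have hdet : covectorWedge c e = 0 := by rw [h0]; rfl
  rw [covectorWedge_apply] at hdet
  obtain ⟨z, hz, hz0⟩ := Matrix.exists_mulVec_eq_zero_iff.mpr hdet
  refine hz ?_
  have key := h (∑ j, (z j).re • e j) (∑ j, (z j).im • e j) fun i => by
    have h1 := congrFun hz0 i
    simp only [Matrix.mulVec, dotProduct, Matrix.of_apply, Pi.zero_apply] at h1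
    rw [map_sum, map_sum, Finset.mul_sum, ← Finset.sum_add_distrib, ← h1]
    refine Finset.sum_congr rfl fun j _ => ?_
    rw [map_smul, map_smul, Complex.real_smul, Complex.real_smul]
    conv_rhs => rw [← Complex.re_add_im (z j)]
    ring
  have hre := Fintype.linearIndependent_iff.mp e.linearIndependent _ key.1
  have him := Fintype.linearIndependent_iff.mp e.linearIndependent _ key.2
  exact funext fun j => Complex.ext (hre j) (him j)

end Darboux

end ComplexSymplectic

end

noncomputable section

namespace ComplexSymplectic

/-! ### The pointwise volume element σ^n ∧ σ̄^n -/

section VolumeElement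

variable {V : Type*} [AddCommGroup V] [Module ℝ V] [TopologicalSpace V]

theorem apply_J_of_mem_bidegree {J : V →L[ℝ] V} {σ : V [⋀^Fin 2]→L[ℝ] ℂ}
    (hσ : σ ∈ bidegree J 2 2 0) (v w : V) : σ ![J v, w] = Complex.I * σ ![v, w] := by
  induction hσ using Submodule.span_induction with
  | mem σ hσ =>
    obtain ⟨α, S, hS, -, hα, -, rfl⟩ := hσ
    have hu : S = Finset.univ := by
      apply Finset.eq_univ_of_card
      rw [Fintype.card_fin]
      exact_mod_cast hS
    have h : ∀ i v, α i (J v) = Complex.I * α i v := fun i => hα i (by simp [hu])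
    rw [covectorWedge_apply, covectorWedge_apply, Matrix.det_fin_two, Matrix.det_fin_two]
    simp [h]
    ring
  | zero => simp
  | add a b _ _ ha hb =>
    rw [ContinuousAlternatingMap.add_apply, ha, hb, ContinuousAlternatingMap.add_apply, mul_add]
  | smul c a _ ha =>
    rw [ContinuousAlternatingMap.smul_apply, ha, ContinuousAlternatingMap.smul_apply, smul_eq_mul,
      smul_eq_mul, mul_left_comm]

/-- A `2`-form, as a bilinear form. -/
def toBilin (σ : V [⋀^Fin 2]→L[ℝ] ℂ) : V →ₗ[ℝ] V →ₗ[ℝ] ℂ :=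
  have h2 : ∀ v w, σ ![v, w] = -σ ![w, v] := fun v w => by
    have := σ.toAlternatingMap.map_swap ![v, w] (i := 0) (j := 1) (by simp)
    rw [show ![v, w] ∘ Equiv.swap 0 1 = ![w, v] by ext i; fin_cases i <;> rfl] at this
    exact neg_eq_iff_eq_neg.mp this.symm
  have h1 : ∀ v v' w, σ ![v + v', w] = σ ![v, w] + σ ![v', w] := fun v v' w =>
    σ.toAlternatingMap.map_vecCons_add ![w] v v'
  have h1' : ∀ (t : ℝ) v w, σ ![t • v, w] = t • σ ![v, w] := fun t v w =>
    σ.toAlternatingMap.map_vecCons_smul ![w] t v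
  LinearMap.mk₂ ℝ (fun v w => σ ![v, w]) h1 h1'
    (fun v w w' => by rw [h2, h1, h2 w, h2 w']; ring)
    (fun t v w => by rw [h2, h1', h2 w, smul_neg, neg_neg])

variable [IsTopologicalAddGroup V] [FiniteDimensional ℝ V] [T2Space V] [ContinuousSMul ℝ V]

/-- Darboux gives s = ∑ α_i β_i, and s' is its conjugate; s^n s'^n is (n!)² times a product of 4n
covectors. If x + iy is killed by them all, J-linearity and nondegeneracy force x = y = 0. The
representatives `s` and `s'` are returned along with the conclusion so that every σ^k ∧ σ̄^m can be
computed in the same ring. -/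
theorem exists_volume_element {J : V →L[ℝ] V} (hJ : ∀ v, J (J v) = -v) {n : ℕ}
    (hn : Module.finrank ℝ V = 4 * n) {σ : V [⋀^Fin 2]→L[ℝ] ℂ} (hσ : σ ∈ bidegree J 2 2 0)
    (hnd : ∀ v, (∀ w, σ ![v, w] = 0) → v = 0) :
    ∃ s ∈ ⋀[ℂ]^2 (V →L[ℝ] ℂ), ∃ s' ∈ ⋀[ℂ]^2 (V →L[ℝ] ℂ), toForm 2 s = σ ∧
      toForm 2 s' = conjForm σ ∧ Commute s s' ∧ toForm (2 * n + 2 * n) (s ^ n * s' ^ n) ≠ 0 := by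
  obtain ⟨a, b, haJ, hbJ, hab⟩ := exists_darboux (J := J.toLinearMap) n (toBilin σ)
    (fun v => σ.map_eq_zero_of_eq ![v, v] (i := 0) (j := 1) rfl (by simp))
    (fun v w => apply_J_of_mem_bidegree hσ v w) (by omega)
  set α : Fin n → V →L[ℝ] ℂ := fun i => LinearMap.toContinuousLinearMap (a i)
  set β : Fin n → V →L[ℝ] ℂ := fun i => LinearMap.toContinuousLinearMap (b i)
  let cj : (V →L[ℝ] ℂ) → (V →L[ℝ] ℂ) := fun γ => (Complex.conjCLE : ℂ →L[ℝ] ℂ).comp γ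
  have hsum : σ = ∑ i, covectorWedge ![α i, β i] := by
    ext v
    rw [show v = ![v 0, v 1] by ext i; fin_cases i <;> rfl]
    rw [ContinuousAlternatingMap.sum_apply]
    refine (hab (v 0) (v 1)).trans (Finset.sum_congr rfl fun i _ => ?_)
    rw [covectorWedge_apply, Matrix.det_fin_two]
    simp [α, β]
    ring
  have hsum' : conjForm σ = ∑ i, covectorWedge ![cj (α i), cj (β i)] := by
    ext v
    rw [hsum, conjForm_apply, ContinuousAlternatingMap.sum_apply,
      ContinuousAlternatingMap.sum_apply, map_sum]
    refine Finset.sum_congr rfl fun i _ => ?_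
    rw [← conjForm_apply, conjForm_covectorWedge]
    congr 2
    ext j
    fin_cases j <;> rfl
  obtain ⟨c, hc, hca, hcb⟩ := prod_ι_mul_ι α β
  obtain ⟨c', hc', hca', hcb'⟩ := prod_ι_mul_ι (fun i => cj (α i)) (fun i => cj (β i))
  refine ⟨∑ i, ExteriorAlgebra.ι ℂ (α i) * ExteriorAlgebra.ι ℂ (β i),
    Submodule.sum_mem _ fun i _ => ι_mul_ι_mem _ _,
    ∑ i, ExteriorAlgebra.ι ℂ (cj (α i)) * ExteriorAlgebra.ι ℂ (cj (β i)),
    Submodule.sum_mem _ fun i _ => ι_mul_ι_mem _ _, ?_, ?_, ?_, ?_⟩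
  · rw [map_sum, hsum]
    simp only [toForm_ι_mul_ι]
  · rw [map_sum, hsum']
    simp only [toForm_ι_mul_ι]
  · exact Commute.sum_left _ _ _ fun i _ => Commute.sum_right _ _ _ fun j _ =>
      commute_ι_mul_ι _ _ _ _
  · rw [(sum_pow_of_sq_zero _ (fun i j => commute_ι_mul_ι _ _ _ _) fun i => ι_mul_ι_sq _ _).1,
      (sum_pow_of_sq_zero _ (fun i j => commute_ι_mul_ι _ _ _ _) fun i => ι_mul_ι_sq _ _).1,
      hc, hc', smul_mul_smul_comm, ExteriorAlgebra.ιMulti_mul_ιMulti,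
      ← Nat.cast_smul_eq_nsmul ℂ, map_smul, toForm_ιMulti]
    have hf : ((n.factorial * n.factorial : ℕ) : ℂ) ≠ 0 :=
      Nat.cast_ne_zero.mpr (mul_ne_zero n.factorial_ne_zero n.factorial_ne_zero)
    intro h0
    have h0' : covectorWedge (Fin.append c c') = 0 := by
      ext v
      exact (mul_eq_zero.mp (congrArg (fun f => f v) h0)).resolve_left hf
    revert h0'
    refine covectorWedge_ne_zero (by omega) _ fun x y h => ?_
    have hl : ∀ γ ∈ Set.range c, γ x + Complex.I * γ y = 0 := by
      rintro _ ⟨j, rfl⟩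
      have := h (Fin.castAdd _ j)
      rwa [Fin.append_left] at this
    have hr : ∀ γ ∈ Set.range c', γ x + Complex.I * γ y = 0 := by
      rintro _ ⟨j, rfl⟩
      have := h (Fin.natAdd _ j)
      rwa [Fin.append_right] at this
    -- Conjugating the vanishing of the conjugate of γ on x + iy gives the vanishing of γ on x - iy.
    have hr' : ∀ γ, cj γ ∈ Set.range c' → γ x - Complex.I * γ y = 0 := by
      intro γ hγ
      have h1 := congrArg (starRingEnd ℂ) (hr _ hγ)
      have h2 : ∀ z, (starRingEnd ℂ) (cj γ z) = γ z := fun z => Complex.conj_conj _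
      rw [map_add, map_mul, h2, h2, Complex.conj_I, map_zero] at h1
      linear_combination h1
    have hα : ∀ i v, α i (J v) = Complex.I * α i v := haJ
    have hβ : ∀ i v, β i (J v) = Complex.I * β i v := hbJ
    have hab' : ∀ v w, σ ![v, w] = ∑ i, (α i v * β i w - β i v * α i w) := hab
    have hz : ∀ v, (∀ i, α i v = 0) → (∀ i, β i v = 0) → v = 0 := fun v h1 h2 =>
      hnd v fun w => by simp [hab', h1, h2]
    -- As γ(Jy) = iγ(y), vanishing on x ± iy is vanishing on the real vectors x ± Jy, and σ is
    -- nondegenerate on those.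
    have h1 : x + J y = 0 := hz _
      (fun i => by rw [map_add, hα, hl _ (hca i)]) (fun i => by rw [map_add, hβ, hl _ (hcb i)])
    have h2 : x - J y = 0 := hz _ (fun i => by rw [map_sub, hα, hr' _ (hca' i)])
      (fun i => by rw [map_sub, hβ, hr' _ (hcb' i)])
    have hx : x = 0 := by
      have : (2 : ℝ) • x = 0 := by
        rw [two_smul]
        calc x + x = (x + J y) + (x - J y) := by abel
          _ = 0 := by rw [h1, h2, add_zero]
      exact (smul_eq_zero.mp this).resolve_left two_ne_zero
    refine ⟨hx, ?_⟩
    rw [hx, zero_add] at h1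
    rw [← neg_neg y, ← hJ y, h1, map_zero, neg_zero]

/-- Decompose `a` into types: every component other than (p, q) gives a top-degree product of
unbalanced type, which vanishes. -/
theorem wedge_bidegreeProj {J : V →L[ℝ] V} (hJ : ∀ v, J (J v) = -v) {k l : ℕ} {p q p' q' : ℤ}
    (hN : Module.finrank ℝ V = k + l) (hp : 0 ≤ p) (hq : 0 ≤ q) (hpq : p + q = k)
    (h : p + p' = q + q') (a : V [⋀^Fin k]→L[ℝ] ℂ) {b : V [⋀^Fin l]→L[ℝ] ℂ}
    (hb : b ∈ bidegree J l p' q') : wedge (bidegreeProj J k p q a) b = wedge a b := by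
  lift p to ℕ using hp
  conv_rhs => rw [← sum_bidegreeProj hJ a, ← wedgeBilin_apply, map_sum, LinearMap.sum_apply]
  rw [Finset.sum_eq_single p, wedgeBilin_apply, show (k : ℤ) - p = q by omega]
  · intro p₁ _ hne
    rw [wedgeBilin_apply]
    exact eq_zero_of_mem_bidegree_top hN (by omega)
      (wedge_mem_bidegree hJ (bidegreeProj_mem hJ p₁ (k - p₁) a) hb)
  · intro hp
    simp only [Finset.mem_range] at hp
    omega

end VolumeElement

end ComplexSymplectic

end

noncomputable section

namespace ComplexSymplectic

/-! ### Wedge, conjugation, d and types for forms on the manifold -/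

section FormAlgebra

variable {E : Type*} [NormedAddCommGroup E] [NormedSpace ℝ E]
variable {M : Type*} [TopologicalSpace M] [ChartedSpace E M]

theorem Form.differentiableAt {k : ℕ} (η : Form E M k) (c : M) {y : E}
    (hy : y ∈ (extChartAt 𝓘(ℝ, E) c).target) :
    DifferentiableAt ℝ (formInChart η.toFun c) y :=
  ((η.smooth c).contDiffAt ((isOpen_extChartAt_target c).mem_nhds hy)).differentiableAt (by simp)

theorem continuousOn_formInChart_apply {N : ℕ} (τ : Form E M N) (c : M) (v : Fin N → E) :
    ContinuousOn (fun y => formInChart τ.toFun c y v) (extChartAt 𝓘(ℝ, E) c).target :=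
  ((ContinuousAlternatingMap.apply ℝ E ℂ v).contDiff.comp_contDiffOn (τ.smooth c)).continuousOn

theorem ComplexStructure.one_mem_bidegreeForms [IsManifold 𝓘(ℝ, E) ∞ M] (S : ComplexStructure E M) :
    Form.one E M ∈ S.bidegreeForms 0 0 0 := fun x => by
  refine Submodule.subset_span ⟨fun i => i.elim0, ∅, rfl, rfl, by simp, fun i => i.elim0, ?_⟩
  ext v
  rw [covectorWedge_apply, Matrix.det_isEmpty]
  rfl

theorem formInChart_comp_chartDeriv [IsManifold 𝓘(ℝ, E) ∞ M] {k : ℕ}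
    (η : ∀ x : M, TangentSpace 𝓘(ℝ, E) x [⋀^Fin k]→L[ℝ] ℂ) (c : M) {x : M}
    (hx : x ∈ (extChartAt 𝓘(ℝ, E) c).source) :
    (formInChart η c (extChartAt 𝓘(ℝ, E) c x)).compContinuousLinearMap (chartDeriv E c x) = η x := by
  obtain ⟨z, hz, rfl⟩ : ∃ z ∈ (extChartAt 𝓘(ℝ, E) c).target, (extChartAt 𝓘(ℝ, E) c).symm z = x :=
    ⟨_, (extChartAt 𝓘(ℝ, E) c).map_source hx, (extChartAt 𝓘(ℝ, E) c).left_inv hx⟩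
  rw [(extChartAt 𝓘(ℝ, E) c).right_inv hz]
  have hid : ∀ w, chartSymmDeriv E c z (chartDeriv E c ((extChartAt 𝓘(ℝ, E) c).symm z) w) = w :=
    fun w => congrArg (fun L => L w) (chartSymmDeriv_comp_chartDeriv c hz)
  ext v
  exact congrArg (η ((extChartAt 𝓘(ℝ, E) c).symm z)) (funext fun i => hid (v i))

theorem d_one [IsManifold 𝓘(ℝ, E) ∞ M] : d E M 0 (Form.one E M) = 0 := by
  refine Form.ext (funext fun x => ?_)
  have h : extDeriv (formInChart (Form.one E M).toFun x) (extChartAt 𝓘(ℝ, E) x x) = 0 := by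
    have h1 : formInChart (Form.one E M).toFun x =
        fun _ => ContinuousAlternatingMap.constOfIsEmpty ℝ E (Fin 0) (1 : ℂ) := rfl
    rw [h1, extDeriv_constOfIsEmpty]
    ext v
    simp
  exact congrArg (fun a => a.compContinuousLinearMap (chartDeriv E x x)) h

variable [FiniteDimensional ℝ E]

instance (x : M) : FiniteDimensional ℝ (TangentSpace 𝓘(ℝ, E) x) :=
  inferInstanceAs (FiniteDimensional ℝ E)

instance (x : M) : T2Space (TangentSpace 𝓘(ℝ, E) x) := inferInstanceAs (T2Space E)

theorem extDeriv_conjForm {k : ℕ} {f : E → E [⋀^Fin k]→L[ℝ] ℂ} {y : E}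
    (hf : DifferentiableAt ℝ f y) :
    extDeriv (fun z => conjForm (f z)) y = conjForm (extDeriv f y) := by
  have := finiteDimensional_forms (E := E) k
  let L : (E [⋀^Fin k]→L[ℝ] ℂ) →L[ℝ] (E [⋀^Fin k]→L[ℝ] ℂ) := LinearMap.toContinuousLinearMap
    { toFun := conjForm
      map_add' := conjForm_add
      map_smul' := fun c a => by
        ext v
        simp [conjForm_apply] }
  have h : fderiv ℝ (fun z => conjForm (f z)) y = L.comp (fderiv ℝ f y) :=
    (L.hasFDerivAt.comp y hf.hasFDerivAt).fderiv
  ext v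
  rw [extDeriv, extDeriv, h, conjForm_apply, ContinuousAlternatingMap.alternatizeUncurryFin_apply,
    ContinuousAlternatingMap.alternatizeUncurryFin_apply, map_sum]
  refine Finset.sum_congr rfl fun i _ => ?_
  rw [map_zsmul]
  rfl

theorem Form.wedge_zero {k l : ℕ} (η : Form E M k) : η.wedge (0 : Form E M l) = 0 :=
  Form.ext (funext fun x => map_zero (wedgeBilin E k l (η.toFun x)))

theorem Form.zero_wedge {k l : ℕ} (η : Form E M l) : (0 : Form E M k).wedge η = 0 :=
  Form.ext (funext fun x => LinearMap.map_zero₂ (wedgeBilin E k l) (η.toFun x))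

theorem formInChart_wedge {k l : ℕ} (η : Form E M k) (ζ : Form E M l) (c : M) :
    formInChart (η.wedge ζ).toFun c =
      fun y => wedge (formInChart η.toFun c y) (formInChart ζ.toFun c y) :=
  funext fun _ => wedge_compContinuousLinearMap _ _ _

theorem conjForm_conjForm {V : Type*} [AddCommGroup V] [Module ℝ V] [TopologicalSpace V] {k : ℕ}
    (a : V [⋀^Fin k]→L[ℝ] ℂ) : conjForm (conjForm a) = a := by
  ext v
  simp [conjForm_apply]

theorem Form.conj_conj {k : ℕ} (η : Form E M k) : η.conj.conj = η :=
  Form.ext (funext fun _ => conjForm_conjForm _)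

theorem Form.conj_wedge {k l : ℕ} (η : Form E M k) (ζ : Form E M l) :
    (η.wedge ζ).conj = η.conj.wedge ζ.conj :=
  Form.ext (funext fun _ => conjForm_wedge _ _)

theorem Form.conj_one : (Form.one E M).conj = Form.one E M :=
  Form.ext (funext fun x => by
    ext v
    exact map_one (starRingEnd ℂ))

theorem Form.conj_pow (η : Form E M 2) (k : ℕ) : (η.pow k).conj = η.conj.pow k := by
  induction k with
  | zero => exact Form.conj_one
  | succ k ih =>
    change ((η.pow k).wedge η).conj = (η.conj.pow k).wedge η.conj
    rw [Form.conj_wedge, ih]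

theorem Form.conj_powWedgeConjPow (η : Form E M 2) (k m : ℕ) :
    (η.powWedgeConjPow k m).conj = η.conj.powWedgeConjPow k m := by
  rw [powWedgeConjPow, powWedgeConjPow, Form.conj_wedge, Form.conj_pow, Form.conj_pow]

/-- At a fixed point the iterated wedge becomes a power in the exterior algebra of `E →L[ℝ] ℂ`, the
tangent space being `E` by definition. -/
theorem Form.pow_toFun (η : Form E M 2) (x : M) {s : ExteriorAlgebra ℂ (E →L[ℝ] ℂ)}
    (hs : s ∈ ⋀[ℂ]^2 (E →L[ℝ] ℂ)) (h : toForm 2 s = η.toFun x) (k : ℕ) :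
    (η.pow k).toFun x = toForm (2 * k) (s ^ k) := by
  induction k with
  | zero => exact (pow_zero s ▸ toForm_one).symm
  | succ k ih =>
    change ComplexSymplectic.wedge ((η.pow k).toFun x) (η.toFun x) = toForm (2 * k + 2) (s ^ (k + 1))
    rw [ih, ← h, pow_succ, toForm_mul (pow_mem_exteriorPower hs k) hs]
    rfl

theorem Form.powWedgeConjPow_toFun (η : Form E M 2) (x : M)
    {s s' : ExteriorAlgebra ℂ (E →L[ℝ] ℂ)}
    (hs : s ∈ ⋀[ℂ]^2 (E →L[ℝ] ℂ)) (h : toForm 2 s = η.toFun x)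
    (hs' : s' ∈ ⋀[ℂ]^2 (E →L[ℝ] ℂ)) (h' : toForm 2 s' = η.conj.toFun x) (k m : ℕ) :
    (η.powWedgeConjPow k m).toFun x = toForm (2 * k + 2 * m) (s ^ k * s' ^ m) := by
  change ComplexSymplectic.wedge ((η.pow k).toFun x) ((η.conj.pow m).toFun x) = _
  rw [η.pow_toFun x hs h, η.conj.pow_toFun x hs' h',
    toForm_mul (pow_mem_exteriorPower hs k) (pow_mem_exteriorPower hs' m)]
  rfl

/-- Regrouping needs only that the elements `s` and `s'` commute, being of even degree. -/
theorem Form.wedge_powWedgeConjPow_toFun (η : Form E M 2) (x : M)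
    {s s' : ExteriorAlgebra ℂ (E →L[ℝ] ℂ)}
    (hs : s ∈ ⋀[ℂ]^2 (E →L[ℝ] ℂ)) (h : toForm 2 s = η.toFun x)
    (hs' : s' ∈ ⋀[ℂ]^2 (E →L[ℝ] ℂ)) (h' : toForm 2 s' = η.conj.toFun x) (hc : Commute s s')
    (k m k' m' : ℕ) :
    ((η.powWedgeConjPow k m).wedge (η.powWedgeConjPow k' m')).toFun x =
      toForm (2 * k + 2 * m + (2 * k' + 2 * m')) (s ^ (k + k') * s' ^ (m + m')) := by
  change ComplexSymplectic.wedge ((η.powWedgeConjPow k m).toFun x)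
    ((η.powWedgeConjPow k' m').toFun x) = _
  rw [η.powWedgeConjPow_toFun x hs h hs' h', η.powWedgeConjPow_toFun x hs h hs' h']
  have e : s ^ (k + k') * s' ^ (m + m') = s ^ k * s' ^ m * (s ^ k' * s' ^ m') := by
    rw [pow_add, pow_add, mul_assoc, mul_assoc, ← mul_assoc (s ^ k'),
      ((hc.pow_left k').pow_right m).eq, mul_assoc]
  rw [e, toForm_mul
    (mul_mem_exteriorPower (pow_mem_exteriorPower hs k) (pow_mem_exteriorPower hs' m))
    (mul_mem_exteriorPower (pow_mem_exteriorPower hs k') (pow_mem_exteriorPower hs' m'))]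
  rfl

variable [IsManifold 𝓘(ℝ, E) ∞ M]

/-- The Leibniz rule. -/
theorem d_wedge_toFun {k l : ℕ} (η : Form E M k) (ζ : Form E M l) (x : M)
    (v : Fin (k + l + 1) → TangentSpace 𝓘(ℝ, E) x) :
    (d E M (k + l) (η.wedge ζ)).toFun x v =
      ((d E M k η).wedge ζ).toFun x (v ∘ Fin.cast (Nat.add_right_comm k 1 l)) +
        (-1) ^ k * (η.wedge (d E M l ζ)).toFun x v := by
  have hx := mem_extChartAt_target (I := 𝓘(ℝ, E)) x
  have hζ := formInChart_comp_chartDeriv ζ.toFun x (mem_extChartAt_source (I := 𝓘(ℝ, E)) x)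
  have hη := formInChart_comp_chartDeriv η.toFun x (mem_extChartAt_source (I := 𝓘(ℝ, E)) x)
  change extDeriv (formInChart (η.wedge ζ).toFun x) (extChartAt 𝓘(ℝ, E) x x)
    (fun i => chartDeriv E x x (v i)) = _
  rw [formInChart_wedge, extDeriv_wedge (η.differentiableAt x hx) (ζ.differentiableAt x hx)]
  -- Each term is the pullback by the chart derivative at x of the corresponding term on the model
  -- space, so the rule there can be transported.
  have h1 : ((d E M k η).wedge ζ).toFun x = (wedge (extDeriv (formInChart η.toFun x)
      (extChartAt 𝓘(ℝ, E) x x)) (formInChart ζ.toFun x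
        (extChartAt 𝓘(ℝ, E) x x))).compContinuousLinearMap (chartDeriv E x x) := by
    rw [wedge_compContinuousLinearMap, hζ]
    rfl
  have h2 : (η.wedge (d E M l ζ)).toFun x = (wedge (formInChart η.toFun x
      (extChartAt 𝓘(ℝ, E) x x)) (extDeriv (formInChart ζ.toFun x)
        (extChartAt 𝓘(ℝ, E) x x))).compContinuousLinearMap (chartDeriv E x x) := by
    rw [wedge_compContinuousLinearMap, hη]
    rfl
  rw [h1, h2]
  rfl

theorem d_conj {k : ℕ} (η : Form E M k) : d E M k η.conj = (d E M k η).conj := by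
  refine Form.ext (funext fun x => ?_)
  exact congrArg (fun a => a.compContinuousLinearMap (chartDeriv E x x))
    (extDeriv_conjForm (η.differentiableAt x (mem_extChartAt_target (I := 𝓘(ℝ, E)) x)))

theorem d_wedge_eq_zero {k l : ℕ} {η : Form E M k} {ζ : Form E M l} (hη : d E M k η = 0)
    (hζ : d E M l ζ = 0) : d E M (k + l) (η.wedge ζ) = 0 := by
  refine Form.ext (funext fun x => ?_)
  ext v
  rw [d_wedge_toFun, hη, hζ, Form.zero_wedge, Form.wedge_zero]
  simp [Form.zero_apply]

theorem d_pow_eq_zero {η : Form E M 2} (hη : d E M 2 η = 0) (k : ℕ) :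
    d E M (2 * k) (η.pow k) = 0 := by
  induction k with
  | zero => exact d_one
  | succ k ih => exact d_wedge_eq_zero ih hη

theorem d_powWedgeConjPow_eq_zero {η : Form E M 2} (hη : d E M 2 η = 0) (k m : ℕ) :
    d E M (2 * k + 2 * m) (η.powWedgeConjPow k m) = 0 := by
  refine d_wedge_eq_zero (d_pow_eq_zero hη k) (d_pow_eq_zero ?_ m)
  rw [d_conj, hη]
  exact Form.ext (funext fun x => by ext v; exact map_zero (starRingEnd ℂ))

namespace ComplexStructure

variable (S : ComplexStructure E M)

theorem wedge_mem_bidegreeForms {k l : ℕ} {p q p' q' : ℤ} {η : Form E M k} {ζ : Form E M l}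
    (hη : η ∈ S.bidegreeForms k p q) (hζ : ζ ∈ S.bidegreeForms l p' q') :
    η.wedge ζ ∈ S.bidegreeForms (k + l) (p + p') (q + q') := fun x =>
  wedge_mem_bidegree (V := TangentSpace 𝓘(ℝ, E) x) (S.sq_eq_neg x) (hη x) (hζ x)

theorem conj_mem_bidegreeForms {k : ℕ} {p q : ℤ} {η : Form E M k}
    (hη : η ∈ S.bidegreeForms k p q) : η.conj ∈ S.bidegreeForms k q p := fun x =>
  conjForm_mem_bidegree (V := TangentSpace 𝓘(ℝ, E) x) (S.sq_eq_neg x) (hη x)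

theorem proj_mem_bidegreeForms {k : ℕ} (p q : ℤ) (η : Form E M k) :
    S.proj k p q η ∈ S.bidegreeForms k p q := fun x =>
  bidegreeProj_mem (V := TangentSpace 𝓘(ℝ, E) x) (S.sq_eq_neg x) p q (η.toFun x)

theorem pow_mem_bidegreeForms {η : Form E M 2} (p q : ℤ) (hη : η ∈ S.bidegreeForms 2 p q) (k : ℕ) :
    η.pow k ∈ S.bidegreeForms (2 * k) (k * p) (k * q) := by
  induction k with
  | zero =>
    rw [Nat.cast_zero, zero_mul, zero_mul]
    exact S.one_mem_bidegreeForms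
  | succ k ih =>
    have := S.wedge_mem_bidegreeForms ih hη
    push_cast
    rw [add_one_mul, add_one_mul]
    exact this

theorem powWedgeConjPow_mem_bidegreeForms {η : Form E M 2} (hη : η ∈ S.bidegreeForms 2 2 0)
    (k m : ℕ) : η.powWedgeConjPow k m ∈ S.bidegreeForms (2 * k + 2 * m) (2 * k : ℕ) (2 * m : ℕ) := by
  have := S.wedge_mem_bidegreeForms (S.pow_mem_bidegreeForms _ _ hη k)
    (S.pow_mem_bidegreeForms _ _ (S.conj_mem_bidegreeForms hη) m)
  rw [mul_zero, mul_zero, add_zero, zero_add] at this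
  rw [Nat.cast_mul, Nat.cast_mul, Nat.cast_ofNat, mul_comm (2 : ℤ), mul_comm (2 : ℤ)]
  exact this

theorem del_of_mem_bidegreeForms {k : ℕ} {p q : ℤ} {η : Form E M k}
    (h : η ∈ S.bidegreeForms k p q) : S.del k η = S.proj (k + 1) (p + 1) q (d E M k η) := by
  by_cases hpq : 0 ≤ p ∧ 0 ≤ q ∧ p + q = k
  · obtain ⟨hp, hq, hk⟩ := hpq
    lift p to ℕ using hp
    lift q to ℕ using hq
    obtain rfl : p + q = k := by exact_mod_cast hk
    exact S.del_of_mem h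
  · have : η = 0 := Form.ext (funext fun x => by
      have := h x
      rwa [bidegree_eq_bot hpq, Submodule.mem_bot] at this)
    rw [this, map_zero, map_zero, map_zero]

theorem delbar_of_mem_bidegreeForms {k : ℕ} {p q : ℤ} {η : Form E M k}
    (h : η ∈ S.bidegreeForms k p q) : S.delbar k η = S.proj (k + 1) p (q + 1) (d E M k η) := by
  by_cases hpq : 0 ≤ p ∧ 0 ≤ q ∧ p + q = k
  · obtain ⟨hp, hq, hk⟩ := hpq
    lift p to ℕ using hp
    lift q to ℕ using hq
    obtain rfl : p + q = k := by exact_mod_cast hk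
    exact S.delbar_of_mem h
  · have : η = 0 := Form.ext (funext fun x => by
      have := h x
      rwa [bidegree_eq_bot hpq, Submodule.mem_bot] at this)
    rw [this, map_zero, map_zero, map_zero]

/-- The components of type `(p,q)` of the exact `k`-forms. -/
def projExact : (k : ℕ) → (p q : ℤ) → Submodule ℂ (Form E M k)
  | 0, _, _ => ⊥
  | k + 1, p, q => LinearMap.range ((S.proj (k + 1) p q).comp (d E M k))

/-- On pure types ∂ and ∂̄ are d followed by a projection, and both images land in the same type (p,
q). A sum of the two is again a component of one exact form because `projExact` is a subspace. -/
theorem aeppliCoboundaries_le_projExact (k : ℕ) (p q : ℤ) :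
    S.aeppliCoboundaries k p q ≤ S.projExact k p q := by
  cases k with
  | zero => exact bot_le
  | succ k =>
    refine sup_le ?_ ?_
    · rintro _ ⟨α, hα, rfl⟩
      rw [S.del_of_mem_bidegreeForms hα, sub_add_cancel]
      exact ⟨α, rfl⟩
    · rintro _ ⟨α, hα, rfl⟩
      rw [S.delbar_of_mem_bidegreeForms hα, sub_add_cancel]
      exact ⟨α, rfl⟩

theorem dolbeaultCoboundaries_le_aeppliCoboundaries (k : ℕ) (p q : ℤ) :
    S.dolbeaultCoboundaries k p q ≤ S.aeppliCoboundaries k p q := by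
  cases k with
  | zero => exact bot_le
  | succ k => exact le_sup_right

theorem delCoboundaries_le_aeppliCoboundaries (k : ℕ) (p q : ℤ) :
    S.delCoboundaries k p q ≤ S.aeppliCoboundaries k p q := by
  cases k with
  | zero => exact bot_le
  | succ k => exact le_sup_left

/-- ∂∂̄α is ∂ of the form ∂̄α, which has type (p - 1, q). -/
theorem bottChernCoboundaries_le_aeppliCoboundaries (k : ℕ) (p q : ℤ) :
    S.bottChernCoboundaries k p q ≤ S.aeppliCoboundaries k p q := by
  match k with
  | 0 => exact bot_le
  | 1 => exact bot_le
  | k + 2 =>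
    refine le_trans ?_ (le_sup_left : _ ≤ S.aeppliCoboundaries (k + 2) p q)
    rintro _ ⟨α, hα, rfl⟩
    refine ⟨S.delbar k α, ?_, rfl⟩
    rw [S.delbar_of_mem_bidegreeForms hα]
    have := S.proj_mem_bidegreeForms (p - 1) (q - 1 + 1) (d E M k α)
    rwa [sub_add_cancel q 1] at this ⊢

theorem mem_projExact_of_mem_deRhamCoboundaries {k : ℕ} {p q : ℤ} {η : Form E M k}
    (hη : η ∈ S.bidegreeForms k p q) (h : η ∈ deRhamCoboundaries E M k) :
    η ∈ S.projExact k p q := by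
  cases k with
  | zero => exact h
  | succ k =>
    obtain ⟨α, rfl⟩ := h
    exact ⟨α, S.proj_of_mem hη⟩

theorem del_eq_zero {k : ℕ} {p q : ℤ} {η : Form E M k}
    (h : η ∈ S.bidegreeForms k p q) (hd : d E M k η = 0) : S.del k η = 0 := by
  rw [S.del_of_mem_bidegreeForms h, hd, map_zero]

theorem delbar_eq_zero {k : ℕ} {p q : ℤ} {η : Form E M k}
    (h : η ∈ S.bidegreeForms k p q) (hd : d E M k η = 0) : S.delbar k η = 0 := by
  rw [S.delbar_of_mem_bidegreeForms h, hd, map_zero]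

/-- As θ is closed, d(γ ∧ θ) = dγ ∧ θ, and the balance p + p' = q + q' lets only the (p,
q)-component of dγ contribute. Thus pairing a component of an exact form with θ yields an exact top
form. -/
theorem proj_d_wedge_toFun {k l : ℕ} {p q p' q' : ℤ} (hN : Module.finrank ℝ E = k + 1 + l)
    (hp : 0 ≤ p) (hq : 0 ≤ q) (hpq : p + q = (k + 1 : ℕ)) (h : p + p' = q + q') (γ : Form E M k)
    {θ : Form E M l} (hθ : θ ∈ S.bidegreeForms l p' q') (hd : d E M l θ = 0) (x : M)
    (v : Fin (k + l + 1) → TangentSpace 𝓘(ℝ, E) x) :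
    (d E M (k + l) (γ.wedge θ)).toFun x v = ((S.proj (k + 1) p q (d E M k γ)).wedge θ).toFun x
      (v ∘ Fin.cast (Nat.add_right_comm k 1 l)) := by
  rw [d_wedge_toFun, hd, Form.wedge_zero, Form.zero_apply]
  have := wedge_bidegreeProj (V := TangentSpace 𝓘(ℝ, E) x) (S.sq_eq_neg x) hN hp hq
    hpq h ((d E M k γ).toFun x) (hθ x)
  refine Eq.trans ?_ (congrArg
    (fun a => a (v ∘ Fin.cast (Nat.add_right_comm k 1 l))) this).symm
  simp
  rfl

end ComplexStructure

end FormAlgebra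

end ComplexSymplectic

end

noncomputable section

namespace ComplexSymplectic

/-! ### Ratios of top-degree forms -/

section TopForms

variable {E : Type*} [NormedAddCommGroup E] [NormedSpace ℝ E] [FiniteDimensional ℝ E]

/-- Any tuple is the image of the basis under a linear map, so its value is a determinant times the
value on the basis. -/
theorem top_form_eq_zero {N : ℕ} (b : Module.Basis (Fin N) ℝ E) {a : E [⋀^Fin N]→L[ℝ] ℂ}
    (h : a b = 0) : a = 0 := by
  ext v
  have := apply_comp_eq_det_mul (Module.finrank_eq_card_basis b |>.trans (Fintype.card_fin N)) a
    (b.constr ℝ v) b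
  rw [h, mul_zero] at this
  rw [← show (b.constr ℝ v) ∘ b = v from funext fun i => b.constr_basis ℝ v i, this]
  rfl

variable {M : Type*} [TopologicalSpace M] [ChartedSpace E M]

/-- The ratio of two top-degree forms. -/
def ratio {N : ℕ} (b : Module.Basis (Fin N) ℝ E) (Ω τ : Form E M N) (x : M) : ℂ :=
  τ.toFun x b / Ω.toFun x b

variable {N : ℕ} {b : Module.Basis (Fin N) ℝ E} {Ω : Form E M N}

theorem top_form_apply_ne_zero (b : Module.Basis (Fin N) ℝ E) (hΩ : ∀ x, Ω.toFun x ≠ 0) (x : M) :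
    Ω.toFun x b ≠ 0 := fun h => hΩ x (top_form_eq_zero b h)

/-- Passing to the chart multiplies both values by the same determinant, so the ratio is independent
of the chart. -/
theorem formInChart_apply_eq_ratio_mul (hΩ : ∀ x, Ω.toFun x ≠ 0) (τ : Form E M N) (c : M) (y : E) :
    formInChart τ.toFun c y b =
      ratio b Ω τ ((extChartAt 𝓘(ℝ, E) c).symm y) * formInChart Ω.toFun c y b := by
  have hN := Module.finrank_eq_card_basis b |>.trans (Fintype.card_fin N)
  let A : E →ₗ[ℝ] E := (chartSymmDeriv E c y).toLinearMap
  have h : ∀ η : Form E M N, formInChart η.toFun c y b =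
      (LinearMap.det A : ℝ) * η.toFun ((extChartAt 𝓘(ℝ, E) c).symm y) b := fun η =>
    apply_comp_eq_det_mul (V := E) hN (η.toFun ((extChartAt 𝓘(ℝ, E) c).symm y)) A b
  rw [h, h, ratio]
  have := top_form_apply_ne_zero b hΩ ((extChartAt 𝓘(ℝ, E) c).symm y)
  field_simp

variable [IsManifold 𝓘(ℝ, E) ∞ M]

theorem formInChart_apply_ne_zero (b : Module.Basis (Fin N) ℝ E) (hΩ : ∀ x, Ω.toFun x ≠ 0) (c : M)
    {y : E} (hy : y ∈ (extChartAt 𝓘(ℝ, E) c).target) : formInChart Ω.toFun c y b ≠ 0 := by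
  intro h
  have h0 := top_form_eq_zero b h
  refine hΩ ((extChartAt 𝓘(ℝ, E) c).symm y) ?_
  rw [← formInChart_comp_chartDeriv Ω.toFun c ((extChartAt 𝓘(ℝ, E) c).map_target hy),
    (extChartAt 𝓘(ℝ, E) c).right_inv hy, h0]
  rfl

end TopForms

/-! ### Stokes on a vector space, and integration against |Ω| -/

section Stokes

open MeasureTheory Set

variable {E : Type*} [NormedAddCommGroup E] [NormedSpace ℝ E] [FiniteDimensional ℝ E]
  [MeasurableSpace E] [BorelSpace E]

/-- Integration by parts against the constant function 1. -/
theorem integral_fderiv_eq_zero (μ : Measure E) [μ.IsAddHaarMeasure] {g : E → ℂ}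
    (hg : ContDiff ℝ 1 g) (hc : HasCompactSupport g) (u : E) : ∫ y, fderiv ℝ g y u ∂μ = 0 := by
  have h1 : Integrable (fun y => fderiv ℝ g y u) μ :=
    ((hg.continuous_fderiv one_ne_zero).clm_apply continuous_const).integrable_of_hasCompactSupport
      (hc.fderiv_apply ℝ u)
  have h := integral_smul_fderiv_eq_neg_fderiv_smul_of_integrable (μ := μ) (f := fun _ => (1 : ℝ))
    (g := g) (v := u) (by simp) (by simpa using h1)
    (by simpa using hg.continuous.integrable_of_hasCompactSupport hc)
    (fun _ _ => differentiableAt_const _) (fun y _ => hg.differentiable one_ne_zero y)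
  simpa using h

/-- Stokes' theorem for compactly supported forms on a vector space. -/
theorem integral_extDeriv_eq_zero (μ : Measure E) [μ.IsAddHaarMeasure] {N : ℕ}
    {f : E → E [⋀^Fin N]→L[ℝ] ℂ} (hf : ContDiff ℝ 1 f) (hc : HasCompactSupport f)
    (v : Fin (N + 1) → E) : ∫ y, extDeriv f y v ∂μ = 0 := by
  have hg : ∀ w, ContDiff ℝ 1 fun y => f y w := fun w =>
    (ContinuousAlternatingMap.apply ℝ E ℂ w).contDiff.comp hf
  have hgc : ∀ w, HasCompactSupport fun y => f y w := fun w =>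
    hc.comp_left (g := fun a : E [⋀^Fin N]→L[ℝ] ℂ => a w) rfl
  have hi : ∀ w u, Integrable (fun y => fderiv ℝ (fun y => f y w) y u) μ := fun w u =>
    (((hg w).continuous_fderiv one_ne_zero).clm_apply
      continuous_const).integrable_of_hasCompactSupport ((hgc w).fderiv_apply ℝ u)
  -- Each summand is, up to sign, a directional derivative of a compactly supported function.
  simp only [extDeriv_apply (hf.differentiable one_ne_zero _)]
  rw [integral_finsetSum _ fun i _ => (hi _ _).fun_smul _]
  refine Finset.sum_eq_zero fun i _ => ?_
  have h0 := integral_fderiv_eq_zero μ (hg (i.removeNth v)) (hgc (i.removeNth v)) (v i)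
  rcases neg_one_pow_eq_or ℤ (i : ℕ) with h | h <;> simp [h, h0, integral_neg]

variable {M : Type*} [TopologicalSpace M] [ChartedSpace E M]

/-- The integral, over the domain of the preferred chart at `c`, of a function with respect to the
measure defined by a top-degree form `Ω`. -/
def chartIntegral {N : ℕ} (b : Module.Basis (Fin N) ℝ E) (Ω : Form E M N) (c : M) (g : M → ℂ) : ℂ :=
  ∫ y in (extChartAt 𝓘(ℝ, E) c).target, ‖formInChart Ω.toFun c y b‖ •
    g ((extChartAt 𝓘(ℝ, E) c).symm y) ∂Measure.addHaar

variable {N : ℕ} {b : Module.Basis (Fin N) ℝ E} {Ω : Form E M N}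

/-- The integrand is continuous on the compact image of K in the chart and vanishes on the rest of
the target. -/
theorem integrableOn_of_support_subset (c : M) {g : M → ℂ} {K : Set M} (hK : IsCompact K)
    (hKc : K ⊆ (extChartAt 𝓘(ℝ, E) c).source) (hg : ∀ x ∉ K, g x = 0)
    (hcont : ContinuousOn (fun y => g ((extChartAt 𝓘(ℝ, E) c).symm y))
      (extChartAt 𝓘(ℝ, E) c).target) :
    IntegrableOn (fun y => ‖formInChart Ω.toFun c y b‖ • g ((extChartAt 𝓘(ℝ, E) c).symm y))
      (extChartAt 𝓘(ℝ, E) c).target Measure.addHaar := by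
  have hK' : IsCompact (extChartAt 𝓘(ℝ, E) c '' K) :=
    hK.image_of_continuousOn ((continuousOn_extChartAt c).mono hKc)
  have hsub : extChartAt 𝓘(ℝ, E) c '' K ⊆ (extChartAt 𝓘(ℝ, E) c).target := by
    rintro _ ⟨x, hx, rfl⟩
    exact (extChartAt 𝓘(ℝ, E) c).map_source (hKc hx)
  have h : ContinuousOn (fun y => ‖formInChart Ω.toFun c y b‖ •
      g ((extChartAt 𝓘(ℝ, E) c).symm y)) (extChartAt 𝓘(ℝ, E) c).target :=
    (continuousOn_formInChart_apply Ω c b).norm.smul hcont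
  refine ((h.mono hsub).integrableOn_compact hK').of_forall_sdiff_eq_zero
    (isOpen_extChartAt_target c).measurableSet fun y hy => ?_
  rw [hg, smul_zero]
  exact fun hyK => hy.2 ⟨_, hyK, (extChartAt 𝓘(ℝ, E) c).right_inv hy.1⟩

variable [IsManifold 𝓘(ℝ, E) ∞ M]

/-- The integral of a function supported in the domains of two charts does not depend on which of
them is used. -/
theorem chartIntegral_eq_of_support (c c' : M) {g : M → ℂ}
    (hc : ∀ x ∉ (extChartAt 𝓘(ℝ, E) c).source, g x = 0)
    (hc' : ∀ x ∉ (extChartAt 𝓘(ℝ, E) c').source, g x = 0) :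
    chartIntegral b Ω c g = chartIntegral b Ω c' g := by
  have hN := Module.finrank_eq_card_basis b |>.trans (Fintype.card_fin N)
  set φ := extChartAt 𝓘(ℝ, E) c with hφ
  set φ' := extChartAt 𝓘(ℝ, E) c' with hφ'
  have hopen : ∀ c c' : M, IsOpen ((extChartAt 𝓘(ℝ, E) c).target ∩
      (extChartAt 𝓘(ℝ, E) c).symm ⁻¹' (extChartAt 𝓘(ℝ, E) c').source) := fun c c' =>
    (continuousOn_extChartAt_symm c).isOpen_inter_preimage (isOpen_extChartAt_target c)
      (isOpen_extChartAt_source c')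
  set s := φ.target ∩ φ.symm ⁻¹' φ'.source with hs
  set s' := φ'.target ∩ φ'.symm ⁻¹' φ.source with hs'
  have h1 : chartIntegral b Ω c g = ∫ y in s, ‖formInChart Ω.toFun c y b‖ • g (φ.symm y)
      ∂Measure.addHaar := by
    refine setIntegral_eq_of_subset_of_forall_sdiff_eq_zero
      (isOpen_extChartAt_target c).measurableSet inter_subset_left fun y hy => ?_
    rw [hc' _ fun h => hy.2 ⟨hy.1, h⟩, smul_zero]
  have h2 : chartIntegral b Ω c' g = ∫ y in s', ‖formInChart Ω.toFun c' y b‖ • g (φ'.symm y)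
      ∂Measure.addHaar := by
    refine setIntegral_eq_of_subset_of_forall_sdiff_eq_zero
      (isOpen_extChartAt_target c').measurableSet inter_subset_left fun y hy => ?_
    rw [hc _ fun h => hy.2 ⟨hy.1, h⟩, smul_zero]
  -- Both integrals live on the overlap; the transition map carries one copy of it onto the other.
  have him : (φ' ∘ φ.symm) '' s = s' := by
    ext z
    constructor
    · rintro ⟨y, ⟨hy, hy'⟩, rfl⟩
      refine ⟨φ'.map_source hy', ?_⟩
      change φ'.symm (φ' (φ.symm y)) ∈ φ.source
      rw [φ'.left_inv hy']
      exact φ.map_target hy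
    · rintro ⟨hz, hz'⟩
      refine ⟨φ (φ'.symm z), ⟨φ.map_source hz', ?_⟩, ?_⟩
      · change φ.symm (φ (φ'.symm z)) ∈ φ'.source
        rw [φ.left_inv hz']
        exact φ'.map_target hz
      · change φ' (φ.symm (φ (φ'.symm z))) = z
        rw [φ.left_inv hz', φ'.right_inv hz]
  have hinj : InjOn (φ' ∘ φ.symm) s := by
    rintro y ⟨hy, hy'⟩ z ⟨hz, hz'⟩ h
    exact φ.symm.injOn hy hz (φ'.injOn hy' hz' h)
  rw [h1, h2, ← him, integral_image_eq_integral_abs_det_fderiv_smul _ (hopen c c').measurableSet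
    (fun y hy => ((contDiffAt_transition c c' hy.1 hy.2).differentiableAt
      (by simp)).hasFDerivAt.hasFDerivWithinAt) hinj]
  refine setIntegral_congr_fun (hopen c c').measurableSet fun y hy => ?_
  change ‖formInChart Ω.toFun c y b‖ • g (φ.symm y) = |_| • ‖_‖ • g (φ'.symm (φ' (φ.symm y)))
  rw [φ'.left_inv hy.2, smul_smul, formInChart_eq Ω.toFun c c' hy.1 hy.2]
  congr 1
  -- The coefficient of Ω changes by the Jacobian determinant, so its norm absorbs exactly the |det|
  -- of the change of variables. No orientation enters.
  have := apply_comp_eq_det_mul hN (formInChart Ω.toFun c' ((φ' ∘ φ.symm) y))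
    (fderiv ℝ (φ' ∘ φ.symm) y).toLinearMap b
  refine (congrArg norm this).trans ?_
  rw [norm_mul, Complex.norm_real, Real.norm_eq_abs]

end Stokes

end ComplexSymplectic

end

noncomputable section

namespace ComplexSymplectic

/-! ### Stokes' theorem in a chart -/

section ExactForms

open MeasureTheory Set

variable {E : Type*} [NormedAddCommGroup E] [NormedSpace ℝ E]

theorem extDeriv_eq_zero_of_eventuallyEq {k : ℕ} {f : E → E [⋀^Fin k]→L[ℝ] ℂ} {y : E}
    (h : f =ᶠ[nhds y] 0) : extDeriv f y = 0 := by
  rw [extDeriv, h.fderiv_eq, fderiv_zero]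
  exact map_zero (ContinuousAlternatingMap.alternatizeUncurryFinCLM ℝ E ℂ)

variable {M : Type*} [TopologicalSpace M] [ChartedSpace E M]

theorem Form.sum_apply {k : ℕ} {ι : Type*} (T : Finset ι) (η : ι → Form E M k) (x : M)
    (v : Fin k → TangentSpace 𝓘(ℝ, E) x) :
    (∑ i ∈ T, η i).toFun x v = ∑ i ∈ T, (η i).toFun x v := by
  classical
  induction T using Finset.induction_on with
  | empty => rfl
  | insert i T hi ih => rw [Finset.sum_insert hi, Finset.sum_insert hi, ← ih]; rfl

theorem chartIntegral_sum [FiniteDimensional ℝ E] [MeasurableSpace E]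
    [BorelSpace E] {N : ℕ} {b : Module.Basis (Fin N) ℝ E} {Ω : Form E M N} {ι : Type*}
    (T : Finset ι) (c : M) {g : ι → M → ℂ}
    (hg : ∀ i ∈ T, IntegrableOn (fun y => ‖formInChart Ω.toFun c y b‖ •
      g i ((extChartAt 𝓘(ℝ, E) c).symm y)) (extChartAt 𝓘(ℝ, E) c).target Measure.addHaar) :
    chartIntegral b Ω c (fun x => ∑ i ∈ T, g i x) = ∑ i ∈ T, chartIntegral b Ω c (g i) := by
  simp only [chartIntegral, Finset.smul_sum]
  exact integral_finsetSum _ hg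

theorem chartIntegral_ofReal [FiniteDimensional ℝ E] [MeasurableSpace E] [BorelSpace E] {N : ℕ}
    {b : Module.Basis (Fin N) ℝ E} {Ω : Form E M N} (c : M) (r : M → ℝ) :
    chartIntegral b Ω c (fun x => (r x : ℂ)) =
      ((∫ y in (extChartAt 𝓘(ℝ, E) c).target, ‖formInChart Ω.toFun c y b‖ *
        r ((extChartAt 𝓘(ℝ, E) c).symm y) ∂Measure.addHaar : ℝ) : ℂ) := by
  rw [← integral_complex_ofReal, chartIntegral]
  congr 1
  ext y
  rw [Complex.real_smul, ← Complex.ofReal_mul]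

theorem re_chartIntegral_nonneg [FiniteDimensional ℝ E] [MeasurableSpace E] [BorelSpace E] {N : ℕ}
    {b : Module.Basis (Fin N) ℝ E} {Ω : Form E M N} (c : M) {r : M → ℝ} (hr0 : ∀ x, 0 ≤ r x) :
    0 ≤ (chartIntegral b Ω c (fun x => (r x : ℂ))).re := by
  rw [chartIntegral_ofReal, Complex.ofReal_re]
  exact integral_nonneg fun y => mul_nonneg (norm_nonneg _) (hr0 _)

variable [IsManifold 𝓘(ℝ, E) ∞ M]

theorem d_toFun_eq_zero {k : ℕ} {η : Form E M k} {x : M} (h : ∀ᶠ z in nhds x, η.toFun z = 0) :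
    (d E M k η).toFun x = 0 := by
  have hev : formInChart η.toFun x =ᶠ[nhds (extChartAt 𝓘(ℝ, E) x x)] 0 := by
    have hc : ContinuousAt (extChartAt 𝓘(ℝ, E) x).symm (extChartAt 𝓘(ℝ, E) x x) :=
      continuousAt_extChartAt_symm x
    have h' : ∀ᶠ z in nhds ((extChartAt 𝓘(ℝ, E) x).symm (extChartAt 𝓘(ℝ, E) x x)),
        η.toFun z = 0 := by
      rwa [extChartAt_to_inv x]
    filter_upwards [hc.eventually h'] with y hy
    change (η.toFun _).compContinuousLinearMap _ = 0
    rw [hy]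
    rfl
  have h0 := extDeriv_eq_zero_of_eventuallyEq hev
  exact congrArg (fun a => a.compContinuousLinearMap (chartDeriv E x x)) h0

variable [FiniteDimensional ℝ E]

/-- The product of a smooth function and a differential form. -/
def Form.smulFun {k : ℕ} (ρ : M → ℝ) (hρ : ContMDiff 𝓘(ℝ, E) 𝓘(ℝ, ℝ) ∞ ρ) (η : Form E M k) :
    Form E M k :=
  ⟨fun x => (ρ x : ℂ) • η.toFun x, fun c => by
    have h : ContDiffOn ℝ ∞ (fun y => ρ ((extChartAt 𝓘(ℝ, E) c).symm y))
        (extChartAt 𝓘(ℝ, E) c).target :=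
      (hρ.comp_contMDiffOn (contMDiffOn_extChartAt_symm c)).contDiffOn
    refine contDiffOn_of_apply fun v => ?_
    exact (Complex.ofRealCLM.contDiff.comp_contDiffOn h).mul
      ((ContinuousAlternatingMap.apply ℝ E ℂ v).contDiff.comp_contDiffOn (η.smooth c))⟩

variable {N : ℕ} {b : Module.Basis (Fin (N + 1)) ℝ E} {Ω : Form E M (N + 1)}

theorem continuousOn_ratio (hΩ : ∀ x, Ω.toFun x ≠ 0) (τ : Form E M (N + 1)) (c : M) :
    ContinuousOn (fun y => ratio b Ω τ ((extChartAt 𝓘(ℝ, E) c).symm y))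
      (extChartAt 𝓘(ℝ, E) c).target := by
  refine ((continuousOn_formInChart_apply τ c b).div (continuousOn_formInChart_apply Ω c b)
    fun y hy => formInChart_apply_ne_zero b hΩ c hy).congr fun y hy => ?_
  exact (div_eq_of_eq_mul (formInChart_apply_ne_zero b hΩ c hy)
    (formInChart_apply_eq_ratio_mul hΩ τ c y)).symm

variable [MeasurableSpace E] [BorelSpace E]

/-- Stokes' theorem for forms supported in the domain of a chart. -/
theorem chartIntegral_ratio_d_eq_zero (hΩ : ∀ x, Ω.toFun x ≠ 0)
    (hreal : ∀ x v, (starRingEnd ℂ) (Ω.toFun x v) = Ω.toFun x v) (c : M) {K : Set M}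
    (hK : IsCompact K) (hKc : K ⊆ (extChartAt 𝓘(ℝ, E) c).source) {γ : Form E M N}
    (hγ : ∀ x ∉ K, γ.toFun x = 0) :
    chartIntegral b Ω c (ratio b Ω (d E M N γ)) = 0 := by
  set φ := extChartAt 𝓘(ℝ, E) c with hφ
  have htgt : IsOpen φ.target := isOpen_extChartAt_target c
  set w : E → ℝ := fun y => (formInChart Ω.toFun c y b).re with hw
  -- Reality of Ω makes its coefficient a nowhere vanishing real function w on the target, so |w| is
  -- w times a locally constant sign.
  have hwΩ : ∀ y, formInChart Ω.toFun c y b = w y := fun y =>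
    (Complex.conj_eq_iff_re.mp (hreal (φ.symm y) fun i => chartSymmDeriv E c y (b i))).symm
  have hw0 : ∀ y ∈ φ.target, w y ≠ 0 := fun y hy h => by
    have := hwΩ y
    rw [h, Complex.ofReal_zero] at this
    exact formInChart_apply_ne_zero b hΩ c hy this
  have hwc : ContinuousOn w φ.target :=
    Complex.continuous_re.comp_continuousOn (continuousOn_formInChart_apply Ω c b)
  set s : E → ℝ := fun y => if 0 < w y then 1 else -1 with hs
  have hsw : ∀ y ∈ φ.target, |w y| = s y * w y := by
    intro y hy
    rcases lt_or_gt_of_ne (hw0 y hy) with h | h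
    · simp [hs, abs_of_neg h, h.le.not_gt]
    · simp [hs, abs_of_pos h, h]
  have hsc : ∀ y ∈ φ.target, ∀ᶠ z in nhds y, s z = s y := by
    intro y hy
    have hcy := hwc.continuousAt (htgt.mem_nhds hy)
    rcases lt_or_gt_of_ne (hw0 y hy) with h | h
    · filter_upwards [hcy.eventually_lt continuousAt_const h] with z hz
      simp [hs, h.le.not_gt, (show w z < 0 from hz).le.not_gt]
    · filter_upwards [continuousAt_const.eventually_lt hcy h] with z hz
      simp [hs, h, show 0 < w z from hz]
  have hK' : IsCompact (φ '' K) :=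
    hK.image_of_continuousOn ((continuousOn_extChartAt c).mono hKc)
  -- The form γ in the chart, multiplied by the sign of Ω and extended by zero. Its differential,
  -- evaluated on b, is the integrand |Ω| · dγ/Ω.
  set f : E → E [⋀^Fin N]→L[ℝ] ℂ :=
    φ.target.indicator fun y => s y • formInChart γ.toFun c y with hf
  have hev : ∀ y ∈ φ.target, f =ᶠ[nhds y] s y • formInChart γ.toFun c := by
    intro y hy
    filter_upwards [htgt.mem_nhds hy, hsc y hy] with z hz hz'
    rw [hf, indicator_of_mem hz, hz']
    rfl
  have hf0 : ∀ y ∉ φ '' K, f y = 0 := by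
    intro y hy
    by_cases hyt : y ∈ φ.target
    · have h0 : formInChart γ.toFun c y = 0 := by
        change (γ.toFun (φ.symm y)).compContinuousLinearMap _ = 0
        rw [hγ _ fun h => hy ⟨_, h, φ.right_inv hyt⟩]
        rfl
      rw [hf, indicator_of_mem hyt, h0]
      exact smul_zero (A := E [⋀^Fin N]→L[ℝ] ℂ) (s y)
    · exact indicator_of_notMem hyt _
  -- Inside the target f is locally ±γ; outside it f vanishes nearby, the image of K being closed
  -- and contained in the target.
  have hfs : ContDiff ℝ 1 f := by
    refine contDiff_iff_contDiffAt.mpr fun y => ?_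
    by_cases hyt : y ∈ φ.target
    · refine ContDiffAt.congr_of_eventuallyEq ?_ (hev y hyt)
      exact (((γ.smooth c).contDiffAt (htgt.mem_nhds hyt)).of_le (by simp)).const_smul (s y)
    · have hyK : y ∉ φ '' K := by
        rintro ⟨x, hx, rfl⟩
        exact hyt (φ.map_source (hKc hx))
      refine ContDiffAt.congr_of_eventuallyEq (contDiffAt_const (c := 0)) ?_
      filter_upwards [hK'.isClosed.isOpen_compl.mem_nhds hyK] with z hz
      exact hf0 z hz
  have hfc : HasCompactSupport f := HasCompactSupport.intro hK' hf0
  have key := integral_extDeriv_eq_zero Measure.addHaar hfs hfc b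
  rw [← setIntegral_eq_integral_of_forall_compl_eq_zero (s := φ.target)] at key
  · rw [chartIntegral, ← key]
    refine setIntegral_congr_fun htgt.measurableSet fun y hy => ?_
    have h1 := formInChart_apply_eq_ratio_mul (b := b) hΩ (d E M N γ) c y
    change ‖_‖ • ratio b Ω (d E M N γ) (φ.symm y) = extDeriv f y b
    rw [(hev y hy).extDeriv_eq, extDeriv_smul, ← formInChart_extDerivField γ c hy,
      ContinuousAlternatingMap.smul_apply]
    change _ = s y • formInChart (d E M N γ).toFun c y b
    rw [h1, hwΩ, Complex.norm_real, Real.norm_eq_abs, hsw y hy, Complex.real_smul,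
      Complex.real_smul]
    push_cast
    ring
  · intro y hy
    have hyK : y ∉ φ '' K := by
      rintro ⟨x, hx, rfl⟩
      exact hy (φ.map_source (hKc hx))
    have h0 : f =ᶠ[nhds y] 0 := by
      filter_upwards [hK'.isClosed.isOpen_compl.mem_nhds hyK] with z hz
      exact hf0 z hz
    rw [extDeriv_eq_zero_of_eventuallyEq h0]
    rfl

end ExactForms

/-! ### Exact real top forms on a compact manifold -/

section Compact

open MeasureTheory Set

variable {E : Type*} [NormedAddCommGroup E] [NormedSpace ℝ E] [FiniteDimensional ℝ E]
variable {M : Type*} [TopologicalSpace M] [ChartedSpace E M] [IsManifold 𝓘(ℝ, E) ∞ M]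

section ChartIntegral

variable {N : ℕ} {b : Module.Basis (Fin (N + 1)) ℝ E} {Ω : Form E M (N + 1)}
  [MeasurableSpace E] [BorelSpace E]

/-- If `r` and `h` are finite families of functions, both with sum `1`, whose members with index `c`
are supported in the domain of the chart at `c`, then the integrals of the members of `r` and of
those of `h` have the same sum. -/
theorem sum_chartIntegral_eq_sum_chartIntegral (T : Finset M) {r h : M → M → ℂ} {K : M → Set M}
    (hK : ∀ c, IsCompact (K c)) (hKc : ∀ c, K c ⊆ (extChartAt 𝓘(ℝ, E) c).source)
    (hr : ∀ c, ∀ x ∉ K c, r c x = 0) (hh : ∀ c, ∀ x ∉ K c, h c x = 0)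
    (hrsum : ∀ x, ∑ c ∈ T, r c x = 1) (hhsum : ∀ x, ∑ c ∈ T, h c x = 1)
    (hrcont : ∀ c c', ContinuousOn (fun y => r c' ((extChartAt 𝓘(ℝ, E) c).symm y))
      (extChartAt 𝓘(ℝ, E) c).target)
    (hhcont : ∀ c c', ContinuousOn (fun y => h c' ((extChartAt 𝓘(ℝ, E) c).symm y))
      (extChartAt 𝓘(ℝ, E) c).target) :
    ∑ c ∈ T, chartIntegral b Ω c (r c) = ∑ c ∈ T, chartIntegral b Ω c (h c) := by
  -- The double sum of the integrals of r_{c'} h_c is evaluated in two orders: summing over c' first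
  -- leaves h_c, summing over c first leaves r_{c'}.
  have h1 : ∀ c, ∑ c' ∈ T, chartIntegral b Ω c (fun x => r c' x * h c x) =
      chartIntegral b Ω c (h c) := by
    intro c
    have e : (fun x => ∑ c' ∈ T, r c' x * h c x) = h c := by
      ext x
      rw [← Finset.sum_mul, hrsum, one_mul]
    rw [← chartIntegral_sum (b := b) (Ω := Ω) T c
      (g := fun c' x => r c' x * h c x) fun c' _ => ?_, e]
    exact integrableOn_of_support_subset (b := b) (Ω := Ω) (g := fun x => r c' x * h c x) c (hK c)
      (hKc c)
      (fun x hx => by rw [hh c x hx, mul_zero]) ((hrcont c c').mul (hhcont c c))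
  have h2 : ∀ c', ∑ c ∈ T, chartIntegral b Ω c (fun x => r c' x * h c x) =
      chartIntegral b Ω c' (r c') := by
    intro c'
    have e : (fun x => ∑ c ∈ T, r c' x * h c x) = r c' := by
      ext x
      rw [← Finset.mul_sum, hhsum, mul_one]
    -- The product is supported in both chart domains, so its integral may be moved from the chart
    -- at c to the one at c'.
    refine (Finset.sum_congr rfl fun c _ => chartIntegral_eq_of_support (b := b) (Ω := Ω) c c'
      (g := fun x => r c' x * h c x) (fun x hx => by rw [hh c x fun hxc => hx (hKc c hxc), mul_zero])
      (fun x hx => by rw [hr c' x fun hxc => hx (hKc c' hxc), zero_mul])).trans ?_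
    rw [← chartIntegral_sum (b := b) (Ω := Ω) T c'
      (g := fun c x => r c' x * h c x) fun c _ => ?_, e]
    exact integrableOn_of_support_subset (b := b) (Ω := Ω) (g := fun x => r c' x * h c x) c' (hK c')
      (hKc c')
      (fun x hx => by rw [hr c' x hx, zero_mul]) ((hrcont c' c').mul (hhcont c' c))
  rw [← Finset.sum_congr rfl fun c _ => h2 c, Finset.sum_comm]
  exact Finset.sum_congr rfl fun c _ => h1 c

/-- The integrand is nonnegative and continuous on the target, and nonzero at the image of x₀; its
support there contains a nonempty open set, which has positive measure. -/
theorem re_chartIntegral_pos (hΩ : ∀ x, Ω.toFun x ≠ 0) (c : M) {r : M → ℝ} (hrc : Continuous r)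
    (hr0 : ∀ x, 0 ≤ r x) {K : Set M} (hK : IsCompact K)
    (hKc : K ⊆ (extChartAt 𝓘(ℝ, E) c).source) (hr : ∀ x ∉ K, r x = 0) {x₀ : M} (hx₀ : r x₀ ≠ 0) :
    0 < (chartIntegral b Ω c (fun x => (r x : ℂ))).re := by
  rw [chartIntegral_ofReal, Complex.ofReal_re]
  have hrcont : ContinuousOn (fun y => r ((extChartAt 𝓘(ℝ, E) c).symm y))
      (extChartAt 𝓘(ℝ, E) c).target :=
    hrc.comp_continuousOn (continuousOn_extChartAt_symm c)
  have hint : IntegrableOn (fun y => ‖formInChart Ω.toFun c y b‖ *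
      r ((extChartAt 𝓘(ℝ, E) c).symm y)) (extChartAt 𝓘(ℝ, E) c).target Measure.addHaar := by
    have := (integrableOn_of_support_subset (b := b) (Ω := Ω) (g := fun x => (r x : ℂ)) c hK
      hKc (fun x hx => by rw [hr x hx, Complex.ofReal_zero])
      (Complex.continuous_ofReal.comp_continuousOn hrcont)).re
    refine this.congr (Filter.Eventually.of_forall fun y => ?_)
    simp
  rw [setIntegral_pos_iff_support_of_nonneg_ae (Filter.Eventually.of_forall fun y =>
    mul_nonneg (norm_nonneg _) (hr0 _)) hint]
  have hucont := (continuousOn_formInChart_apply Ω c b).norm.mul hrcont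
  have hopen := hucont.isOpen_inter_preimage (isOpen_extChartAt_target c)
    (isOpen_compl_singleton (x := (0 : ℝ)))
  rw [inter_comm]
  have hs : x₀ ∈ (extChartAt 𝓘(ℝ, E) c).source := hKc (by_contra fun h => hx₀ (hr x₀ h))
  have ht := (extChartAt 𝓘(ℝ, E) c).map_source hs
  refine hopen.measure_pos _ ⟨extChartAt 𝓘(ℝ, E) c x₀, ht, ?_⟩
  refine mul_ne_zero (norm_ne_zero_iff.mpr (formInChart_apply_ne_zero b hΩ c ht)) ?_
  change r ((extChartAt 𝓘(ℝ, E) c).symm _) ≠ 0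
  rw [(extChartAt 𝓘(ℝ, E) c).left_inv hs]
  exact hx₀

end ChartIntegral

/-- An exact real form of top degree on a compact manifold has a zero. -/
theorem exists_d_toFun_eq_zero {N : ℕ} [CompactSpace M] [T2Space M] [Nonempty M]
    (hN : Module.finrank ℝ E = N + 1) (ζ : Form E M N)
    (hreal : ∀ x v, (starRingEnd ℂ) ((d E M N ζ).toFun x v) = (d E M N ζ).toFun x v) :
    ∃ x, (d E M N ζ).toFun x = 0 := by
  by_contra! hΩ
  -- The exact form itself serves as the density. Naming it separately keeps it fixed when ζ is
  -- later rewritten as a sum of pieces.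
  obtain ⟨Ω, hΩdef⟩ : ∃ Ω, Ω = d E M N ζ := ⟨_, rfl⟩
  rw [← hΩdef] at hreal hΩ
  obtain ⟨b⟩ : Nonempty (Module.Basis (Fin (N + 1)) ℝ E) :=
    ⟨(Module.finBasis ℝ E).reindex (finCongr hN)⟩
  obtain ⟨ρ, hρ⟩ := SmoothPartitionOfUnity.exists_isSubordinate_chartAt_source 𝓘(ℝ, E) M
  obtain ⟨T, hmemT⟩ : ∃ T : Finset M, ∀ c x, ρ c x ≠ 0 → c ∈ T :=
    ⟨ρ.locallyFinite.finite_nonempty_of_compact.toFinset, fun c x h => by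
      rw [Set.Finite.mem_toFinset]
      exact ⟨x, h⟩⟩
  have hsum : ∀ x, ∑ c ∈ T, ρ c x = 1 := by
    intro x
    rw [← ρ.sum_eq_one (mem_univ x), finsum_eq_sum_of_support_subset]
    exact fun c hc => hmemT c x hc
  have hsum' : ∀ x, ∑ c ∈ T, (ρ c x : ℂ) = 1 := fun x => by
    rw [← Complex.ofReal_sum, hsum, Complex.ofReal_one]
  have hK : ∀ c, IsCompact (tsupport (ρ c)) := fun c => (isClosed_tsupport _).isCompact
  have hKc : ∀ c, tsupport (ρ c) ⊆ (extChartAt 𝓘(ℝ, E) c).source := fun c => by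
    rw [extChartAt_source]
    exact hρ c
  have hρ0 : ∀ c, ∀ x ∉ tsupport (ρ c), ρ c x = 0 := fun c x hx =>
    image_eq_zero_of_notMem_tsupport hx
  -- The pieces ρ_c ζ: they sum to ζ, so their differentials sum to Ω and the ratios to 1.
  obtain ⟨γ, hγdef⟩ : ∃ γ : M → Form E M N, ∀ c x v, (γ c).toFun x v = (ρ c x : ℂ) * ζ.toFun x v :=
    ⟨fun c => ζ.smulFun (ρ c) (ρ c).contMDiff, fun _ _ _ => rfl⟩
  have hγ : ∀ c, ∀ x ∉ tsupport (ρ c), (γ c).toFun x = 0 := by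
    intro c x hx
    ext v
    rw [hγdef, hρ0 c x hx, Complex.ofReal_zero, zero_mul]
    rfl
  have hζ : ζ = ∑ c ∈ T, γ c := by
    refine Form.ext (funext fun x => ?_)
    ext v
    rw [Form.sum_apply, Finset.sum_congr rfl fun c _ => hγdef c x v, ← Finset.sum_mul, hsum',
      one_mul]
  have hh : ∀ c, ∀ x ∉ tsupport (ρ c), ratio b Ω (d E M N (γ c)) x = 0 := by
    intro c x hx
    have : (d E M N (γ c)).toFun x = 0 := d_toFun_eq_zero (by
      filter_upwards [(isClosed_tsupport (ρ c)).isOpen_compl.mem_nhds hx] with z hz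
      exact hγ c z hz)
    rw [ratio, this]
    exact zero_div _
  have hhsum : ∀ x, ∑ c ∈ T, ratio b Ω (d E M N (γ c)) x = 1 := by
    intro x
    have h1 : Ω.toFun x b = ∑ c ∈ T, (d E M N (γ c)).toFun x b := by
      rw [hΩdef, hζ, map_sum]
      exact Form.sum_apply T (fun c => d E M N (γ c)) x b
    simp only [ratio]
    rw [← Finset.sum_div, ← h1]
    exact div_self (top_form_apply_ne_zero b hΩ x)
  let _ : MeasurableSpace E := borel E
  have _ : BorelSpace E := ⟨rfl⟩
  -- The integrals of the ρ_c have the same total as those of the ratios d(ρ_c ζ)/Ω, each of which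
  -- is zero by Stokes in a chart.
  have key : ∑ c ∈ T, chartIntegral b Ω c (fun x => (ρ c x : ℂ)) = 0 := by
    rw [sum_chartIntegral_eq_sum_chartIntegral (b := b) (Ω := Ω) T (r := fun c x => (ρ c x : ℂ))
      (h := fun c => ratio b Ω (d E M N (γ c))) hK hKc
      (fun c x hx => by rw [hρ0 c x hx, Complex.ofReal_zero]) hh hsum' hhsum
      (fun c c' => Complex.continuous_ofReal.comp_continuousOn
        ((ρ c').contMDiff.continuous.comp_continuousOn (continuousOn_extChartAt_symm c)))
      (fun c c' => continuousOn_ratio hΩ (d E M N (γ c')) c)]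
    exact Finset.sum_eq_zero fun c _ =>
      chartIntegral_ratio_d_eq_zero hΩ hreal c (hK c) (hKc c) (hγ c)
  obtain ⟨x₀⟩ := ‹Nonempty M›
  obtain ⟨c, hc⟩ : ∃ c, ρ c x₀ ≠ 0 := by
    by_contra! h0
    have := hsum x₀
    simp [h0] at this
  have key' := congrArg Complex.re key
  -- A zero sum of nonnegative terms has all its terms zero, yet a ρ_c that does not vanish at x₀
  -- has positive integral.
  rw [Complex.re_sum, Complex.zero_re, Finset.sum_eq_zero_iff_of_nonneg fun c _ =>
    re_chartIntegral_nonneg c (ρ.nonneg c)] at key'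
  exact (re_chartIntegral_pos (b := b) hΩ c (ρ c).contMDiff.continuous (ρ.nonneg c) (hK c) (hKc c)
    (hρ0 c) hc).ne' (key' c (hmemT c x₀ hc))

end Compact

end ComplexSymplectic

end

noncomputable section

namespace ComplexSymplectic

/-! ### Nonzero classes and ranks -/

section Classes

theorem definesNonzeroClass_of_notMem {W : Type*} [AddCommGroup W] [Module ℂ W]
    {Z B : Submodule ℂ W} {η : W} (hZ : η ∈ Z) (hB : η ∉ B) : DefinesNonzeroClass Z B η :=
  ⟨hZ, fun h => hB ((Submodule.Quotient.mk_eq_zero (B.submoduleOf Z)).mp h)⟩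

theorem DefinesNonzeroClass.one_le_rank {W : Type*} [AddCommGroup W] [Module ℂ W]
    {Z B : Submodule ℂ W} {η : W} (h : DefinesNonzeroClass Z B η) :
    1 ≤ Module.rank ℂ (Cohomology Z B) := by
  obtain ⟨hZ, hne⟩ := h
  exact Cardinal.one_le_iff_pos.mpr (rank_pos_iff_exists_ne_zero.mpr ⟨_, hne⟩)

end Classes

/-! ### Pairing with the complementary powers of σ -/

section ComplexSymplecticForm

variable {E : Type*} [NormedAddCommGroup E] [NormedSpace ℝ E] [FiniteDimensional ℝ E]
variable {M : Type*} [TopologicalSpace M] [ChartedSpace E M] [IsManifold 𝓘(ℝ, E) ∞ M]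

namespace ComplexStructure

variable {S : ComplexStructure E M}

/-- A form of complementary bidegree cannot pair a form in `S.projExact k p q` to a real form
without zeros. -/
theorem exists_wedge_toFun_eq_zero [CompactSpace M] [T2Space M] [Nonempty M] {k l : ℕ}
    {p q p' q' : ℤ} (hN : Module.finrank ℝ E = k + l) (hp : 0 ≤ p) (hq : 0 ≤ q) (hpq : p + q = k)
    (h : p + p' = q + q') {η : Form E M k} (hη : η ∈ S.projExact k p q) {θ : Form E M l}
    (hθ : θ ∈ S.bidegreeForms l p' q') (hd : d E M l θ = 0)
    (hreal : (η.wedge θ).conj = η.wedge θ) : ∃ x, (η.wedge θ).toFun x = 0 := by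
  cases k with
  | zero =>
    -- In degree 0 there are no coboundaries, so the product is identically zero and any point will
    -- do.
    obtain rfl : η = 0 := hη
    rw [Form.zero_wedge]
    exact ⟨Classical.arbitrary M, rfl⟩
  | succ k =>
    obtain ⟨γ, rfl⟩ := hη
    have key := S.proj_d_wedge_toFun hN hp hq hpq h γ hθ hd
    -- Up to the reindexing of its arguments, the product is d(γ ∧ θ), a real exact form of top
    -- degree.
    obtain ⟨x, hx⟩ := exists_d_toFun_eq_zero (N := k + l) (by omega) (γ.wedge θ) fun x v => by
      rw [key]
      exact congrArg (fun ζ : Form E M (k + 1 + l) => ζ.toFun x _) hreal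
    refine ⟨x, ?_⟩
    ext v
    have h0 := key x (v ∘ Fin.cast (Nat.add_right_comm k l 1))
    rw [hx] at h0
    exact h0.symm

variable {n : ℕ} {σ : Form E M 2}

theorem IsComplexSymplectic.exists_volume_element (hσ : S.IsComplexSymplectic σ)
    (hn : Module.finrank ℝ E = 4 * n) (x : M) :
    ∃ s ∈ ⋀[ℂ]^2 (E →L[ℝ] ℂ), ∃ s' ∈ ⋀[ℂ]^2 (E →L[ℝ] ℂ), toForm 2 s = σ.toFun x ∧
      toForm 2 s' = σ.conj.toFun x ∧ Commute s s' ∧ toForm (2 * n + 2 * n) (s ^ n * s' ^ n) ≠ 0 :=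
  let J : E →L[ℝ] E := S.J x
  let a : E [⋀^Fin 2]→L[ℝ] ℂ := σ.toFun x
  have hJ : ∀ v, J (J v) = -v := S.sq_eq_neg x
  have ha : a ∈ bidegree J 2 2 0 := hσ.bidegree_two_zero x
  have hnd : ∀ v, (∀ w, a ![v, w] = 0) → v = 0 := hσ.nondegenerate x
  ComplexSymplectic.exists_volume_element hJ hn ha hnd

/-- Conjugation exchanges `s` and `s'`; these commute and occur in the product with equal total
exponents. -/
theorem IsComplexSymplectic.conj_wedge (hσ : S.IsComplexSymplectic σ)
    (hn : Module.finrank ℝ E = 4 * n) {k m k' m' : ℕ} (h : k + k' = m + m') :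
    ((σ.powWedgeConjPow k m).wedge (σ.powWedgeConjPow k' m')).conj =
      (σ.powWedgeConjPow k m).wedge (σ.powWedgeConjPow k' m') := by
  rw [Form.conj_wedge, Form.conj_powWedgeConjPow, Form.conj_powWedgeConjPow]
  refine Form.ext (funext fun x => ?_)
  obtain ⟨s, hs, s', hs', h1, h2, hc, -⟩ := hσ.exists_volume_element hn x
  rw [Form.wedge_powWedgeConjPow_toFun σ x hs h1 hs' h2 hc,
    Form.wedge_powWedgeConjPow_toFun σ.conj x hs' h2 hs (σ.conj_conj.symm ▸ h1) hc.symm, h,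
    (hc.pow_pow _ _).eq]

/-- The total exponents are n and n, so at each point the product is the volume element s^n s'^n, up
to a cast of the degree. -/
theorem IsComplexSymplectic.wedge_toFun_ne_zero (hσ : S.IsComplexSymplectic σ)
    (hn : Module.finrank ℝ E = 4 * n) {k m k' m' : ℕ} (hk : k + k' = n) (hm : m + m' = n) (x : M) :
    ((σ.powWedgeConjPow k m).wedge (σ.powWedgeConjPow k' m')).toFun x ≠ 0 := by
  obtain ⟨s, hs, s', hs', h1, h2, hc, hne⟩ := hσ.exists_volume_element hn x
  rw [Form.wedge_powWedgeConjPow_toFun σ x hs h1 hs' h2 hc, hk, hm]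
  intro h0
  refine hne ?_
  ext v
  rw [← toForm_cast (show 2 * k + 2 * m + (2 * k' + 2 * m') = 2 * n + 2 * n by omega), h0]
  rfl

/-- The complementary form σ^{n-k} ∧ σ̄^{n-m} is closed and brings the type to the balanced (2n,
2n). Membership would give the real product σ^n ∧ σ̄^n a zero, which it does not have. -/
theorem IsComplexSymplectic.notMem_projExact [CompactSpace M] [T2Space M] [Nonempty M]
    (hσ : S.IsComplexSymplectic σ) (hn : Module.finrank ℝ E = 4 * n) {k m : ℕ} (hk : k ≤ n)
    (hm : m ≤ n) :
    σ.powWedgeConjPow k m ∉ S.projExact (2 * k + 2 * m) (2 * k : ℕ) (2 * m : ℕ) := by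
  intro h
  obtain ⟨k', rfl⟩ := Nat.exists_eq_add_of_le hk
  obtain ⟨m', hm'⟩ := Nat.exists_eq_add_of_le hm
  obtain ⟨x, hx⟩ := S.exists_wedge_toFun_eq_zero (by omega) (by omega) (by omega)
    (by push_cast; ring)
    (by push_cast; omega) h (S.powWedgeConjPow_mem_bidegreeForms hσ.bidegree_two_zero k' m')
    (d_powWedgeConjPow_eq_zero hσ.closed k' m') (hσ.conj_wedge hn hm')
  exact hσ.wedge_toFun_ne_zero hn rfl hm'.symm x hx

end ComplexStructure

end ComplexSymplecticForm

end ComplexSymplectic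

end

open ComplexSymplectic in
theorem theorem5p1 (n : ℕ) (M : Type*) [TopologicalSpace M] [T2Space M] [CompactSpace M]
    [Nonempty M] [ChartedSpace (EuclideanSpace ℝ (Fin (4 * n))) M]
    [IsManifold 𝓘(ℝ, EuclideanSpace ℝ (Fin (4 * n))) ∞ M]
    (S : ComplexStructure (EuclideanSpace ℝ (Fin (4 * n))) M)
    (σ : Form (EuclideanSpace ℝ (Fin (4 * n))) M 2) (hσ : S.IsComplexSymplectic σ)
    (k m : ℕ) (hk : k ≤ n) (hm : m ≤ n) :
    DefinesNonzeroClass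
      (deRhamCocycles (EuclideanSpace ℝ (Fin (4 * n))) M (2 * k + 2 * m))
      (deRhamCoboundaries (EuclideanSpace ℝ (Fin (4 * n))) M (2 * k + 2 * m))
      (σ.powWedgeConjPow k m) ∧
    DefinesNonzeroClass
      (S.dolbeaultCocycles (2 * k + 2 * m) (2 * k : ℕ) (2 * m : ℕ))
      (S.dolbeaultCoboundaries (2 * k + 2 * m) (2 * k : ℕ) (2 * m : ℕ))
      (σ.powWedgeConjPow k m) ∧
    DefinesNonzeroClass
      (S.delCocycles (2 * k + 2 * m) (2 * k : ℕ) (2 * m : ℕ))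
      (S.delCoboundaries (2 * k + 2 * m) (2 * k : ℕ) (2 * m : ℕ))
      (σ.powWedgeConjPow k m) ∧
    DefinesNonzeroClass
      (S.bottChernCocycles (2 * k + 2 * m) (2 * k : ℕ) (2 * m : ℕ))
      (S.bottChernCoboundaries (2 * k + 2 * m) (2 * k : ℕ) (2 * m : ℕ))
      (σ.powWedgeConjPow k m) ∧
    DefinesNonzeroClass
      (S.aeppliCocycles (2 * k + 2 * m) (2 * k : ℕ) (2 * m : ℕ))
      (S.aeppliCoboundaries (2 * k + 2 * m) (2 * k : ℕ) (2 * m : ℕ))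
      (σ.powWedgeConjPow k m) ∧
    1 ≤ Module.rank ℂ (S.DolbeaultCohomology (2 * k) (2 * m)) ∧
    1 ≤ Module.rank ℂ (S.DelCohomology (2 * k) (2 * m)) ∧
    1 ≤ Module.rank ℂ (S.BottChernCohomology (2 * k) (2 * m)) ∧
    1 ≤ Module.rank ℂ (S.AeppliCohomology (2 * k) (2 * m)) := by
  have hn : Module.finrank ℝ (EuclideanSpace ℝ (Fin (4 * n))) = 4 * n := finrank_euclideanSpace_fin
  have hη := S.powWedgeConjPow_mem_bidegreeForms hσ.bidegree_two_zero k m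
  have hd := d_powWedgeConjPow_eq_zero hσ.closed k m
  have hdel := S.del_eq_zero hη hd
  have hdelbar := S.delbar_eq_zero hη hd
  have hB := hσ.notMem_projExact hn hk hm
  -- The Aeppli coboundaries contain those of the Dolbeault, ∂- and Bott–Chern theories, so this one
  -- non-membership serves all four.
  have hA := fun h => hB (S.aeppliCoboundaries_le_projExact _ _ _ h)
  have h1 : DefinesNonzeroClass
      (S.dolbeaultCocycles (2 * k + 2 * m) (2 * k : ℕ) (2 * m : ℕ))
      (S.dolbeaultCoboundaries (2 * k + 2 * m) (2 * k : ℕ) (2 * m : ℕ))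
      (σ.powWedgeConjPow k m) :=
    definesNonzeroClass_of_notMem ⟨hη, hdelbar⟩ fun h =>
      hA (S.dolbeaultCoboundaries_le_aeppliCoboundaries _ _ _ h)
  have h2 : DefinesNonzeroClass
      (S.delCocycles (2 * k + 2 * m) (2 * k : ℕ) (2 * m : ℕ))
      (S.delCoboundaries (2 * k + 2 * m) (2 * k : ℕ) (2 * m : ℕ))
      (σ.powWedgeConjPow k m) :=
    definesNonzeroClass_of_notMem ⟨hη, hdel⟩ fun h =>
      hA (S.delCoboundaries_le_aeppliCoboundaries _ _ _ h)
  have h3 : DefinesNonzeroClass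
      (S.bottChernCocycles (2 * k + 2 * m) (2 * k : ℕ) (2 * m : ℕ))
      (S.bottChernCoboundaries (2 * k + 2 * m) (2 * k : ℕ) (2 * m : ℕ))
      (σ.powWedgeConjPow k m) :=
    definesNonzeroClass_of_notMem ⟨hη, hdel, hdelbar⟩ fun h =>
      hA (S.bottChernCoboundaries_le_aeppliCoboundaries _ _ _ h)
  have h4 : DefinesNonzeroClass
      (S.aeppliCocycles (2 * k + 2 * m) (2 * k : ℕ) (2 * m : ℕ))
      (S.aeppliCoboundaries (2 * k + 2 * m) (2 * k : ℕ) (2 * m : ℕ))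
      (σ.powWedgeConjPow k m) :=
    definesNonzeroClass_of_notMem
      ⟨hη, (congrArg (S.del (2 * k + 2 * m + 1)) hdelbar).trans (map_zero _)⟩ hA
  -- An exact form of pure type is its own component, so the de Rham case reduces to the same
  -- non-membership in `projExact`.
  exact ⟨definesNonzeroClass_of_notMem hd fun h =>
    hB (S.mem_projExact_of_mem_deRhamCoboundaries hη h), h1, h2, h3, h4,
    h1.one_le_rank, h2.one_le_rank, h3.one_le_rank, h4.one_le_rank⟩
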